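/- Let $(p_k)_{k\ge 0}$ be a probability distribution on $\{0,1,2,\dots\}$ with $p_0=p_1=0$ and $\sum_k p_k e^{\theta k}<\infty$ for some $\theta>0$. Put $b=\min\{k\ge 1: p_k>0\}$ and $B=\sup\{k\ge 1: p_k>0\}\in[b,\infty]$. Let $X$ be a symmetric real random variable with $E[X^2]=1$ such that, for some constant $\alpha>0$, $P(X>z)=\Theta(1)\,e^{-e^{z^\alpha}}$ as $z\to\infty$, that is, the quotient $P(X>z)/e^{-e^{z^\alpha}}$ stays between two positive constants for all large $z$. Consider the branching random walk started from one particle at the origin: its genealogical tree $\mathcal T$ (root $\rho$) is a Galton–Watson tree with offspring distribution $(p_k)$; given $\mathcal T$, its non-root vertices $v$ carry i.i.d. copies $X_v$ of $X$; the position $S_v$ of a vertex $v$ is the sum of the $X_u$ over all vertices $u\neq\rho$ on the path from $\rho$ to $v$, including $v$. Let $Z_n(E)$ be the number of vertices $v$ of generation $n$ with $S_v\in E$ and $\bar Z_n(E)=Z_n(E)/Z_n(\mathbb R)$. Let $\nu$ be the standard Gaussian measure on $\mathbb R$, let $A$ be a set in the algebra generated by the half-lines $(-\infty,x]$, $x\in\mathbb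 R$, with $\nu(A)>0$, and for $q\in(\nu(A),1)$ let $$I_A(q)=\inf\{|x|:\ x\in\mathbb R,\ \nu(A-x)\ge q\}\in[0,\infty],\qquad \inf\emptyset=\infty .$$ If $p\in(\nu(A),1)$ is such that $I_A(p)<\infty$ and the function $I_A$ is continuous at $p$, then $$\lim_{n\to\infty} n^{-\frac{\alpha}{2(\alpha+1)}}\log\Bigl[-\log P\bigl(\bar Z_n(\sqrt n A)\ge p\bigr)\Bigr]=\bigl(y_\alpha\, I_A(p)\,\log b\bigr)^{\frac{\alpha}{\alpha+1}},$$ where $y_\alpha=\dfrac{(1+\alpha)\log B}{(1+\alpha)\log B-\log b}$ if $B<\infty$, and $y_\alpha=1$ if $B=\infty$. -/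

import Mathlib

open MeasureTheory ProbabilityTheory Filter Topology Asymptotics
open scoped Pointwise ENNReal

noncomputable section

namespace BranchingRandomWalk

/-- The algebra `𝒜` of subsets of `ℝ` generated by the half-lines `(-∞, x]`. -/
def halfLineAlgebra : Set (Set ℝ) :=
  generateSetAlgebra (Set.range (Set.Iic : ℝ → Set ℝ))

/-- The standard Gaussian measure `ν` on `ℝ`, evaluated as a real number. -/
def nu (E : Set ℝ) : ℝ := (gaussianReal 0 1).real E

/-- `I_A(p) = inf {|x| : ν(A - x) ≥ p}`, with values in `[0, ∞]` (so `inf ∅ = ∞`). -/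
def rateI (A : Set ℝ) (p : ℝ) : ℝ≥0∞ :=
  sInf {r : ℝ≥0∞ | ∃ x : ℝ, p ≤ nu ((fun a => a - x) '' A) ∧ r = ENNReal.ofReal |x|}

/-- `b = min {k ≥ 1 : p_k > 0}`. -/
def minOffspring (off : PMF ℕ) : ℕ := sInf {k : ℕ | 1 ≤ k ∧ 0 < off k}

/-- `B = sup {k ≥ 1 : p_k > 0}`, possibly infinite. -/
def maxOffspring (off : PMF ℕ) : ℕ∞ := sSup {K : ℕ∞ | ∃ k : ℕ, 1 ≤ k ∧ 0 < off k ∧ K = (k : ℕ∞)}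

/-- `y_α = (1+α) log B / ((1+α) log B - log b)`, read as its limit `1` when `B = ∞`. -/
def yConst (off : PMF ℕ) (α : ℝ) : ℝ :=
  if maxOffspring off = ⊤ then 1
  else
    (1 + α) * Real.log ((maxOffspring off).toNat : ℝ) /
      ((1 + α) * Real.log ((maxOffspring off).toNat : ℝ) - Real.log (minOffspring off : ℝ))

/-! Vertices are Ulam-Harris words. A word is a list whose head is the most recent index: the root
is `[]` and the children of `u` are `0 :: u, 1 :: u, …`. -/

/-- The input of a branching random walk on a probability space: numbers of children `N u` with
law `off` and displacements `X u` with law `μ`, for all words `u`, all of them independent. -/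
structure IsBRW {Ω : Type*} [MeasurableSpace Ω] (P : Measure Ω) (off : PMF ℕ) (μ : Measure ℝ)
    (N : List ℕ → Ω → ℕ) (X : List ℕ → Ω → ℝ) : Prop where
  measurable_N : ∀ u, Measurable (N u)
  measurable_X : ∀ u, Measurable (X u)
  law_N : ∀ u, P.map (N u) = off.toMeasure
  law_X : ∀ u, P.map (X u) = μ
  indep_pair : ∀ u, IndepFun (N u) (X u) P
  indep : iIndepFun (fun (u : List ℕ) (ω : Ω) => (N u ω, X u ω)) P

/-- The vertices of generation `n` of the genealogical tree in which `u` has `c u` children. -/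
def generation (c : List ℕ → ℕ) : ℕ → Finset (List ℕ)
  | 0 => {[]}
  | n + 1 => (generation c n).biUnion fun u => (Finset.range (c u)).image fun i => i :: u

/-- The position `S_v`: the sum of the displacements along the path from the root (excluded)
to `v`. -/
def position (x : List ℕ → ℝ) : List ℕ → ℝ
  | [] => 0
  | i :: u => position x u + x (i :: u)

open Classical in
/-- `Z_n(E)`: the number of particles of generation `n` that lie in `E`. -/
def count (c : List ℕ → ℕ) (x : List ℕ → ℝ) (n : ℕ) (E : Set ℝ) : ℕ :=
  ((generation c n).filter fun v => position x v ∈ E).card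

/-- The empirical distribution `Z̄_n(E) = Z_n(E) / Z_n(ℝ)`. -/
def empirical (c : List ℕ → ℕ) (x : List ℕ → ℝ) (n : ℕ) (E : Set ℝ) : ℝ :=
  (count c x n E : ℝ) / (count c x n Set.univ : ℝ)

end BranchingRandomWalk

end

set_option linter.unusedSectionVars false
set_option linter.unusedVariables false

open MeasureTheory ProbabilityTheory Filter Topology Asymptotics
open scoped Pointwise ENNReal

noncomputable section

namespace BranchingRandomWalk

/-! The rare event is produced in the first `T` generations, with `T` of order `n ^ γ` and `γ = α /
(2 * (α + 1)) < 1 / 2`. Afterwards the subtrees rooted in generation `T`, at least `b ^ T` of them,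
obey a law of large numbers: each spreads like a Gaussian on the scale `√n` around the position of
its root. Up to an error `exp (-c b ^ T)`, reaching the proportion `p` therefore forces a fixed
positive proportion of generation `T` to lie at distance about `I_A(p) √n`. The question is how far
most of generation `T` can be moved at a price of about `b ^ T` in the exponent.

A displacement `z` costs `exp (z ^ α)` per vertex. Let the tree be `b`-ary, except that below one
vertex of generation `t` every vertex has `K` children, with `K ^ (T - t)` slightly larger than `b ^
T`. This branch makes up most of generation `T`, yet `j` generations before `T` it has only `K ^ (T
- t - j)` vertices, and a single one before generation `t`. So the price `b ^ T` per generation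
allows `z ^ α` to be about `min (T log b) (j log K)`. Summing over `j` gives a total displacement of
about `T (T log b) ^ (1 / α) (1 - log b / ((1 + α) log K))`. The last factor is `1 / y_α` for `K =
B`, and it tends to `1` for large `K` when `B = ∞`. Equating the total with `I_A(p) √n` gives `T = κ
n ^ γ`, and the limit is `κ log b`.

The lower bound of the probability realises this strategy: `eventually_exists_profile` provides the
displacements, `IsBRW.le_measureReal_branchEvent` prices them, and `IsBRW.le_measureReal_empirical`
shows that they suffice. The upper bound says that nothing cheaper works: a vertex `j` generations
before `T` has at most `B ^ j` descendants there, so many large displacements are needed to move a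
positive proportion (`eventually_measure_far_le_of_bounded`, and `eventually_measure_far_le` when `B
= ∞`). If few particles are far away, `IsBRW.measure_empirical_inter_le` applies. Both laws of large
numbers rest on the uniform exponential moments of `exists_lintegral_exp_treeSum_le`. Continuity of
`I_A` at `p` leaves strict gaps on both sides, and `tendsto_loglog` combines the two bounds. -/

/-! ### Deterministic trees -/

/-- The configuration seen from the vertex `v`. -/
def shift {β : Type*} (v : List ℕ) (c : List ℕ → β) : List ℕ → β := fun w => c (w ++ v)

/-- The sum of `f` over the positions of the particles of generation `k`. -/
def treeSum (c : List ℕ → ℕ) (x : List ℕ → ℝ) (k : ℕ) (f : ℝ → ℝ) : ℝ :=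
  ∑ w ∈ generation c k, f (position x w)

lemma generation_zero (c : List ℕ → ℕ) : generation c 0 = {[]} := rfl

lemma length_of_mem_generation {c : List ℕ → ℕ} {k : ℕ} {w : List ℕ} (h : w ∈ generation c k) :
    w.length = k := by
  induction k generalizing w with
  | zero => simp only [generation, Finset.mem_singleton] at h; simp [h]
  | succ k ih =>
    simp only [generation, Finset.mem_biUnion, Finset.mem_image, Finset.mem_range] at h
    obtain ⟨u, hu, i, -, rfl⟩ := h
    simp [ih hu]

lemma nil_mem_generation {c : List ℕ → ℕ} {k : ℕ} : [] ∈ generation c k ↔ k = 0 := by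
  constructor
  · intro h; simpa using (length_of_mem_generation h).symm
  · rintro rfl; simp [generation]

lemma cons_mem_generation {c : List ℕ → ℕ} {k : ℕ} {i : ℕ} {u : List ℕ} :
    i :: u ∈ generation c (k + 1) ↔ u ∈ generation c k ∧ i < c u := by
  simp only [generation, Finset.mem_biUnion, Finset.mem_image, Finset.mem_range]
  constructor
  · rintro ⟨u', hu, j, hj, h⟩
    obtain ⟨rfl, rfl⟩ := List.cons.inj h
    exact ⟨hu, hj⟩
  · rintro ⟨hu, hi⟩
    exact ⟨u, hu, i, hi, rfl⟩

/-- The head of a word is the most recent index, so descendants of `v` are the words `w ++ v` and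
ancestors are suffixes. This is the deterministic form of the branching property. -/
lemma append_mem_generation {c : List ℕ → ℕ} {k T : ℕ} {w v : List ℕ}
    (hw : w.length = k) :
    w ++ v ∈ generation c (k + T) ↔ v ∈ generation c T ∧ w ∈ generation (shift v c) k := by
  induction k generalizing w with
  | zero => simp [List.length_eq_zero_iff.1 hw, nil_mem_generation]
  | succ k ih =>
    match w, hw with
    | i :: w, hw =>
      rw [List.cons_append, Nat.add_right_comm, cons_mem_generation, cons_mem_generation,
        ih (by simpa using hw), and_assoc]
      rfl

lemma position_append (x : List ℕ → ℝ) (w v : List ℕ) :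
    position x (w ++ v) = position x v + position (shift v x) w := by
  induction w with
  | nil => simp [position]
  | cons i w ih => simp only [List.cons_append, position, ih, shift]; ring

lemma sum_generation_succ {β : Type*} [AddCommMonoid β] (c : List ℕ → ℕ) (k : ℕ)
    (f : List ℕ → β) :
    ∑ u ∈ generation c (k + 1), f u = ∑ u ∈ generation c k, ∑ i ∈ Finset.range (c u), f (i :: u) := by
  rw [generation, Finset.sum_biUnion]
  · refine Finset.sum_congr rfl fun u _ => Finset.sum_image ?_
    intro a _ b _ h
    exact (List.cons.inj h).1
  · intro u _ u' _ hne
    simp only [Function.onFun, Finset.disjoint_left, Finset.mem_image, Finset.mem_range]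
    rintro _ ⟨i, -, rfl⟩ ⟨j, -, h⟩
    exact hne (List.cons.inj h).2.symm

lemma sum_generation_add {β : Type*} [AddCommMonoid β] (c : List ℕ → ℕ) (k T : ℕ)
    (f : List ℕ → β) :
    ∑ u ∈ generation c (k + T), f u
      = ∑ v ∈ generation c T, ∑ w ∈ generation (shift v c) k, f (w ++ v) := by
  induction k generalizing f with
  | zero => simp [generation]
  | succ k ih =>
    rw [Nat.add_right_comm, sum_generation_succ, ih]
    refine Finset.sum_congr rfl fun v _ => ?_
    rw [sum_generation_succ]
    rfl

/-- Cutting at generation `T` writes an additive functional as a sum over subtrees, which are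
independent once the first `T` generations are fixed. The event that the empirical proportion
reaches `p` is handled as a sign condition on such a functional. -/
lemma treeSum_add (c : List ℕ → ℕ) (x : List ℕ → ℝ) (k T : ℕ) (f : ℝ → ℝ) :
    treeSum c x (k + T) f = ∑ v ∈ generation c T,
      treeSum (shift v c) (shift v x) k (fun s => f (position x v + s)) := by
  simp only [treeSum, sum_generation_add, position_append]

lemma count_eq_treeSum (c : List ℕ → ℕ) (x : List ℕ → ℝ) (k : ℕ) (E : Set ℝ) :
    (count c x k E : ℝ) = treeSum c x k (E.indicator 1) := by
  classical
  simp [count, treeSum, Set.indicator_apply]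

lemma card_eq_treeSum (c : List ℕ → ℕ) (x : List ℕ → ℝ) (k : ℕ) :
    ((generation c k).card : ℝ) = treeSum c x k (fun _ => 1) := by
  simp [treeSum]

lemma abs_treeSum_le (c : List ℕ → ℕ) (x : List ℕ → ℝ) (k : ℕ) {f : ℝ → ℝ}
    (hf : ∀ s, |f s| ≤ 1) : |treeSum c x k f| ≤ (generation c k).card := by
  refine (Finset.abs_sum_le_sum_abs _ _).trans ?_
  calc _ ≤ ∑ w ∈ generation c k, (1 : ℝ) := Finset.sum_le_sum fun w _ => hf _
    _ = _ := by simp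

lemma generation_congr {c d : List ℕ → ℕ} {k : ℕ}
    (h : ∀ j < k, ∀ u ∈ generation d j, c u = d u) : generation c k = generation d k := by
  induction k with
  | zero => rfl
  | succ k ih =>
    have hk := ih fun j hj => h j (hj.trans (Nat.lt_succ_self k))
    ext v
    match v with
    | [] => simp [nil_mem_generation]
    | i :: u =>
      rw [cons_mem_generation, cons_mem_generation, hk]
      refine and_congr_right fun hu => ?_
      rw [h k (Nat.lt_succ_self k) u hu]

lemma card_generation_const (b k : ℕ) : (generation (fun _ => b) k).card = b ^ k := by
  induction k with
  | zero => simp [generation]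
  | succ k ih =>
    have := sum_generation_succ (fun _ => b) k (fun _ => 1)
    simp only [Finset.sum_const, smul_eq_mul, mul_one, Finset.card_range] at this
    rw [this, ih, pow_succ]

lemma generation_mono {c d : List ℕ → ℕ} (k : ℕ) (h : ∀ j < k, ∀ u ∈ generation c j, c u ≤ d u) :
    generation c k ⊆ generation d k := by
  induction k with
  | zero => exact Finset.Subset.refl _
  | succ k ih =>
    intro v hv
    match v with
    | [] => simp [nil_mem_generation] at hv
    | i :: u =>
      rw [cons_mem_generation] at hv ⊢
      exact ⟨ih (fun j hj => h j (by omega)) hv.1, hv.2.trans_le (h k (by omega) u hv.1)⟩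

lemma pow_le_card_generation {c : List ℕ → ℕ} {b : ℕ} (h : ∀ u, b ≤ c u) (k : ℕ) :
    b ^ k ≤ (generation c k).card := by
  rw [← card_generation_const b k]
  exact Finset.card_le_card (generation_mono k fun _ _ u _ => h u)

lemma drop_mem_generation {c : List ℕ → ℕ} {j k : ℕ} {v : List ℕ} (hv : v ∈ generation c (j + k)) :
    v.drop j ∈ generation c k := by
  have hl := length_of_mem_generation hv
  rw [← List.take_append_drop j v] at hv
  exact ((append_mem_generation (by simp; omega)).1 hv).1

/-! ### Measurability -/

section Measurability

instance : MeasurableSpace (Finset (List ℕ)) := ⊤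

variable {Ω : Type*} {m : MeasurableSpace Ω} {c : Ω → List ℕ → ℕ} {x : Ω → List ℕ → ℝ}

lemma measurableSet_mem_generation {k : ℕ} (hc : ∀ u : List ℕ, u.length < k →
    Measurable fun ω => c ω u) (u : List ℕ) : MeasurableSet {ω | u ∈ generation (c ω) k} := by
  induction k generalizing u with
  | zero => simp [generation]
  | succ k ih =>
    match u with
    | [] => simp [nil_mem_generation]
    | i :: u =>
      simp only [cons_mem_generation, Set.ofPred_and]
      by_cases hu : u.length = k
      · exact (ih (fun u hu => hc u (by omega)) u).inter
          (measurableSet_lt measurable_const (hc u (by omega)))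
      · convert! MeasurableSet.empty
        ext ω
        simp only [Set.mem_inter_iff, Set.mem_ofPred_eq, Set.mem_empty_iff_false, iff_false]
        exact fun h => hu (length_of_mem_generation h.1)

lemma measurable_generation {k : ℕ} (hc : ∀ u : List ℕ, u.length < k →
    Measurable fun ω => c ω u) : Measurable fun ω => generation (c ω) k := by
  refine measurable_to_countable' fun g => ?_
  have : (fun ω => generation (c ω) k) ⁻¹' {g} =
      ⋂ u : List ℕ, {ω | u ∈ generation (c ω) k ↔ u ∈ g} := by
    ext ω
    simp [Finset.ext_iff]
  rw [this]
  refine MeasurableSet.iInter fun u => ?_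
  by_cases hu : u ∈ g
  · simpa [hu] using measurableSet_mem_generation hc u
  · simp only [hu, iff_false]
    exact (measurableSet_mem_generation hc u).compl

lemma measurable_position {k : ℕ} (hx : ∀ u : List ℕ, u ≠ [] → u.length ≤ k →
    Measurable fun ω => x ω u) (w : List ℕ) (hw : w.length ≤ k) :
    Measurable fun ω => position (x ω) w := by
  induction w with
  | nil => exact measurable_const
  | cons i w ih =>
    exact (ih (by simp at hw; omega)).add (hx _ (by simp) hw)

lemma measurable_sum_generation {β : Type*} [MeasurableSpace β] [AddCommMonoid β]
    [MeasurableAdd₂ β] {k : ℕ} (hc : ∀ u : List ℕ, u.length < k → Measurable fun ω => c ω u)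
    {a : List ℕ → Ω → β} (ha : ∀ w : List ℕ, w.length = k → Measurable (a w)) :
    Measurable fun ω => ∑ w ∈ generation (c ω) k, a w ω := by
  classical
  -- The random index set takes countably many values, so joint measurability can be checked for
  -- each fixed set. Words of length other than `k` get the value zero because nothing is known
  -- about their terms.
  have h1 : Measurable fun p : Finset (List ℕ) × Ω =>
      ∑ w ∈ p.1, if w.length = k then a w p.2 else 0 := by
    refine measurable_from_prod_countable_right fun g => ?_
    refine Finset.measurable_fun_sum _ fun w _ => ?_
    by_cases hw : w.length = k
    · simpa [hw] using ha w hw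
    · simp [hw]
  have h2 := h1.comp ((measurable_generation hc).prodMk measurable_id)
  convert! h2 using 2 with ω
  refine Finset.sum_congr rfl fun w hw => ?_
  simp [length_of_mem_generation hw]

lemma measurable_treeSum {k : ℕ} (hc : ∀ u, Measurable fun ω => c ω u)
    (hx : ∀ u, u ≠ [] → Measurable fun ω => x ω u) {f : ℝ → ℝ} (hf : Measurable f) :
    Measurable fun ω => treeSum (c ω) (x ω) k f :=
  measurable_sum_generation (fun u _ => hc u) fun w _ =>
    hf.comp (measurable_position (k := w.length) (fun u hu _ => hx u hu) w le_rfl)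

end Measurability

/-! ### Independence -/

section Independence

variable {Ω : Type*} [mΩ : MeasurableSpace Ω] {P : Measure Ω} [IsProbabilityMeasure P] {off : PMF ℕ}
  {μ : Measure ℝ} {N : List ℕ → Ω → ℕ} {X : List ℕ → Ω → ℝ}

/-- The σ-algebras generated by the single inputs: `(u, true)` stands for the number of children
of `u` and `(u, false)` for its displacement. -/
@[reducible]
def inputSigma (N : List ℕ → Ω → ℕ) (X : List ℕ → Ω → ℝ) : List ℕ × Bool → MeasurableSpace Ω
  | (u, true) => MeasurableSpace.comap (N u) inferInstance
  | (u, false) => MeasurableSpace.comap (X u) inferInstance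

/-- The σ-algebra generated by the inputs with index in `S`. -/
@[reducible]
def sigma (N : List ℕ → Ω → ℕ) (X : List ℕ → Ω → ℝ) (S : Set (List ℕ × Bool)) :
    MeasurableSpace Ω := ⨆ i ∈ S, inputSigma N X i

lemma measurable_sigma_N {S : Set (List ℕ × Bool)} {u : List ℕ} (h : (u, true) ∈ S) :
    Measurable[sigma N X S] (N u) :=
  Measurable.mono (comap_measurable (N u)) (le_biSup (inputSigma N X) h) le_rfl

lemma measurable_sigma_X {S : Set (List ℕ × Bool)} {u : List ℕ} (h : (u, false) ∈ S) :
    Measurable[sigma N X S] (X u) :=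
  Measurable.mono (comap_measurable (X u)) (le_biSup (inputSigma N X) h) le_rfl

lemma sigma_mono {S S' : Set (List ℕ × Bool)} (h : S ⊆ S') : sigma N X S ≤ sigma N X S' :=
  biSup_mono h

namespace IsBRW

lemma inputSigma_le (h : IsBRW P off μ N X) (i : List ℕ × Bool) : inputSigma N X i ≤ mΩ := by
  obtain ⟨u, _ | _⟩ := i
  · exact (h.measurable_X u).comap_le
  · exact (h.measurable_N u).comap_le

lemma sigma_le (h : IsBRW P off μ N X) (S : Set (List ℕ × Bool)) : sigma N X S ≤ mΩ :=
  iSup₂_le fun i _ => h.inputSigma_le i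

/-- Independence of the pairs, together with independence inside each pair, separates all single
inputs. This is needed because a cut at generation `T` runs through the pairs: the displacement of a
vertex there belongs to the past, its offspring number to the future. -/
lemma iIndep_inputSigma (h : IsBRW P off μ N X) : iIndep (inputSigma N X) P := by
  classical
  rw [iIndep_iff]
  intro s f hf
  -- Padding with `univ` gives every vertex involved both of its inputs, so that the intersection
  -- can be grouped by vertices.
  set g : List ℕ × Bool → Set Ω := fun i => if i ∈ s then f i else Set.univ with hg
  have hgm : ∀ i, MeasurableSet[inputSigma N X i] (g i) := by
    intro i
    by_cases hi : i ∈ s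
    · simpa [hg, hi] using hf i hi
    · simp [hg, hi]
  set U : Finset (List ℕ) := s.image Prod.fst with hU
  have hsub : s ⊆ U ×ˢ Finset.univ := by
    intro i hi
    simp only [Finset.mem_product, Finset.mem_univ, and_true, hU]
    exact Finset.mem_image_of_mem _ hi
  have h1 : (⋂ i ∈ s, f i) = ⋂ u ∈ U, (g (u, true) ∩ g (u, false)) := by
    ext ω
    simp only [Set.mem_iInter, Set.mem_inter_iff, hg]
    constructor
    · intro hω u _
      constructor <;> split_ifs with hu
      · exact hω _ hu
      · trivial
      · exact hω _ hu
      · trivial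
    · rintro hω ⟨u, b⟩ hi
      have := hω u (Finset.mem_image_of_mem _ hi)
      cases b
      · simpa [hi] using this.2
      · simpa [hi] using this.1
  have h2 : ∏ i ∈ s, P (f i) = ∏ u ∈ U, (P (g (u, true)) * P (g (u, false))) := by
    have : ∏ i ∈ s, P (f i) = ∏ i ∈ U ×ˢ Finset.univ, P (g i) := by
      rw [← Finset.prod_subset hsub]
      · exact Finset.prod_congr rfl fun i hi => by simp [hg, hi]
      · intro i _ hi
        simp [hg, hi]
    rw [this, Finset.prod_product]
    simp
  rw [h1, h2]
  have key := h.indep.meas_biInter (S := U) (s := fun u => g (u, true) ∩ g (u, false)) ?_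
  · rw [key]
    refine Finset.prod_congr rfl fun u _ => ?_
    exact (Indep_iff _ _ _).1 (h.indep_pair u) _ _ (hgm (u, true)) (hgm (u, false))
  · intro u _
    have hN : MeasurableSpace.comap (N u) inferInstance ≤
        MeasurableSpace.comap (fun ω => (N u ω, X u ω)) inferInstance :=
      (measurable_fst.comp (comap_measurable fun ω => (N u ω, X u ω))).comap_le
    have hX : MeasurableSpace.comap (X u) inferInstance ≤
        MeasurableSpace.comap (fun ω => (N u ω, X u ω)) inferInstance :=
      (measurable_snd.comp (comap_measurable fun ω => (N u ω, X u ω))).comap_le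
    exact (hN _ (hgm (u, true))).inter (hX _ (hgm (u, false)))

lemma indep_sigma (h : IsBRW P off μ N X) {S S' : Set (List ℕ × Bool)} (hS : Disjoint S S') :
    Indep (sigma N X S) (sigma N X S') P :=
  indep_iSup_of_disjoint h.inputSigma_le h.iIndep_inputSigma hS

lemma lintegral_mul (h : IsBRW P off μ N X) {S S' : Set (List ℕ × Bool)} (hS : Disjoint S S')
    {f g : Ω → ℝ≥0∞} (hf : Measurable[sigma N X S] f) (hg : Measurable[sigma N X S'] g) :
    ∫⁻ ω, f ω * g ω ∂P = (∫⁻ ω, f ω ∂P) * ∫⁻ ω, g ω ∂P :=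
  lintegral_mul_eq_lintegral_mul_lintegral_of_independent_measurableSpace (h.sigma_le S)
    (h.sigma_le S') (h.indep_sigma hS) hf hg

lemma lintegral_prod {ι : Type*} (h : IsBRW P off μ N X) (s : Finset ι)
    {S : ι → Set (List ℕ × Bool)} (hS : ∀ i ∈ s, ∀ j ∈ s, i ≠ j → Disjoint (S i) (S j))
    {f : ι → Ω → ℝ≥0∞} (hf : ∀ i ∈ s, Measurable[sigma N X (S i)] (f i)) :
    ∫⁻ ω, ∏ i ∈ s, f i ω ∂P = ∏ i ∈ s, ∫⁻ ω, f i ω ∂P := by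
  classical
  induction s using Finset.induction_on with
  | empty => simp
  | insert a s ha ih =>
    simp only [Finset.prod_insert ha]
    rw [h.lintegral_mul (S := S a) (S' := ⋃ i ∈ s, S i), ih]
    · intro i hi j hj; exact hS i (by simp [hi]) j (by simp [hj])
    · intro i hi; exact hf i (by simp [hi])
    · rw [Set.disjoint_iUnion₂_right]
      intro i hi
      exact hS a (by simp) i (by simp [hi]) (by rintro rfl; exact ha hi)
    · exact hf a (by simp)
    · refine Finset.measurable_fun_prod s fun i hi => ?_
      exact (hf i (by simp [hi])).mono (sigma_mono (Set.subset_biUnion_of_mem (u := S) hi)) le_rfl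

lemma shift (h : IsBRW P off μ N X) (v : List ℕ) :
    IsBRW P off μ (fun u => N (u ++ v)) (fun u => X (u ++ v)) where
  measurable_N u := h.measurable_N _
  measurable_X u := h.measurable_X _
  law_N u := h.law_N _
  law_X u := h.law_X _
  indep_pair u := h.indep_pair _
  indep := h.indep.precomp (g := fun u => u ++ v) fun a b hab => List.append_cancel_right hab

end IsBRW

/-- The indices of the inputs of the subtree of `v` (without the displacement of `v`). -/
def subtreeIndex (v : List ℕ) : Set (List ℕ × Bool) :=
  {i | ∃ w : List ℕ, i.1 = w ++ v ∧ (i.2 = false → w ≠ [])}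

/-- The indices of the inputs that determine the first `T` generations. -/
def pastIndex (T : ℕ) : Set (List ℕ × Bool) :=
  {i | i.1.length ≤ T ∧ (i.2 = true → i.1.length < T)}

lemma disjoint_subtreeIndex {v v' : List ℕ} (hl : v.length = v'.length) (hne : v ≠ v') :
    Disjoint (subtreeIndex v) (subtreeIndex v') := by
  rw [Set.disjoint_left]
  rintro i ⟨w, hw, -⟩ ⟨w', hw', -⟩
  exact hne (List.append_inj_right' (hw.symm.trans hw') hl)

/-- The two conventions fit: the displacement of `v` is counted in the past and its offspring number
in the subtree. -/
lemma disjoint_pastIndex_subtreeIndex (v : List ℕ) :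
    Disjoint (pastIndex v.length) (subtreeIndex v) := by
  rw [Set.disjoint_left]
  rintro ⟨u, b⟩ ⟨h1, h2⟩ ⟨w, rfl : u = w ++ v, hw⟩
  cases b
  · have := List.length_pos_iff.2 (hw rfl)
    simp at h1
    exact hw rfl h1
  · have := h2 rfl
    simp at this

lemma measurable_treeSum_subtree (v : List ℕ) (k : ℕ) {f : ℝ → ℝ} (hf : Measurable f) :
    Measurable[sigma N X (subtreeIndex v)] fun ω =>
      treeSum (fun u => N (u ++ v) ω) (fun u => X (u ++ v) ω) k f := by
  refine measurable_treeSum (m := sigma N X (subtreeIndex v)) ?_ ?_ hf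
  · intro u
    exact measurable_sigma_N ⟨u, rfl, by simp⟩
  · intro u hu
    exact measurable_sigma_X ⟨u, rfl, fun _ => hu⟩

end Independence

/-! ### Moments -/

/-- The law of the position of a particle of generation `n`. -/
def walkLaw (μ : Measure ℝ) : ℕ → Measure ℝ
  | 0 => Measure.dirac 0
  | n + 1 => (walkLaw μ n).conv μ

instance (μ : Measure ℝ) [IsProbabilityMeasure μ] (n : ℕ) : IsProbabilityMeasure (walkLaw μ n) := by
  induction n with
  | zero => rw [walkLaw]; infer_instance
  | succ n ih => rw [walkLaw]; infer_instance

section Moments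

variable {Ω : Type*} [mΩ : MeasurableSpace Ω] {P : Measure Ω} [IsProbabilityMeasure P] {off : PMF ℕ}
  {μ : Measure ℝ} [IsProbabilityMeasure μ] {N : List ℕ → Ω → ℕ} {X : List ℕ → Ω → ℝ}

namespace IsBRW

lemma map_position (h : IsBRW P off μ N X) (w : List ℕ) :
    P.map (fun ω => position (fun u => X u ω) w) = walkLaw μ w.length := by
  induction w with
  | nil => simp [position, walkLaw]
  | cons i u ih =>
    have hp : Measurable[sigma N X {i | i.1.length ≤ u.length ∧ i.2 = false}]
        fun ω => position (fun u => X u ω) u :=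
      measurable_position (m := sigma N X _) (k := u.length)
        (fun w _ hw => measurable_sigma_X
          (S := {i | i.1.length ≤ u.length ∧ i.2 = false}) ⟨hw, rfl⟩) u le_rfl
    have hX : Measurable[sigma N X {(i :: u, false)}] (X (i :: u)) := measurable_sigma_X (by simp)
    have hd : Disjoint {i : List ℕ × Bool | i.1.length ≤ u.length ∧ i.2 = false}
        {(i :: u, false)} := by simp
    have hi : IndepFun (fun ω => position (fun u => X u ω) u) (X (i :: u)) P :=
      indep_of_indep_of_le_left (indep_of_indep_of_le_right (h.indep_sigma hd) hX.comap_le)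
        hp.comap_le
    have := hi.map_add_eq_map_conv_map (hp.mono (h.sigma_le _) le_rfl) (h.measurable_X _)
    rw [ih, h.law_X] at this
    exact this

/-- A many-to-one formula: membership of a word in the tree depends on offspring numbers only and
the summand on displacements only, so the expectation factors word by word. -/
lemma lintegral_sum_generation_of_forall (h : IsBRW P off μ N X) (k : ℕ) {a : List ℕ → Ω → ℝ≥0∞}
    {κ : ℝ≥0∞} (ha : ∀ w, Measurable[sigma N X {i | i.2 = false}] (a w))
    (hκ : ∀ w : List ℕ, w.length = k → ∫⁻ ω, a w ω ∂P = κ) :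
    ∫⁻ ω, ∑ w ∈ generation (fun u => N u ω) k, a w ω ∂P =
      (∫⁻ ω, ((generation (fun u => N u ω) k).card : ℝ≥0∞) ∂P) * κ := by
  classical
  have hsum (ω : Ω) (a : List ℕ → ℝ≥0∞) : ∑ w ∈ generation (fun u => N u ω) k, a w =
      ∑' w, (if w ∈ generation (fun u => N u ω) k then 1 else 0) * a w := by
    rw [tsum_eq_sum (s := generation (fun u => N u ω) k)]
    · exact Finset.sum_congr rfl fun w hw => by simp [hw]
    · intro w hw; simp [hw]
  have hcard (ω : Ω) : ((generation (fun u => N u ω) k).card : ℝ≥0∞) =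
      ∑' w, (if w ∈ generation (fun u => N u ω) k then 1 else 0) := by
    have := hsum ω (fun _ => 1)
    simpa using this
  have hmem (w : List ℕ) : Measurable[sigma N X {i | i.2 = true}]
      fun ω => (if w ∈ generation (fun u => N u ω) k then (1 : ℝ≥0∞) else 0) :=
    Measurable.ite (measurableSet_mem_generation (m := sigma N X _)
      (fun u _ => measurable_sigma_N (S := {i | i.2 = true}) rfl) w) measurable_const
      measurable_const
  simp only [hsum, hcard]
  rw [lintegral_tsum, lintegral_tsum, ← ENNReal.tsum_mul_right]
  · refine tsum_congr fun w => ?_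
    by_cases hw : w.length = k
    · rw [h.lintegral_mul _ (hmem w) (ha w), hκ w hw]
      rw [Set.disjoint_left]
      intro i hi hi'
      simp_all
    · have (ω : Ω) : w ∉ generation (fun u => N u ω) k := fun hm =>
        hw (length_of_mem_generation hm)
      simp [this]
  · exact fun w => ((hmem w).mono (h.sigma_le _) le_rfl).aemeasurable
  · exact fun w => (((hmem w).mono (h.sigma_le _) le_rfl).mul
      ((ha w).mono (h.sigma_le _) le_rfl)).aemeasurable

lemma lintegral_sum_generation (h : IsBRW P off μ N X) (k : ℕ) {g : ℝ → ℝ≥0∞}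
    (hg : Measurable g) :
    ∫⁻ ω, ∑ w ∈ generation (fun u => N u ω) k, g (position (fun u => X u ω) w) ∂P =
      (∫⁻ ω, ((generation (fun u => N u ω) k).card : ℝ≥0∞) ∂P) * ∫⁻ s, g s ∂walkLaw μ k := by
  refine h.lintegral_sum_generation_of_forall k (fun w => ?_) fun w hw => ?_
  · exact hg.comp (measurable_position (m := sigma N X _) (k := w.length)
      (fun u _ _ => measurable_sigma_X (S := {i | i.2 = false}) rfl) w le_rfl)
  · rw [← hw, ← h.map_position w, lintegral_map hg]
    exact measurable_position (k := w.length) (fun u _ _ => h.measurable_X u) w le_rfl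

lemma measure_N_eq (h : IsBRW P off μ N X) (u : List ℕ) (k : ℕ) : P {ω | N u ω = k} = off k := by
  have : (P.map (N u)) {k} = off.toMeasure {k} := by rw [h.law_N u]
  rw [Measure.map_apply (h.measurable_N u) (measurableSet_singleton k),
    PMF.toMeasure_apply_singleton _ _ (measurableSet_singleton k)] at this
  exact this

lemma lintegral_N (h : IsBRW P off μ N X) (u : List ℕ) (g : ℕ → ℝ≥0∞) :
    ∫⁻ ω, g (N u ω) ∂P = ∑' k, off k * g k := by
  rw [← lintegral_map (f := g) (measurable_of_countable g) (h.measurable_N u), h.law_N,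
    lintegral_countable']
  refine tsum_congr fun k => ?_
  rw [PMF.toMeasure_apply_singleton _ _ (measurableSet_singleton k), mul_comm]

lemma lintegral_card_generation (h : IsBRW P off μ N X) (k : ℕ) :
    ∫⁻ ω, ((generation (fun u => N u ω) k).card : ℝ≥0∞) ∂P = (∑' j : ℕ, off j * (j : ℝ≥0∞)) ^ k := by
  classical
  induction k with
  | zero => simp [generation]
  | succ k ih =>
    have hcard (ω : Ω) : ((generation (fun u => N u ω) (k + 1)).card : ℝ≥0∞) =
        ∑' w, (if w ∈ generation (fun u => N u ω) k then 1 else 0) * (N w ω : ℝ≥0∞) := by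
      have := sum_generation_succ (fun u => N u ω) k (fun _ => (1 : ℝ≥0∞))
      simp only [Finset.sum_const, nsmul_eq_mul, mul_one, Finset.card_range] at this
      rw [this, tsum_eq_sum (s := generation (fun u => N u ω) k)]
      · exact Finset.sum_congr rfl fun w hw => by simp [hw]
      · intro w hw; simp [hw]
    have hcard' (ω : Ω) : ((generation (fun u => N u ω) k).card : ℝ≥0∞) =
        ∑' w, (if w ∈ generation (fun u => N u ω) k then 1 else 0) := by
      rw [tsum_eq_sum (s := generation (fun u => N u ω) k)]
      · simp
      · intro w hw; simp [hw]
    have hmem (w : List ℕ) : Measurable[sigma N X {i | i.1.length < k}]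
        fun ω => (if w ∈ generation (fun u => N u ω) k then (1 : ℝ≥0∞) else 0) :=
      Measurable.ite (measurableSet_mem_generation (m := sigma N X _)
        (fun u hu => measurable_sigma_N (S := {i | i.1.length < k}) hu) w) measurable_const
        measurable_const
    have hN (w : List ℕ) : Measurable[sigma N X {(w, true)}] fun ω => (N w ω : ℝ≥0∞) :=
      (measurable_of_countable (fun j : ℕ => (j : ℝ≥0∞))).comp (measurable_sigma_N (by simp))
    simp only [hcard]
    rw [lintegral_tsum, pow_succ, ← ih]
    · simp only [hcard']
      rw [lintegral_tsum, ← ENNReal.tsum_mul_right]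
      · refine tsum_congr fun w => ?_
        by_cases hw : w.length = k
        · rw [h.lintegral_mul _ (hmem w) (hN w), h.lintegral_N w (fun j => (j : ℝ≥0∞))]
          simp [hw]
        · have (ω : Ω) : w ∉ generation (fun u => N u ω) k := fun hm =>
            hw (length_of_mem_generation hm)
          simp [this]
      · exact fun w => ((hmem w).mono (h.sigma_le _) le_rfl).aemeasurable
    · exact fun w => (((hmem w).mono (h.sigma_le _) le_rfl).mul
        ((hN w).mono (h.sigma_le _) le_rfl)).aemeasurable

/-- Decomposition at the root of an exponential functional of the size of a generation. -/
lemma lintegral_exp_card_succ (h : IsBRW P off μ N X) (k : ℕ) (t : ℝ) {a : ℝ≥0∞}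
    (ha : ∀ i : ℕ, ∫⁻ ω, ENNReal.ofReal
      (Real.exp (t * (generation (fun u => N (u ++ [i]) ω) k).card)) ∂P ≤ a) :
    ∫⁻ ω, ENNReal.ofReal (Real.exp (t * (generation (fun u => N u ω) (k + 1)).card)) ∂P ≤
      ∑' j : ℕ, off j * a ^ j := by
  classical
  set F : ℕ → Ω → ℝ≥0∞ := fun i ω => ENNReal.ofReal
    (Real.exp (t * (generation (fun u => N (u ++ [i]) ω) k).card)) with hF
  have hFm (i : ℕ) : Measurable[sigma N X (subtreeIndex [i])] (F i) := by
    have := measurable_treeSum_subtree (N := N) (X := X) [i] k (f := fun _ => 1) measurable_const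
    simp only [← card_eq_treeSum] at this
    exact ENNReal.measurable_ofReal.comp (Real.measurable_exp.comp (this.const_mul t))
  -- Summing over the possible offspring numbers `j` of the root replaces a product of random length
  -- by products of fixed length, to which independence applies.
  have hdec (ω : Ω) : ENNReal.ofReal
      (Real.exp (t * (generation (fun u => N u ω) (k + 1)).card)) =
      ∑' j : ℕ, (if N [] ω = j then 1 else 0) * ∏ i ∈ Finset.range j, F i ω := by
    rw [tsum_eq_single (N [] ω)]
    · rw [if_pos rfl, one_mul, hF, ← ENNReal.ofReal_prod_of_nonneg (fun _ _ => Real.exp_nonneg _),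
        ← Real.exp_sum, ← Finset.mul_sum]
      congr 3
      have h1 := (sum_generation_add (fun u => N u ω) k 1 (fun _ => (1 : ℝ))).trans
        (sum_generation_succ _ 0 _)
      simp only [Finset.sum_const, nsmul_eq_mul, mul_one, generation_zero,
        Finset.sum_singleton] at h1
      exact h1
    · intro j hj
      simp [hj.symm]
  simp only [hdec]
  have hI (j : ℕ) : Measurable[sigma N X {([], true)}]
      fun ω => (if N [] ω = j then (1 : ℝ≥0∞) else 0) :=
    (measurable_of_countable (fun i : ℕ => if i = j then (1 : ℝ≥0∞) else 0)).comp
      (measurable_sigma_N (S := {([], true)}) (by simp))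
  have hprod (j : ℕ) : Measurable[sigma N X (⋃ i ∈ Finset.range j, subtreeIndex [i])]
      fun ω => ∏ i ∈ Finset.range j, F i ω :=
    Finset.measurable_fun_prod _ fun i hi =>
      (hFm i).mono (sigma_mono (Set.subset_biUnion_of_mem (u := fun i => subtreeIndex [i]) hi)) le_rfl
  rw [lintegral_tsum]
  · refine ENNReal.tsum_le_tsum fun j => ?_
    rw [h.lintegral_mul _ (hI j) (hprod j), h.lintegral_prod _ _ (fun i _ => hFm i)]
    · refine mul_le_mul' ?_ ?_
      · rw [h.lintegral_N [] (fun i => if i = j then 1 else 0), tsum_eq_single j]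
        · simp
        · intro i hi; simp [hi]
      · calc _ ≤ ∏ i ∈ Finset.range j, a := Finset.prod_le_prod' fun i _ => ha i
          _ = a ^ j := by simp
    · intro i _ i' _ hne
      exact disjoint_subtreeIndex rfl (by simpa using hne)
    · rw [Set.disjoint_iUnion₂_right]
      intro i _
      rw [Set.disjoint_left]
      rintro _ rfl ⟨w, hw, -⟩
      simp at hw
  · exact fun j => (((hI j).mono (h.sigma_le _) le_rfl).mul
      ((hprod j).mono (h.sigma_le _) le_rfl)).aemeasurable

end IsBRW

end Moments

/-! ### Exponential moments -/

/-- The linear term is kept exactly. Integrated, it yields bounds `exp (mean * θ + const * θ ^ 2)`,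
in which a negative mean wins for small `θ`. -/
lemma exp_le_one_add_add_sq_mul_exp_abs (x : ℝ) :
    Real.exp x ≤ 1 + x + x ^ 2 * Real.exp |x| := by
  have h := Complex.norm_exp_sub_sum_le_norm_mul_exp (x : ℂ) 2
  have h1 : Complex.exp x - ∑ m ∈ Finset.range 2, (x : ℂ) ^ m / (m.factorial : ℂ) =
      ((Real.exp x - (1 + x) : ℝ) : ℂ) := by
    simp [Finset.sum_range_succ]
  rw [h1, Complex.norm_real, Complex.norm_real, Real.norm_eq_abs, Real.norm_eq_abs, sq_abs] at h
  linarith [le_abs_self (Real.exp x - (1 + x))]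

lemma sq_le_mul_exp {a x : ℝ} (ha : 0 < a) (hx : 0 ≤ x) :
    x ^ 2 ≤ 2 / a ^ 2 * Real.exp (a * x) := by
  have h := Real.quadratic_le_exp_of_nonneg (mul_nonneg ha.le hx)
  rw [div_mul_eq_mul_div, le_div_iff₀ (by positivity)]
  nlinarith [mul_nonneg ha.le hx]

/-- An offspring law without mass at `0` and `1` and with an exponential moment has a finite mean
`m ≥ 2` and a generating function bounded by `exp (m s + C s²)` at `exp s`. -/
lemma exists_offspring_bound {off : PMF ℕ} (h_off0 : off 0 = 0) (h_off1 : off 1 = 0)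
    (h_offexp : ∃ θ : ℝ, 0 < θ ∧
      Summable fun k : ℕ => (off k).toReal * Real.exp (θ * (k : ℝ))) :
    ∃ m C s₀ : ℝ, 2 ≤ m ∧ 0 ≤ C ∧ 0 < s₀ ∧ ∑' j : ℕ, off j * (j : ℝ≥0∞) = ENNReal.ofReal m ∧
      ∀ s, 0 ≤ s → s ≤ s₀ →
        ∑' j : ℕ, off j * ENNReal.ofReal (Real.exp s) ^ j ≤
          ENNReal.ofReal (Real.exp (m * s + C * s ^ 2)) := by
  obtain ⟨θ, hθ, hsum⟩ := h_offexp
  set p : ℕ → ℝ := fun k => (off k).toReal with hp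
  have hp0 (k : ℕ) : 0 ≤ p k := ENNReal.toReal_nonneg
  have hofp (k : ℕ) : off k = ENNReal.ofReal (p k) := (ENNReal.ofReal_toReal (off.apply_ne_top k)).symm
  have hp1 : HasSum p 1 := by
    have h1 : ∑' k, off k ≠ ⊤ := by rw [off.tsum_coe]; simp
    have h2 := (ENNReal.summable_toReal h1).hasSum
    rwa [← ENNReal.tsum_toReal_eq off.apply_ne_top, off.tsum_coe, ENNReal.toReal_one] at h2
  have hsumk : Summable fun k : ℕ => p k * k := by
    refine Summable.of_nonneg_of_le (fun k => by have := hp0 k; positivity) (fun k => ?_)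
      (hsum.mul_left (1 / θ))
    have : (k : ℝ) ≤ 1 / θ * Real.exp (θ * k) := by
      rw [div_mul_eq_mul_div, le_div_iff₀ hθ, one_mul]
      linarith [Real.add_one_le_exp (θ * k)]
    calc p k * k ≤ p k * (1 / θ * Real.exp (θ * k)) := mul_le_mul_of_nonneg_left this (hp0 k)
      _ = _ := by ring
  set m : ℝ := ∑' k : ℕ, p k * k with hm
  set M : ℝ := ∑' k : ℕ, p k * Real.exp (θ * k) with hM
  -- The moment `exp (θ k)` is split in two halves: one absorbs the factor `k ^ 2` of the quadratic
  -- remainder, the other dominates `exp (s k)` for `s ≤ θ / 2`.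
  refine ⟨m, 2 / (θ / 2) ^ 2 * M, θ / 2, ?_, by positivity, by positivity, ?_, ?_⟩
  · have h2 : HasSum (fun k => p k * 2) 2 := by simpa using hp1.mul_right 2
    refine hasSum_le (fun k => ?_) h2 hsumk.hasSum
    rcases Nat.lt_or_ge k 2 with hk | hk
    · interval_cases k <;> simp [hp, h_off0, h_off1]
    · exact mul_le_mul_of_nonneg_left (by exact_mod_cast hk) (hp0 k)
  · rw [hm, ENNReal.ofReal_tsum_of_nonneg (fun k => mul_nonneg (hp0 k) (Nat.cast_nonneg k)) hsumk]
    refine tsum_congr fun k => ?_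
    rw [ENNReal.ofReal_mul (hp0 k), ← hofp, ENNReal.ofReal_natCast]
  · intro s hs0 hs
    have hle (k : ℕ) : p k * Real.exp s ^ k ≤
        p k + s * (p k * k) + 2 / (θ / 2) ^ 2 * s ^ 2 * (p k * Real.exp (θ * k)) := by
      have hks : 0 ≤ (k : ℝ) * s := by positivity
      have h1 := exp_le_one_add_add_sq_mul_exp_abs (k * s)
      rw [abs_of_nonneg hks] at h1
      have h2 := sq_le_mul_exp (a := θ / 2) (by positivity) (Nat.cast_nonneg (α := ℝ) k)
      have h3 : Real.exp (k * s) ≤ Real.exp (θ / 2 * k) := by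
        rw [Real.exp_le_exp, mul_comm]
        exact mul_le_mul_of_nonneg_right hs (Nat.cast_nonneg k)
      have h4 : (k * s) ^ 2 * Real.exp (k * s) ≤
          2 / (θ / 2) ^ 2 * s ^ 2 * Real.exp (θ * k) := by
        have h5 : Real.exp (θ * k) = Real.exp (θ / 2 * k) * Real.exp (θ / 2 * k) := by
          rw [← Real.exp_add]; ring_nf
        rw [h5]
        calc (k * s) ^ 2 * Real.exp (k * s) = (k : ℝ) ^ 2 * (s ^ 2 * Real.exp (k * s)) := by ring
          _ ≤ (2 / (θ / 2) ^ 2 * Real.exp (θ / 2 * k)) * (s ^ 2 * Real.exp (θ / 2 * k)) := by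
            gcongr
          _ = _ := by ring
      rw [← Real.exp_nat_mul]
      calc p k * Real.exp (k * s) ≤ p k * (1 + k * s + 2 / (θ / 2) ^ 2 * s ^ 2 * Real.exp (θ * k)) :=
            mul_le_mul_of_nonneg_left (by linarith) (hp0 k)
        _ = _ := by ring
    have hrs : HasSum (fun k : ℕ => p k + s * (p k * k) +
        2 / (θ / 2) ^ 2 * s ^ 2 * (p k * Real.exp (θ * k)))
        (1 + s * m + 2 / (θ / 2) ^ 2 * s ^ 2 * M) :=
      (hp1.add (hsumk.hasSum.mul_left s)).add (hsum.hasSum.mul_left _)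
    have hls : Summable fun k => p k * Real.exp s ^ k :=
      Summable.of_nonneg_of_le (fun k => mul_nonneg (hp0 k) (by positivity)) hle hrs.summable
    have h1 : ∑' j : ℕ, off j * ENNReal.ofReal (Real.exp s) ^ j =
        ENNReal.ofReal (∑' k, p k * Real.exp s ^ k) := by
      rw [ENNReal.ofReal_tsum_of_nonneg (fun k => mul_nonneg (hp0 k) (by positivity)) hls]
      refine tsum_congr fun k => ?_
      rw [ENNReal.ofReal_mul (hp0 k), ← hofp, ENNReal.ofReal_pow (Real.exp_nonneg s)]
    rw [h1]
    refine ENNReal.ofReal_le_ofReal ?_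
    refine (hasSum_le hle hls.hasSum hrs).trans ?_
    have := Real.add_one_le_exp (m * s + 2 / (θ / 2) ^ 2 * M * s ^ 2)
    linarith

section ExponentialMoments

variable {Ω : Type*} [mΩ : MeasurableSpace Ω] {P : Measure Ω} [IsProbabilityMeasure P] {off : PMF ℕ}
  {μ : Measure ℝ} [IsProbabilityMeasure μ] {N : List ℕ → Ω → ℕ} {X : List ℕ → Ω → ℝ}

/-- Decomposing at the root gives a recursion in which `θ` becomes `s = θ / m + 2 C (θ / m) ^ 2` and
the new exponent is `m s + C s ^ 2`. As `m ≥ 2`, the error `2 C θ ^ 2 / m` inherited from the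
subtrees is at most `C θ ^ 2`, and `s ≤ θ` makes the new error at most `C θ ^ 2`. Hence the
coefficient `2 C` reproduces itself and the bound is uniform in `k`. -/
lemma IsBRW.lintegral_exp_card_le {m C s₀ : ℝ} (hm2 : 2 ≤ m) (hC : 0 ≤ C)
    (hgen : ∀ s, 0 ≤ s → s ≤ s₀ → ∑' j : ℕ, off j * ENNReal.ofReal (Real.exp s) ^ j ≤
          ENNReal.ofReal (Real.exp (m * s + C * s ^ 2)))
    (k : ℕ) {θ : ℝ} (hθ : 0 ≤ θ) (hθs : θ ≤ s₀) (hθC : 2 * C * θ ≤ 1)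
    (h : IsBRW P off μ N X) :
    ∫⁻ ω, ENNReal.ofReal (Real.exp (θ * ((generation (fun u => N u ω) k).card / m ^ k))) ∂P ≤
      ENNReal.ofReal (Real.exp (θ + 2 * C * θ ^ 2)) := by
  have hm : 0 < m := by linarith
  induction k generalizing N X θ with
  | zero =>
    simp only [generation_zero, Finset.card_singleton, Nat.cast_one, pow_zero, div_one, mul_one,
      lintegral_const, measure_univ]
    exact ENNReal.ofReal_le_ofReal (Real.exp_le_exp.2 (by nlinarith [mul_nonneg hC (sq_nonneg θ)]))
  | succ k ih =>
    set s : ℝ := θ / m + 2 * C * (θ / m) ^ 2 with hs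
    have hθm : θ / m ≤ θ / 2 := div_le_div_of_nonneg_left hθ (by norm_num) hm2
    have hθm0 : 0 ≤ θ / m := by positivity
    have hs0 : 0 ≤ s := by positivity
    have hsθ : s ≤ θ := by
      have h2 : 2 * C * (θ / m) ≤ 1 := by nlinarith
      nlinarith
    have hstep := h.lintegral_exp_card_succ k (θ / m ^ (k + 1))
      (a := ENNReal.ofReal (Real.exp s)) (fun i => by
        have := ih (θ := θ / m) hθm0 (by linarith) (by nlinarith) (h.shift [i])
        convert! this using 5
        rw [pow_succ]
        field_simp)
    have heq (ω : Ω) : θ * ((generation (fun u => N u ω) (k + 1)).card / m ^ (k + 1)) =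
        θ / m ^ (k + 1) * (generation (fun u => N u ω) (k + 1)).card := by ring
    simp only [heq]
    refine hstep.trans ((hgen s hs0 (hsθ.trans hθs)).trans ?_)
    refine ENNReal.ofReal_le_ofReal (Real.exp_le_exp.2 ?_)
    have h1 : m * s = θ + 2 * C * θ * (θ / m) := by
      rw [hs]; field_simp
    have h2 : 2 * C * θ * (θ / m) ≤ 2 * C * θ * (θ / 2) :=
      mul_le_mul_of_nonneg_left hθm (by positivity)
    have h3 : C * s ^ 2 ≤ C * θ ^ 2 := by gcongr
    nlinarith

lemma IsBRW.measurable_treeSum (h : IsBRW P off μ N X) (k : ℕ) {f : ℝ → ℝ} (hf : Measurable f) :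
    Measurable fun ω => treeSum (fun u => N u ω) (fun u => X u ω) k f :=
  BranchingRandomWalk.measurable_treeSum (fun u => h.measurable_N u) (fun u _ => h.measurable_X u) hf

lemma IsBRW.integrable_integral_treeSum {m : ℝ} (hm : 0 ≤ m)
    (hmean : ∑' j : ℕ, off j * (j : ℝ≥0∞) = ENNReal.ofReal m)
    (h : IsBRW P off μ N X) (k : ℕ) {f : ℝ → ℝ} (hf : Measurable f) (hf1 : ∀ s, |f s| ≤ 1) :
    Integrable (fun ω => treeSum (fun u => N u ω) (fun u => X u ω) k f) P ∧
    ∫ ω, treeSum (fun u => N u ω) (fun u => X u ω) k f ∂P = m ^ k * ∫ s, f s ∂walkLaw μ k := by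
  have hpos {g : ℝ → ℝ} (hg : Measurable g) (hg0 : ∀ s, 0 ≤ g s) (hg2 : ∀ s, g s ≤ 2) :
      Integrable (fun ω => treeSum (fun u => N u ω) (fun u => X u ω) k g) P ∧
      ∫ ω, treeSum (fun u => N u ω) (fun u => X u ω) k g ∂P = m ^ k * ∫ s, g s ∂walkLaw μ k := by
    have h1 := h.lintegral_sum_generation k (hg.ennreal_ofReal)
    rw [h.lintegral_card_generation, hmean] at h1
    have hnn (ω : Ω) : 0 ≤ treeSum (fun u => N u ω) (fun u => X u ω) k g :=
      Finset.sum_nonneg fun _ _ => hg0 _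
    have h2 (ω : Ω) : ∑ w ∈ generation (fun u => N u ω) k,
        ENNReal.ofReal (g (position (fun u => X u ω) w)) =
        ENNReal.ofReal (treeSum (fun u => N u ω) (fun u => X u ω) k g) := by
      rw [treeSum, ENNReal.ofReal_sum_of_nonneg fun _ _ => hg0 _]
    simp only [h2] at h1
    have hgi : Integrable g (walkLaw μ k) :=
      Integrable.of_bound hg.aestronglyMeasurable 2
        (ae_of_all _ fun s => by rw [Real.norm_eq_abs, abs_of_nonneg (hg0 s)]; exact hg2 s)
    rw [← ofReal_integral_eq_lintegral_ofReal hgi (ae_of_all _ hg0),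
      ← ENNReal.ofReal_pow hm, ← ENNReal.ofReal_mul (pow_nonneg hm k)] at h1
    have hmeas := h.measurable_treeSum k hg
    refine ⟨⟨hmeas.aestronglyMeasurable, ?_⟩, ?_⟩
    · rw [hasFiniteIntegral_iff_ofReal (ae_of_all _ hnn), h1]
      exact ENNReal.ofReal_lt_top
    · rw [integral_eq_lintegral_of_nonneg_ae (ae_of_all _ hnn) hmeas.aestronglyMeasurable, h1,
        ENNReal.toReal_ofReal (mul_nonneg (pow_nonneg hm k) (integral_nonneg hg0))]
  -- A signed `f` is the difference of `f + 1` and `1`, both with values in `[0, 2]`.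
  have hA := hpos (hf.add_const 1) (fun s => by linarith [neg_le_of_abs_le (hf1 s)])
    (fun s => by linarith [le_of_abs_le (hf1 s)])
  have hB := hpos (g := fun _ => 1) measurable_const (fun _ => by norm_num) (fun _ => by norm_num)
  have hsub (ω : Ω) : treeSum (fun u => N u ω) (fun u => X u ω) k f =
      treeSum (fun u => N u ω) (fun u => X u ω) k (fun s => f s + 1) -
      treeSum (fun u => N u ω) (fun u => X u ω) k (fun _ => 1) := by
    simp [treeSum, Finset.sum_add_distrib]
  have hfi : Integrable f (walkLaw μ k) :=
    Integrable.of_bound hf.aestronglyMeasurable 1 (ae_of_all _ hf1)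
  simp only [hsub]
  refine ⟨hA.1.sub hB.1, ?_⟩
  rw [integral_sub hA.1 hB.1, hA.2, hB.2, integral_add hfi (integrable_const _)]
  simp
  ring

/-- A uniform bound of the moment generating function of `treeSum`. -/
lemma exists_lintegral_exp_treeSum_le {m C s₀ : ℝ} (hm2 : 2 ≤ m) (hC : 0 ≤ C) (hs₀ : 0 < s₀)
    (hmean : ∑' j : ℕ, off j * (j : ℝ≥0∞) = ENNReal.ofReal m)
    (hgen : ∀ s, 0 ≤ s → s ≤ s₀ → ∑' j : ℕ, off j * ENNReal.ofReal (Real.exp s) ^ j ≤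
          ENNReal.ofReal (Real.exp (m * s + C * s ^ 2))) :
    ∃ θ₀ K : ℝ, 0 < θ₀ ∧ 0 ≤ K ∧ ∀ {N : List ℕ → Ω → ℕ} {X : List ℕ → Ω → ℝ}
      (_ : IsBRW P off μ N X) (k : ℕ) {f : ℝ → ℝ} (_ : Measurable f) (_ : ∀ s, |f s| ≤ 1) (θ : ℝ)
      (_ : 0 ≤ θ) (_ : θ ≤ θ₀),
      ∫⁻ ω, ENNReal.ofReal (Real.exp (θ *
        (treeSum (fun u => N u ω) (fun u => X u ω) k f / m ^ k))) ∂P ≤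
      ENNReal.ofReal (Real.exp (θ * ∫ s, f s ∂walkLaw μ k + K * θ ^ 2)) := by
  have hm : 0 < m := by linarith
  set t : ℝ := min s₀ (1 / (2 * C + 1)) with ht
  have ht0 : 0 < t := by positivity
  have hts : t ≤ s₀ := min_le_left _ _
  have htC : 2 * C * t ≤ 1 := by
    have : t ≤ 1 / (2 * C + 1) := min_le_right _ _
    rw [le_div_iff₀ (by positivity)] at this
    linarith
  set L : ℝ := Real.exp (t + 2 * C * t ^ 2) with hL
  -- Again half of the exponent `t` absorbs the square of the normalised population size `W`, and
  -- the other half dominates `exp (θ |ξ|)` since `|ξ| ≤ W`.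
  refine ⟨t / 2, 2 / (t / 2) ^ 2 * L, by positivity, by positivity, ?_⟩
  intro N X h k f hf hf1 θ hθ0 hθ
  set W : Ω → ℝ := fun ω => (generation (fun u => N u ω) k).card / m ^ k with hW
  set ξ : Ω → ℝ := fun ω => treeSum (fun u => N u ω) (fun u => X u ω) k f / m ^ k with hξ
  have hW0 (ω : Ω) : 0 ≤ W ω := by positivity
  have hξW (ω : Ω) : |ξ ω| ≤ W ω := by
    simp only [hξ, hW, abs_div, abs_of_pos (pow_pos hm k)]
    gcongr
    exact abs_treeSum_le _ _ _ hf1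
  have hWm : Measurable W := by
    have := (h.measurable_treeSum k (f := fun _ => 1) measurable_const).div_const (m ^ k)
    simpa only [← card_eq_treeSum] using this
  have hexp := IsBRW.lintegral_exp_card_le hm2 hC hgen k ht0.le hts htC h
  have hexpi : Integrable (fun ω => Real.exp (t * W ω)) P := by
    refine ⟨(Real.measurable_exp.comp (hWm.const_mul t)).aestronglyMeasurable, ?_⟩
    rw [hasFiniteIntegral_iff_ofReal (ae_of_all _ fun _ => Real.exp_nonneg _)]
    exact hexp.trans_lt ENNReal.ofReal_lt_top
  have hexpL : ∫ ω, Real.exp (t * W ω) ∂P ≤ L := by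
    rw [integral_eq_lintegral_of_nonneg_ae (ae_of_all _ fun _ => Real.exp_nonneg _)
      hexpi.aestronglyMeasurable]
    exact ENNReal.toReal_le_of_le_ofReal (Real.exp_nonneg _) hexp
  obtain ⟨hTi, hTe⟩ := h.integrable_integral_treeSum hm.le hmean k hf hf1
  have hξi : Integrable ξ P := hTi.div_const _
  have hξe : ∫ ω, ξ ω ∂P = ∫ s, f s ∂walkLaw μ k := by
    rw [hξ, integral_div, hTe]
    field_simp
  have hbound (ω : Ω) : Real.exp (θ * ξ ω) ≤
      1 + θ * ξ ω + θ ^ 2 * (2 / (t / 2) ^ 2) * Real.exp (t * W ω) := by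
    refine (exp_le_one_add_add_sq_mul_exp_abs _).trans ?_
    have h1 : ξ ω ^ 2 ≤ W ω ^ 2 := by
      rw [← sq_abs]
      gcongr
      exact hξW ω
    have h2 := sq_le_mul_exp (a := t / 2) (by positivity) (hW0 ω)
    have h3 : |θ * ξ ω| ≤ t / 2 * W ω := by
      rw [abs_mul, abs_of_nonneg hθ0]
      exact mul_le_mul hθ (hξW ω) (abs_nonneg _) (by positivity)
    have h4 : Real.exp (t * W ω) = Real.exp (t / 2 * W ω) * Real.exp (t / 2 * W ω) := by
      rw [← Real.exp_add]; ring_nf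
    have h5 : (θ * ξ ω) ^ 2 * Real.exp |θ * ξ ω| ≤
        (θ ^ 2 * (2 / (t / 2) ^ 2 * Real.exp (t / 2 * W ω))) * Real.exp (t / 2 * W ω) := by
      rw [mul_pow]
      gcongr
      exact h1.trans h2
    rw [h4]
    linarith
  have hri : Integrable (fun ω => 1 + θ * ξ ω + θ ^ 2 * (2 / (t / 2) ^ 2) * Real.exp (t * W ω)) P :=
    ((integrable_const _).add (hξi.const_mul θ)).add (hexpi.const_mul _)
  calc ∫⁻ ω, ENNReal.ofReal (Real.exp (θ * ξ ω)) ∂P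
      ≤ ∫⁻ ω, ENNReal.ofReal (1 + θ * ξ ω + θ ^ 2 * (2 / (t / 2) ^ 2) * Real.exp (t * W ω)) ∂P :=
        lintegral_mono fun ω => ENNReal.ofReal_le_ofReal (hbound ω)
    _ = ENNReal.ofReal
        (∫ ω, (1 + θ * ξ ω + θ ^ 2 * (2 / (t / 2) ^ 2) * Real.exp (t * W ω)) ∂P) :=
        (ofReal_integral_eq_lintegral_ofReal hri
          (ae_of_all _ fun ω => (Real.exp_nonneg _).trans (hbound ω))).symm
    _ ≤ _ := by
      refine ENNReal.ofReal_le_ofReal ?_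
      have h0 : Integrable (fun ω => 1 + θ * ξ ω) P := (integrable_const _).add (hξi.const_mul θ)
      rw [integral_add h0 (hexpi.const_mul _),
        integral_add (integrable_const _) (hξi.const_mul θ), integral_const_mul,
        integral_const_mul, hξe]
      have h1 : θ ^ 2 * (2 / (t / 2) ^ 2) * ∫ ω, Real.exp (t * W ω) ∂P ≤
          θ ^ 2 * (2 / (t / 2) ^ 2) * L := by gcongr
      have := Real.add_one_le_exp (θ * ∫ s, f s ∂walkLaw μ k + 2 / (t / 2) ^ 2 * L * θ ^ 2)
      simp only [integral_const, probReal_univ, smul_eq_mul, mul_one]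
      linarith

/-- A Chernoff bound for sums over independent subtrees. -/
lemma IsBRW.measure_sum_treeSum_nonneg_le {m θ K : ℝ} (hm : 0 < m)
    (hexp : ∀ {N : List ℕ → Ω → ℕ} {X : List ℕ → Ω → ℝ}
      (_ : IsBRW P off μ N X) (k : ℕ) {f : ℝ → ℝ} (_ : Measurable f) (_ : ∀ s, |f s| ≤ 1),
      ∫⁻ ω, ENNReal.ofReal (Real.exp (θ *
        (treeSum (fun u => N u ω) (fun u => X u ω) k f / m ^ k))) ∂P ≤
      ENNReal.ofReal (Real.exp (θ * ∫ s, f s ∂walkLaw μ k + K * θ ^ 2)))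
    (hθ : 0 ≤ θ) (h : IsBRW P off μ N X) {T : ℕ} (g : Finset (List ℕ)) (hg : ∀ v ∈ g, v.length = T)
    (k : ℕ) {f : List ℕ → ℝ → ℝ} (hf : ∀ v, Measurable (f v)) (hf1 : ∀ v s, |f v s| ≤ 1) :
    P {ω | 0 ≤ ∑ v ∈ g,
        treeSum (fun u => N (u ++ v) ω) (fun u => X (u ++ v) ω) k (f v)} ≤
      ENNReal.ofReal (Real.exp (θ * ∑ v ∈ g, ∫ s, f v s ∂walkLaw μ k + K * θ ^ 2 * g.card)) := by
  set F : List ℕ → Ω → ℝ≥0∞ := fun v ω => ENNReal.ofReal (Real.exp (θ *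
        (treeSum (fun u => N (u ++ v) ω) (fun u => X (u ++ v) ω) k (f v) / m ^ k))) with hF
  have hFm (v : List ℕ) : Measurable[sigma N X (subtreeIndex v)] (F v) := by
    have := measurable_treeSum_subtree (N := N) (X := X) v k (hf v)
    exact ENNReal.measurable_ofReal.comp (Real.measurable_exp.comp ((this.div_const _).const_mul θ))
  have hprod (ω : Ω) : ∏ v ∈ g, F v ω = ENNReal.ofReal (Real.exp (θ * ((∑ v ∈ g,
        treeSum (fun u => N (u ++ v) ω) (fun u => X (u ++ v) ω) k (f v)) / m ^ k))) := by
    rw [hF, ← ENNReal.ofReal_prod_of_nonneg (fun _ _ => Real.exp_nonneg _), ← Real.exp_sum,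
      ← Finset.mul_sum, Finset.sum_div]
  calc _ ≤ P {ω | 1 ≤ ∏ v ∈ g, F v ω} := by
        refine measure_mono fun ω hω => ?_
        simp only [Set.mem_ofPred_eq] at hω ⊢
        rw [hprod, ENNReal.one_le_ofReal, Real.one_le_exp_iff]
        positivity
    _ ≤ ∫⁻ ω, ∏ v ∈ g, F v ω ∂P := by
        have := mul_meas_ge_le_lintegral₀ (μ := P) (f := fun ω => ∏ v ∈ g, F v ω)
          (Finset.measurable_fun_prod g fun v _ =>
            (hFm v).mono (h.sigma_le _) le_rfl).aemeasurable 1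
        simpa using this
    _ = ∏ v ∈ g, ∫⁻ ω, F v ω ∂P :=
        h.lintegral_prod g (S := subtreeIndex) (fun v hv w hw hne =>
          disjoint_subtreeIndex ((hg v hv).trans (hg w hw).symm) hne) fun v _ => hFm v
    _ ≤ ∏ v ∈ g, ENNReal.ofReal (Real.exp (θ * ∫ s, f v s ∂walkLaw μ k + K * θ ^ 2)) :=
        Finset.prod_le_prod' fun v _ => hexp (h.shift v) k (hf v) (hf1 v)
    _ = _ := by
        rw [← ENNReal.ofReal_prod_of_nonneg (fun _ _ => Real.exp_nonneg _), ← Real.exp_sum,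
          Finset.sum_add_distrib, ← Finset.mul_sum, Finset.sum_const, nsmul_eq_mul]
        ring_nf

end ExponentialMoments

/-! ### Central limit theorem along the tree -/

section CentralLimit

variable {Ω : Type*} [mΩ : MeasurableSpace Ω] {P : Measure Ω} [IsProbabilityMeasure P] {off : PMF ℕ}
  {μ : Measure ℝ} [IsProbabilityMeasure μ] {N : List ℕ → Ω → ℕ} {X : List ℕ → Ω → ℝ}

lemma position_replicate (x : List ℕ → ℝ) (n : ℕ) :
    position x (List.replicate n 0) = ∑ i ∈ Finset.range n, x (List.replicate (i + 1) 0) := by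
  induction n with
  | zero => simp [position]
  | succ n ih => rw [Finset.sum_range_succ, ← ih]; rfl

/-- The displacements along the leftmost words are i.i.d., whether or not these words belong to the
tree, so the classical central limit theorem applies. Slutsky's lemma replaces the normalisation
`√(n - T n)` by `√n`, and the portmanteau theorem for closed sets gives the one-sided bound. -/
lemma IsBRW.eventually_walkLaw_le (h : IsBRW P off μ N X)
    (h_symm : μ.map (fun x : ℝ => -x) = μ) (h_var : ∫ x : ℝ, x ^ 2 ∂μ = 1)
    {T : ℕ → ℕ} (hT : Tendsto (fun n => (T n : ℝ) / n) atTop (𝓝 0))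
    {F : Set ℝ} (hF : IsClosed F) {q : ℝ} (hq : nu F < q) :
    ∀ᶠ n : ℕ in atTop, (walkLaw μ (n - T n)).real {s | (√(n : ℝ))⁻¹ * s ∈ F} < q := by
  set Y : ℕ → Ω → ℝ := fun i => X (List.replicate (i + 1) 0) with hY
  have hlaw (i : ℕ) : P.map (Y i) = μ := h.law_X _
  have hmean : ∫ x, x ∂μ = 0 := by
    have h1 : ∫ x, x ∂μ = ∫ x, -x ∂μ := by
      conv_lhs => rw [← h_symm]
      rw [integral_map (by fun_prop) (by fun_prop)]
    rw [integral_neg] at h1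
    linarith
  have hindep : iIndepFun Y P := by
    have h1 : iIndepFun X P := h.indep.comp (fun _ => Prod.snd) fun _ => measurable_snd
    exact h1.precomp (g := fun i : ℕ => List.replicate (i + 1) 0) fun i j hij => by
      simpa using congrArg List.length hij
  have hident (i : ℕ) : IdentDistrib (Y i) (Y 0) P P :=
    ⟨(h.measurable_X _).aemeasurable, (h.measurable_X _).aemeasurable, by rw [hlaw, hlaw]⟩
  have hclt := tendstoInDistribution_inv_sqrt_mul_sum (P := P) (P' := gaussianReal 0 1)
    (X := Y) (Y := id) ⟨by fun_prop, by simp⟩ (by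
      rw [← hmean, ← hlaw 0, integral_map (h.measurable_X _).aemeasurable (by fun_prop)]) (by
      rw [← h_var, ← hlaw 0, integral_map (h.measurable_X _).aemeasurable (by fun_prop)]
      rfl) hindep hident
  set k : ℕ → ℕ := fun n => n - T n with hk
  have hratio : Tendsto (fun n => (k n : ℝ) / n) atTop (𝓝 1) := by
    have h1 : Tendsto (fun n => 1 - (T n : ℝ) / n) atTop (𝓝 1) := by
      simpa using hT.const_sub 1
    refine h1.congr' ?_
    filter_upwards [eventually_gt_atTop 0, hT.eventually (gt_mem_nhds one_pos)] with n hn hTn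
    have hn' : (0 : ℝ) < n := by exact_mod_cast hn
    rw [div_lt_one hn', Nat.cast_lt] at hTn
    rw [hk, Nat.cast_sub hTn.le, sub_div, div_self hn'.ne']
  have hktop : Tendsto k atTop atTop := by
    rw [← tendsto_natCast_atTop_iff (R := ℝ)]
    have h1 : Tendsto (fun n => (k n : ℝ) / n * n) atTop atTop :=
      hratio.pos_mul_atTop one_pos tendsto_natCast_atTop_atTop
    refine h1.congr' ?_
    filter_upwards [eventually_gt_atTop 0] with n hn
    field_simp
  have hD : TendstoInDistribution
      (fun n ω => (√(k n : ℝ))⁻¹ * ∑ i ∈ Finset.range (k n), Y i ω) atTop id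
      (fun _ => P) (gaussianReal 0 1) :=
    { forall_aemeasurable := fun n => hclt.forall_aemeasurable (k n)
      aemeasurable_limit := hclt.aemeasurable_limit
      tendsto := hclt.tendsto.comp hktop }
  have hsqrt : Tendsto (fun n : ℕ => √((k n : ℝ) / n)) atTop (𝓝 1) := by
    simpa using hratio.sqrt
  have hS := hD.continuous_comp_prodMk_of_tendstoInMeasure_const
    (g := fun z : ℝ × ℝ => z.1 * z.2) (Y := fun n _ => √((k n : ℝ) / n)) (c := 1) (by fun_prop)
    (tendstoInMeasure_of_tendsto_ae (fun n => aestronglyMeasurable_const)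
      (ae_of_all _ fun _ => hsqrt)) (fun n => aemeasurable_const)
  have hlim := ProbabilityMeasure.limsup_measure_closed_le_of_tendsto hS.tendsto hF
  have hnu : ((gaussianReal 0 1).map fun ω : ℝ => id ω * 1) F < ENNReal.ofReal q := by
    have : (fun ω : ℝ => id ω * 1) = id := by ext; simp
    rw [this, Measure.map_id, ← ofReal_measureReal]
    exact (ENNReal.ofReal_lt_ofReal_iff (measureReal_nonneg.trans_lt hq)).2 hq
  have hev := eventually_lt_of_limsup_lt (hlim.trans_lt hnu)
  filter_upwards [hev, hktop.eventually_gt_atTop 0, eventually_gt_atTop 0] with n hn hkn hn0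
  have hmeas : MeasurableSet {s : ℝ | (√(n : ℝ))⁻¹ * s ∈ F} :=
    hF.measurableSet.preimage (measurable_const_mul _)
  have hwalk : walkLaw μ (k n) {s | (√(n : ℝ))⁻¹ * s ∈ F} =
      P.map (fun ω => (√(k n : ℝ))⁻¹ * (∑ i ∈ Finset.range (k n), Y i ω) * √((k n : ℝ) / n)) F := by
    have h1 := h.map_position (List.replicate (k n) 0)
    rw [List.length_replicate] at h1
    have hm : Measurable fun ω => position (fun u => X u ω) (List.replicate (k n) 0) :=
      measurable_position (k := k n) (fun u _ _ => h.measurable_X u) _ (by simp)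
    have hm' : Measurable fun ω =>
        (√(k n : ℝ))⁻¹ * (∑ i ∈ Finset.range (k n), Y i ω) * √((k n : ℝ) / n) :=
      ((Finset.measurable_fun_sum _ fun i _ => h.measurable_X _).const_mul _).mul_const _
    rw [← h1, Measure.map_apply hm hmeas, Measure.map_apply hm' hF.measurableSet]
    congr 1
    ext ω
    simp only [Set.mem_preimage, Set.mem_ofPred_eq, position_replicate]
    have hk0 : √(k n : ℝ) ≠ 0 := by
      have : (0 : ℝ) < k n := by exact_mod_cast hkn
      positivity
    rw [Real.sqrt_div (Nat.cast_nonneg _)]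
    have : (√(k n : ℝ))⁻¹ * (∑ i ∈ Finset.range (k n), Y i ω) * (√(k n : ℝ) / √(n : ℝ)) =
        (√(n : ℝ))⁻¹ * ∑ i ∈ Finset.range (k n), Y i ω := by
      field_simp
    rw [this]
  rw [Measure.real, hwalk]
  exact ENNReal.toReal_lt_of_lt_ofReal hn

end CentralLimit

/-! ### Gaussian measure of translates -/

/-- Besides measurability, this is what the proof needs from the half-line algebra: the boundary is
null for every Gaussian law. -/
lemma finite_frontier_of_mem_halfLineAlgebra {A : Set ℝ} (hA : A ∈ halfLineAlgebra) :
    (frontier A).Finite := by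
  induction hA with
  | base s hs =>
    obtain ⟨x, rfl⟩ := hs
    simp
  | empty => simp
  | compl s _ ih => rwa [frontier_compl]
  | union s t _ _ ihs iht =>
    refine (ihs.union iht).subset ((frontier_union_subset s t).trans ?_)
    exact Set.union_subset_union Set.inter_subset_left Set.inter_subset_right

lemma nu_eq_gaussianReal (x : ℝ) {E : Set ℝ} (hE : MeasurableSet E) :
    nu {s | s + x ∈ E} = (gaussianReal x 1).real E := by
  have h1 : (gaussianReal 0 1).map (· + x) = gaussianReal x 1 := by
    rw [gaussianReal_map_add_const, zero_add]
  rw [nu, ← h1, map_measureReal_apply (by fun_prop) hE]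
  rfl

/-- Closed thickenings decrease to the closure, which exceeds `A` by a finite, hence null, set.
Thickenings absorb errors in the starting position and are closed, as the central limit bound
requires. -/
lemma exists_nu_cthickening_lt {A : Set ℝ} (hA : (frontier A).Finite) {x q : ℝ}
    (hx : nu {s | s + x ∈ A} < q) :
    ∃ δ > 0, nu {s | s + x ∈ Metric.cthickening δ A} < q := by
  have hlim := tendsto_measure_cthickening (μ := gaussianReal x 1) (s := A)
    ⟨1, one_pos, measure_ne_top _ _⟩
  have hcl : (gaussianReal x 1).real (closure A) ≤ nu {s | s + x ∈ A} := by
    rw [← nu_eq_gaussianReal x isClosed_closure.measurableSet]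
    have hsub : {s | s + x ∈ closure A} ⊆ {s | s + x ∈ A} ∪ (· + x) ⁻¹' frontier A := by
      intro s hs
      rcases em (s + x ∈ A) with h | h
      · exact Or.inl h
      · exact Or.inr ⟨hs, fun hi => h (interior_subset hi)⟩
    have hfin : ((· + x) ⁻¹' frontier A).Finite :=
      hA.preimage (add_left_injective x).injOn
    have := nullSingletonClass_gaussianReal (μ := 0) (v := 1) one_ne_zero
    calc nu {s | s + x ∈ closure A} ≤ nu ({s | s + x ∈ A} ∪ (· + x) ⁻¹' frontier A) :=
          measureReal_mono hsub
      _ ≤ nu {s | s + x ∈ A} + nu ((· + x) ⁻¹' frontier A) := measureReal_union_le _ _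
      _ = nu {s | s + x ∈ A} := by
        rw [nu, nu, Measure.real, Measure.real, hfin.measure_zero]
        simp
  have hlt : (gaussianReal x 1) (closure A) < ENNReal.ofReal q := by
    rw [← ofReal_measureReal]
    exact (ENNReal.ofReal_lt_ofReal_iff (measureReal_nonneg.trans_lt hx)).2 (hcl.trans_lt hx)
  have hev := (hlim.eventually (gt_mem_nhds hlt)).filter_mono
    (nhdsWithin_le_nhds (s := Set.Ioi (0 : ℝ)))
  obtain ⟨δ, hδ, hδ0⟩ := (hev.and self_mem_nhdsWithin).exists
  refine ⟨δ, hδ0, ?_⟩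
  rw [nu_eq_gaussianReal x Metric.isClosed_cthickening.measurableSet]
  exact ENNReal.toReal_lt_of_lt_ofReal hδ

lemma mem_cthickening_of_dist_le {A : Set ℝ} {a b δ δ' : ℝ} (hδ : 0 ≤ δ) (hδ' : 0 ≤ δ')
    (h : a ∈ Metric.cthickening δ A) (hab : |b - a| ≤ δ') : b ∈ Metric.cthickening (δ + δ') A := by
  rw [Metric.mem_cthickening_iff] at h ⊢
  calc Metric.infEDist b A ≤ Metric.infEDist a A + edist b a := Metric.infEDist_le_infEDist_add_edist
    _ ≤ ENNReal.ofReal δ + ENNReal.ofReal δ' := by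
      gcongr
      rw [edist_dist, Real.dist_eq]
      exact ENNReal.ofReal_le_ofReal hab
    _ = _ := (ENNReal.ofReal_add hδ hδ').symm

/-- Compactness makes `δ` uniform: moving the centre by less than `δ / 2` is paid for by half of the
thickening. -/
lemma exists_forall_nu_cthickening_lt {A : Set ℝ} (hA : (frontier A).Finite) {R q : ℝ}
    (hR : ∀ x, |x| ≤ R → nu {s | s + x ∈ A} < q) :
    ∃ δ > 0, ∀ x, |x| ≤ R → nu {s | s + x ∈ Metric.cthickening δ A} < q := by
  have hmono {δ δ' : ℝ} (hδ : δ ≤ δ') (x : ℝ) : nu {s | s + x ∈ Metric.cthickening δ A} ≤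
      nu {s | s + x ∈ Metric.cthickening δ' A} :=
    measureReal_mono fun s hs => Metric.cthickening_mono hδ A hs
  have key := (isCompact_Icc (a := -R) (b := R)).induction_on
    (p := fun S => ∃ δ > 0, ∀ x ∈ S, nu {s | s + x ∈ Metric.cthickening δ A} < q)
    ⟨1, one_pos, by simp⟩
    (fun S S' hS ⟨δ, hδ, h⟩ => ⟨δ, hδ, fun x hx => h x (hS hx)⟩)
    (fun S S' ⟨δ, hδ, h⟩ ⟨δ', hδ', h'⟩ => ⟨min δ δ', lt_min hδ hδ', fun x hx => by
      rcases hx with hx | hx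
      · exact (hmono (min_le_left _ _) x).trans_lt (h x hx)
      · exact (hmono (min_le_right _ _) x).trans_lt (h' x hx)⟩)
    (fun x hx => by
      obtain ⟨δ, hδ, h⟩ := exists_nu_cthickening_lt hA (hR x (abs_le.2 hx))
      refine ⟨Metric.ball x (δ / 2), mem_nhdsWithin_of_mem_nhds (Metric.ball_mem_nhds x (by positivity)),
        δ / 2, by positivity, fun y hy => lt_of_le_of_lt (measureReal_mono fun s hs => ?_) h⟩
      have hyx : |(s + x) - (s + y)| ≤ δ / 2 := by
        rw [Metric.mem_ball, dist_comm, Real.dist_eq] at hy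
        have : (s + x) - (s + y) = x - y := by ring
        rw [this]
        exact hy.le
      have := mem_cthickening_of_dist_le (by positivity) (by positivity) hs hyx
      simpa using this)
  obtain ⟨δ, hδ, h⟩ := key
  exact ⟨δ, hδ, fun x hx => h x (abs_le.1 hx)⟩

/-! ### The rate function -/

lemma image_sub_eq (A : Set ℝ) (x : ℝ) : (fun a => a - x) '' A = {s | s + x ∈ A} := by
  ext s
  simp only [Set.mem_image, Set.mem_ofPred_eq]
  constructor
  · rintro ⟨a, ha, rfl⟩; simpa using ha
  · intro h; exact ⟨s + x, h, by simp⟩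

/-- Continuity of `I_A` from the left: translates shorter than `I_A(p)` miss the level `p` by a
fixed gap `p - q`. -/
lemma exists_lt_forall_nu_lt {A : Set ℝ} {p R : ℝ}
    (h_cont : ContinuousAt (fun q : ℝ => rateI A q) p) (h_fin : rateI A p < ⊤)
    (hR0 : 0 ≤ R) (hR : R < (rateI A p).toReal) :
    ∃ q < p, ∀ x, |x| ≤ R → nu {s | s + x ∈ A} < q := by
  have h1 : ENNReal.ofReal R < rateI A p := (ENNReal.ofReal_lt_iff_lt_toReal hR0 h_fin.ne).2 hR
  have h2 := (h_cont.eventually (lt_mem_nhds h1)).filter_mono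
    (nhdsWithin_le_nhds (s := Set.Iio p))
  obtain ⟨q, hq, hqp⟩ := (h2.and self_mem_nhdsWithin).exists
  refine ⟨q, hqp, fun x hx => ?_⟩
  by_contra! hcon
  have h3 : rateI A q ≤ ENNReal.ofReal |x| := sInf_le ⟨x, by rwa [image_sub_eq], rfl⟩
  exact absurd (hq.trans_le (h3.trans (ENNReal.ofReal_le_ofReal hx))) (lt_irrefl _)

/-- Continuity from the right: a translate only slightly longer than `I_A(p)` exceeds the level `p`
by a fixed gap `q - p`. -/
lemma exists_gt_exists_le_nu {A : Set ℝ} {p R : ℝ}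
    (h_cont : ContinuousAt (fun q : ℝ => rateI A q) p) (h_fin : rateI A p < ⊤)
    (hR : (rateI A p).toReal < R) :
    ∃ q > p, ∃ x, |x| < R ∧ q ≤ nu {s | s + x ∈ A} := by
  have h1 : rateI A p < ENNReal.ofReal R := (ENNReal.lt_ofReal_iff_toReal_lt h_fin.ne).2 hR
  have h2 := (h_cont.eventually (gt_mem_nhds h1)).filter_mono
    (nhdsWithin_le_nhds (s := Set.Ioi p))
  obtain ⟨q, hq, hqp⟩ := (h2.and self_mem_nhdsWithin).exists
  obtain ⟨r, ⟨x, hx, rfl⟩, hr⟩ := sInf_lt_iff.1 hq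
  refine ⟨q, hqp, x, ?_, by rwa [image_sub_eq] at hx⟩
  exact (ENNReal.ofReal_lt_ofReal_iff (ENNReal.toReal_nonneg.trans_lt hR)).1 hr

/-- All sufficiently small translates of `A` lie in one thickening whose measure is still below `p`.
-/
lemma rateI_toReal_pos {A : Set ℝ} (hA : (frontier A).Finite) {p : ℝ} (hp : nu A < p)
    (h_fin : rateI A p < ⊤) : 0 < (rateI A p).toReal := by
  obtain ⟨δ, hδ, h⟩ := exists_nu_cthickening_lt hA (x := 0) (by simpa using hp)
  refine ENNReal.toReal_pos (fun h0 => ?_) h_fin.ne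
  have h1 : ENNReal.ofReal δ ≤ rateI A p := by
    refine le_sInf ?_
    rintro _ ⟨x, hx, rfl⟩
    refine ENNReal.ofReal_le_ofReal ?_
    by_contra! hcon
    rw [image_sub_eq] at hx
    refine absurd (hx.trans (measureReal_mono fun s hs => ?_)) (not_le.2 h)
    have h2 := mem_cthickening_of_dist_le (δ := 0) le_rfl hδ.le
      (Metric.self_subset_cthickening A hs) (b := s + 0) (by simpa using hcon.le)
    simpa using h2
  rw [h0, nonpos_iff_eq_zero, ENNReal.ofReal_eq_zero] at h1
  linarith

/-! ### Law of large numbers given the first generations -/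

section LawOfLargeNumbers

variable {Ω : Type*} [mΩ : MeasurableSpace Ω] {P : Measure Ω} [IsProbabilityMeasure P] {off : PMF ℕ}
  {μ : Measure ℝ} [IsProbabilityMeasure μ] {N : List ℕ → Ω → ℕ} {X : List ℕ → Ω → ℝ}

/-- Conditioning on a discrete variable that is measurable with respect to the first `T`
generations. -/
lemma IsBRW.measure_inter_le_of_past (h : IsBRW P off μ N X) {T : ℕ} {ι : Type*} [Countable ι]
    {Y : Ω → ι} (hY : ∀ y, MeasurableSet[sigma N X (pastIndex T)] {ω | Y ω = y})
    {B D : Set Ω} {r : ℝ≥0∞}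
    (H : ∀ ω₀ ∈ D, ∃ S : Set (List ℕ × Bool), Disjoint (pastIndex T) S ∧ ∃ B' : Set Ω,
      MeasurableSet[sigma N X S] B' ∧ B ∩ {ω | Y ω = Y ω₀} ⊆ B' ∧ P B' ≤ r) :
    P (B ∩ D) ≤ r := by
  have h1 : B ∩ D ⊆ ⋃ y : ι, (B ∩ D) ∩ {ω | Y ω = y} := by
    intro ω hω
    exact Set.mem_iUnion.2 ⟨Y ω, hω, rfl⟩
  -- On an atom of `Y` that meets `B ∩ D`, the event `B` is contained in an event independent of the
  -- past; the probability of the atom then factors out.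
  have h2 (y : ι) : P ((B ∩ D) ∩ {ω | Y ω = y}) ≤ P {ω | Y ω = y} * r := by
    rcases Set.eq_empty_or_nonempty ((B ∩ D) ∩ {ω | Y ω = y}) with he | ⟨ω₀, ⟨-, hD⟩, hy⟩
    · rw [he]; simp
    · obtain ⟨S, hS, B', hB', hsub, hr⟩ := H ω₀ hD
      have hyy : Y ω₀ = y := hy
      calc P ((B ∩ D) ∩ {ω | Y ω = y}) ≤ P ({ω | Y ω = y} ∩ B') := by
            refine measure_mono fun ω hω => ⟨hω.2, hsub ⟨hω.1.1, ?_⟩⟩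
            exact (hω.2 : Y ω = y).trans hyy.symm
        _ = P {ω | Y ω = y} * P B' := (Indep_iff _ _ _).1 (h.indep_sigma hS) _ _ (hY y) hB'
        _ ≤ _ := by gcongr
  have hm (y : ι) : MeasurableSet {ω | Y ω = y} := h.sigma_le _ _ (hY y)
  calc P (B ∩ D) ≤ ∑' y, P ((B ∩ D) ∩ {ω | Y ω = y}) := (measure_mono h1).trans (measure_iUnion_le _)
    _ ≤ ∑' y, P {ω | Y ω = y} * r := ENNReal.tsum_le_tsum h2
    _ = P (⋃ y, {ω | Y ω = y}) * r := by
      rw [ENNReal.tsum_mul_right, measure_iUnion _ hm]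
      intro y y' hne
      rw [Function.onFun, Set.disjoint_left]
      rintro ω rfl h'
      exact hne h'
    _ ≤ 1 * r := by gcongr; exact prob_le_one
    _ = r := one_mul r

/-- Generation `T` with discretised positions takes countably many values, so conditioning on it is
elementary. -/
lemma measurableSet_image_generation_eq {T : ℕ} {τ : ℝ → ℤ} (hτ : Measurable τ)
    (y : Finset (List ℕ × ℤ)) :
    MeasurableSet[sigma N X (pastIndex T)] {ω | (generation (fun u => N u ω) T).image
      (fun v => (v, τ (position (fun u => X u ω) v))) = y} := by
  have heq : {ω | (generation (fun u => N u ω) T).image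
      (fun v => (v, τ (position (fun u => X u ω) v))) = y} =
      ⋂ z : List ℕ × ℤ, {ω | (z.1.length = T ∧ z.1 ∈ generation (fun u => N u ω) T ∧
        τ (position (fun u => X u ω) z.1) = z.2) ↔ z ∈ y} := by
    ext ω
    simp only [Set.mem_ofPred_eq, Set.mem_iInter, Finset.ext_iff, Finset.mem_image]
    refine forall_congr' fun z => ?_
    refine iff_congr ?_ Iff.rfl
    constructor
    · rintro ⟨v, hv, rfl⟩; exact ⟨length_of_mem_generation hv, hv, rfl⟩
    · rintro ⟨-, hv, hz⟩; exact ⟨z.1, hv, by rw [hz]⟩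
  rw [heq]
  refine @MeasurableSet.iInter _ _ (sigma N X (pastIndex T)) _ _ fun z => ?_
  have hz : MeasurableSet[sigma N X (pastIndex T)] {ω | z.1.length = T ∧
      z.1 ∈ generation (fun u => N u ω) T ∧ τ (position (fun u => X u ω) z.1) = z.2} := by
    by_cases hl : z.1.length = T
    · simp only [hl, true_and]
      refine @MeasurableSet.inter _ (sigma N X (pastIndex T)) _ _ ?_ ?_
      · exact measurableSet_mem_generation (m := sigma N X (pastIndex T)) (fun u hu =>
          measurable_sigma_N (S := pastIndex T) ⟨hu.le, fun _ => hu⟩) z.1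
      · have hp : Measurable[sigma N X (pastIndex T)] fun ω => position (fun u => X u ω) z.1 :=
          measurable_position (m := sigma N X (pastIndex T)) (k := T) (fun u _ hu =>
            measurable_sigma_X (S := pastIndex T) ⟨hu, by simp⟩) z.1 hl.le
        exact (hτ.comp hp) (measurableSet_singleton z.2)
    · simp [hl]
  by_cases hy : z ∈ y
  · simpa only [hy, iff_true] using hz
  · simp only [hy, iff_false]
    exact @MeasurableSet.compl _ _ (sigma N X (pastIndex T)) hz

open Classical in
/-- If few particles of generation `T` are far away, then the proportion of particles in `√n A`
at time `n` is unlikely to reach `p`. -/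
lemma IsBRW.measure_empirical_inter_le {m θ K : ℝ} (hm : 0 < m)
    (hexp : ∀ {N : List ℕ → Ω → ℕ} {X : List ℕ → Ω → ℝ}
      (_ : IsBRW P off μ N X) (k : ℕ) {f : ℝ → ℝ} (_ : Measurable f) (_ : ∀ s, |f s| ≤ 1),
      ∫⁻ ω, ENNReal.ofReal (Real.exp (θ *
        (treeSum (fun u => N u ω) (fun u => X u ω) k f / m ^ k))) ∂P ≤
      ENNReal.ofReal (Real.exp (θ * ∫ s, f s ∂walkLaw μ k + K * θ ^ 2)))
    (hθ : 0 ≤ θ) (h : IsBRW P off μ N X) {A : Set ℝ} {p q δ R R' c : ℝ} {b n T : ℕ}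
    (hp0 : 0 < p) (hp1 : p < 1) (hq0 : 0 ≤ q) (hδ : 0 < δ) (hδR : R' + δ ≤ R) (hn : 0 < n)
    (hT : T ≤ n)
    (hnear : ∀ i : ℤ, |i * δ| ≤ R → (walkLaw μ (n - T)).real
      {s | (√(n : ℝ))⁻¹ * s + i * δ ∈ Metric.cthickening δ A} ≤ q)
    (hc : 0 ≤ c) (hcθ : θ * (-((p - q) / 2)) + K * θ ^ 2 ≤ -c) :
    P ({ω | p ≤ empirical (fun u => N u ω) (fun u => X u ω) n (√(n : ℝ) • A)} ∩
      {ω | (b ^ T : ℝ) ≤ (generation (fun u => N u ω) T).card ∧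
        (((generation (fun u => N u ω) T).filter
          fun v => R' * √(n : ℝ) ≤ |position (fun u => X u ω) v|).card : ℝ) ≤
        (p - q) / 4 * (generation (fun u => N u ω) T).card}) ≤
    ENNReal.ofReal (Real.exp (-c * b ^ T)) := by
  have hn' : (0 : ℝ) < √(n : ℝ) := Real.sqrt_pos.2 (by exact_mod_cast hn)
  set E : ℤ → Set ℝ := fun i => {s | (√(n : ℝ))⁻¹ * s + i * δ ∈ Metric.cthickening δ A} with hE
  have hEm (i : ℤ) : MeasurableSet (E i) :=
    Metric.isClosed_cthickening.measurableSet.preimage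
      ((measurable_id.const_mul _).add_const _)
  -- This dominates the indicator of `√n A` minus `p` for every particle starting in cell `i`: a
  -- thickened indicator for cells within distance `R`, the trivial bound `1 - p` for the others.
  set φ : ℤ → ℝ → ℝ := fun i s =>
    if |i * δ| ≤ R then (E i).indicator 1 s - p else 1 - p with hφ
  have hφm (i : ℤ) : Measurable (φ i) := by
    simp only [hφ]
    split_ifs
    · exact (measurable_one.indicator (hEm i)).sub_const p
    · exact measurable_const
  have hφ1 (i : ℤ) (s : ℝ) : |φ i s| ≤ 1 := by
    simp only [hφ]
    split_ifs
    · by_cases hs : s ∈ E i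
      · simp only [hs, Set.indicator_of_mem, Pi.one_apply]
        rw [abs_le]; constructor <;> linarith
      · simp only [hs, not_false_eq_true, Set.indicator_of_notMem, zero_sub, abs_neg]
        rw [abs_le]; constructor <;> linarith
    · rw [abs_le]; constructor <;> linarith
  -- On the scale `√n`, rounding down to the grid `δ ℤ` moves the starting point by less than `δ`,
  -- the width of the thickening.
  set τ : ℝ → ℤ := fun s => ⌊s / (δ * √(n : ℝ))⌋ with hτ
  have hτm : Measurable τ := Int.measurable_floor.comp (measurable_id.div_const _)
  have hτle (s : ℝ) : τ s * δ ≤ s / √(n : ℝ) := by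
    have := Int.floor_le (s / (δ * √(n : ℝ)))
    rw [le_div_iff₀ (by positivity)] at this
    rw [le_div_iff₀ hn', mul_assoc]
    exact this
  have hτlt (s : ℝ) : s / √(n : ℝ) < τ s * δ + δ := by
    have := Int.lt_floor_add_one (s / (δ * √(n : ℝ)))
    rw [div_lt_iff₀ (by positivity)] at this
    rw [div_lt_iff₀ hn']
    calc s < (τ s + 1) * (δ * √(n : ℝ)) := this
      _ = _ := by ring
  have hind (S s : ℝ) : (√(n : ℝ) • A).indicator (1 : ℝ → ℝ) (S + s) - p ≤ φ (τ S) s := by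
    simp only [hφ]
    split_ifs with hi
    · refine sub_le_sub_right ?_ p
      by_cases hA : S + s ∈ √(n : ℝ) • A
      · have : s ∈ E (τ S) := by
          rw [Set.mem_smul_set_iff_inv_smul_mem₀ hn'.ne', smul_eq_mul] at hA
          have h2 := mem_cthickening_of_dist_le (δ := 0) le_rfl hδ.le
            (Metric.self_subset_cthickening A hA) (b := (√(n : ℝ))⁻¹ * s + τ S * δ) (by
              have h3 : (√(n : ℝ))⁻¹ * s + τ S * δ - (√(n : ℝ))⁻¹ * (S + s) =
                τ S * δ - S / √(n : ℝ) := by field_simp; ring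
              rw [h3, abs_le]
              constructor <;> linarith [hτle S, hτlt S])
          simpa [hE] using h2
        simp [hA, this]
      · rw [Set.indicator_of_notMem hA]
        exact Set.indicator_nonneg (fun _ _ => zero_le_one) s
    · refine sub_le_sub_right ?_ p
      exact Set.indicator_le_self' (fun _ _ => zero_le_one) _
  have hint_near (i : ℤ) (hi : |i * δ| ≤ R) : ∫ s, φ i s ∂walkLaw μ (n - T) ≤ q - p := by
    simp only [hφ, hi, if_true]
    have hI : Integrable ((E i).indicator (1 : ℝ → ℝ)) (walkLaw μ (n - T)) :=
      (integrable_const (1 : ℝ)).indicator (hEm i)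
    rw [integral_sub hI (integrable_const p), integral_indicator_one (hEm i)]
    simp only [integral_const, probReal_univ, smul_eq_mul, one_mul]
    exact sub_le_sub_right (hnear i hi) p
  have hint (i : ℤ) : ∫ s, φ i s ∂walkLaw μ (n - T) ≤ 1 := by
    calc ∫ s, φ i s ∂walkLaw μ (n - T) ≤ ∫ s, (1 : ℝ) ∂walkLaw μ (n - T) :=
          integral_mono (Integrable.of_bound (hφm i).aestronglyMeasurable 1 (ae_of_all _ (hφ1 i)))
            (integrable_const _) fun s => le_of_abs_le (hφ1 i s)
      _ = 1 := by simp
  refine h.measure_inter_le_of_past (T := T) (Y := fun ω =>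
    (generation (fun u => N u ω) T).image (fun v => (v, τ (position (fun u => X u ω) v))))
    (measurableSet_image_generation_eq hτm) ?_
  rintro ω₀ ⟨hb, hfar⟩
  set g := generation (fun u => N u ω₀) T with hg
  set x₀ : List ℕ → ℝ := fun u => X u ω₀ with hx₀
  have hgl : ∀ v ∈ g, v.length = T := fun v hv => length_of_mem_generation hv
  refine ⟨⋃ v ∈ g, subtreeIndex v, ?_, {ω | 0 ≤ ∑ v ∈ g, treeSum (fun u => N (u ++ v) ω)
    (fun u => X (u ++ v) ω) (n - T) (φ (τ (position x₀ v)))}, ?_, ?_, ?_⟩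
  · rw [Set.disjoint_iUnion₂_right]
    intro v hv
    rw [← hgl v hv]
    exact disjoint_pastIndex_subtreeIndex v
  · have hsm : Measurable[sigma N X (⋃ v ∈ g, subtreeIndex v)] fun ω => ∑ v ∈ g,
        treeSum (fun u => N (u ++ v) ω) (fun u => X (u ++ v) ω) (n - T) (φ (τ (position x₀ v))) :=
      Finset.measurable_fun_sum (m := sigma N X (⋃ v ∈ g, subtreeIndex v)) g fun v hv =>
        (measurable_treeSum_subtree v (n - T) (hφm _)).mono
          (sigma_mono (Set.subset_biUnion_of_mem (u := fun v => subtreeIndex v) hv)) le_rfl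
    exact hsm (measurableSet_Ici (a := (0 : ℝ)))
  · rintro ω ⟨hω, hY⟩
    have hω' : p ≤ empirical (fun u => N u ω) (fun u => X u ω) n (√(n : ℝ) • A) := hω
    have hY' : (generation (fun u => N u ω) T).image
      (fun v => (v, τ (position (fun u => X u ω) v))) = g.image
      (fun v => (v, τ (position x₀ v))) := hY
    have hgω : generation (fun u => N u ω) T = g := by
      have := congrArg (Finset.image Prod.fst) hY'
      simpa [Finset.image_image, Function.comp_def] using this
    have hτω (v : List ℕ) (hv : v ∈ g) : τ (position (fun u => X u ω) v) = τ (position x₀ v) := by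
      have : (v, τ (position x₀ v)) ∈ g.image (fun v => (v, τ (position x₀ v))) :=
        Finset.mem_image_of_mem _ hv
      rw [← hY', Finset.mem_image] at this
      obtain ⟨v', -, hv'⟩ := this
      obtain ⟨rfl, h2⟩ := Prod.mk.inj hv'
      exact h2
    -- With no particles the quotient would be zero by convention, which is below `p`.
    have hcount : 0 < (count (fun u => N u ω) (fun u => X u ω) n Set.univ : ℝ) := by
      rcases (Nat.cast_nonneg (α := ℝ)
        (count (fun u => N u ω) (fun u => X u ω) n Set.univ)).lt_or_eq with h0 | h0
      · exact h0
      · rw [empirical, ← h0, div_zero] at hω'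
        linarith
    rw [empirical, le_div_iff₀ hcount, count_eq_treeSum, count_eq_treeSum] at hω'
    have h0 : 0 ≤ treeSum (fun u => N u ω) (fun u => X u ω) n
        (fun s => (√(n : ℝ) • A).indicator (1 : ℝ → ℝ) s - p) := by
      have : treeSum (fun u => N u ω) (fun u => X u ω) n
        (fun s => (√(n : ℝ) • A).indicator (1 : ℝ → ℝ) s - p) =
        treeSum (fun u => N u ω) (fun u => X u ω) n ((√(n : ℝ) • A).indicator 1) -
        p * treeSum (fun u => N u ω) (fun u => X u ω) n (Set.univ.indicator 1) := by
        simp [treeSum, Finset.sum_sub_distrib, mul_comm]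
      rw [this]
      linarith
    have hnT : n = (n - T) + T := by omega
    rw [hnT, treeSum_add, hgω, ← hnT] at h0
    refine h0.trans (Finset.sum_le_sum fun v hv => ?_)
    rw [← hτω v hv]
    exact Finset.sum_le_sum fun w _ => hind _ _
  · refine (h.measure_sum_treeSum_nonneg_le hm hexp hθ g hgl (n - T)
      (f := fun v => φ (τ (position x₀ v))) (fun v => hφm _) (fun v => hφ1 _)).trans ?_
    refine ENNReal.ofReal_le_ofReal (Real.exp_le_exp.2 ?_)
    set far := g.filter fun v => R' * √(n : ℝ) ≤ |position x₀ v| with hfar'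
    have hsum : ∑ v ∈ g, ∫ s, φ (τ (position x₀ v)) s ∂walkLaw μ (n - T) ≤
        -((p - q) / 2) * g.card := by
      -- Far particles contribute at most `1`, hence at most `(q - p) + 2`. Their share is at most
      -- `(p - q) / 4`, so the average stays below `-(p - q) / 2`.
      have hle : ∀ v ∈ g, ∫ s, φ (τ (position x₀ v)) s ∂walkLaw μ (n - T) ≤
          (q - p) + (if R' * √(n : ℝ) ≤ |position x₀ v| then 2 else 0) := by
        intro v hv
        split_ifs with hfv
        · linarith [hint (τ (position x₀ v))]
        · rw [add_zero]
          refine hint_near _ ?_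
          push Not at hfv
          have h1 : |position x₀ v / √(n : ℝ)| < R' := by
            rw [abs_div, abs_of_pos hn', div_lt_iff₀ hn']; exact hfv
          rw [abs_lt] at h1
          rw [abs_le]
          constructor <;> linarith [hτle (position x₀ v), hτlt (position x₀ v)]
      refine (Finset.sum_le_sum hle).trans ?_
      rw [Finset.sum_add_distrib, ← Finset.sum_filter]
      simp only [Finset.sum_const, nsmul_eq_mul]
      have : (far.card : ℝ) ≤ (p - q) / 4 * g.card := hfar
      linarith
    calc θ * ∑ v ∈ g, ∫ s, φ (τ (position x₀ v)) s ∂walkLaw μ (n - T) + K * θ ^ 2 * g.card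
        ≤ θ * (-((p - q) / 2) * g.card) + K * θ ^ 2 * g.card := by gcongr
      _ = (θ * (-((p - q) / 2)) + K * θ ^ 2) * g.card := by ring
      _ ≤ -c * g.card := by gcongr
      _ ≤ -c * b ^ T := by nlinarith

end LawOfLargeNumbers

/-! ### Particles that are far away early -/

/-- A far particle has an ancestor with a large displacement. `v.drop j` is the ancestor `j`
generations back, of generation `v.length - j`. -/
lemma exists_lt_abs_of_sum_lt (x : List ℕ → ℝ) (ℓ : ℕ → ℝ) (v : List ℕ)
    (h : ∑ k ∈ Finset.range v.length, ℓ (k + 1) < |position x v|) :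
    ∃ j < v.length, ℓ (v.length - j) < |x (v.drop j)| := by
  induction v with
  | nil => simp [position] at h
  | cons i u ih =>
    by_cases h1 : ℓ (u.length + 1) < |x (i :: u)|
    · exact ⟨0, by simp, by simpa using h1⟩
    · rw [List.length_cons, Finset.sum_range_succ] at h
      have h2 : |position x (i :: u)| ≤ |position x u| + |x (i :: u)| := abs_add_le _ _
      obtain ⟨j, hj, hj'⟩ := ih (by linarith)
      refine ⟨j + 1, by simpa using hj, ?_⟩
      simpa using hj'

section Far

variable {Ω : Type*} [mΩ : MeasurableSpace Ω] {P : Measure Ω} [IsProbabilityMeasure P] {off : PMF ℕ}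
  {μ : Measure ℝ} [IsProbabilityMeasure μ] {N : List ℕ → Ω → ℕ} {X : List ℕ → Ω → ℝ}

open Classical in
/-- Counting far particles by the large displacements of their ancestors. -/
lemma card_far_le {c : List ℕ → ℕ} {B : ℕ} (hB : ∀ u, c u ≤ B) (x : List ℕ → ℝ) (ℓ : ℕ → ℝ)
    (T : ℕ) : ((generation c T).filter
      fun v => ∑ k ∈ Finset.range T, ℓ (k + 1) < |position x v|).card ≤
    ∑ j ∈ Finset.range T, B ^ j * ((generation c (T - j)).filter fun u => ℓ (T - j) < |x u|).card := by
  have h1 : (generation c T).filter (fun v => ∑ k ∈ Finset.range T, ℓ (k + 1) < |position x v|) ⊆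
      (Finset.range T).biUnion fun j =>
        (generation c T).filter fun v => ℓ (T - j) < |x (v.drop j)| := by
    intro v hv
    obtain ⟨hv, hv'⟩ := Finset.mem_filter.1 hv
    have hl := length_of_mem_generation hv
    subst hl
    obtain ⟨j, hj, hj'⟩ := exists_lt_abs_of_sum_lt x ℓ v hv'
    exact Finset.mem_biUnion.2 ⟨j, Finset.mem_range.2 hj, Finset.mem_filter.2 ⟨hv, hj'⟩⟩
  refine (Finset.card_le_card h1).trans (Finset.card_biUnion_le.trans (Finset.sum_le_sum ?_))
  intro j hj
  have hjT : T = j + (T - j) := by have := Finset.mem_range.1 hj; omega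
  have h2 : ((generation c T).filter fun v => ℓ (T - j) < |x (v.drop j)|).card =
      ∑ v ∈ generation c (j + (T - j)), if ℓ (T - j) < |x (v.drop j)| then 1 else 0 := by
    rw [← hjT, Finset.card_filter]
  rw [h2, sum_generation_add, Finset.card_filter, Finset.mul_sum]
  refine Finset.sum_le_sum fun u hu => ?_
  have h3 : ∑ w ∈ generation (shift u c) j, (if ℓ (T - j) < |x ((w ++ u).drop j)| then 1 else 0) =
      ∑ w ∈ generation (shift u c) j, (if ℓ (T - j) < |x u| then 1 else 0) := by
    refine Finset.sum_congr rfl fun w hw => ?_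
    rw [← length_of_mem_generation hw, List.drop_left]
  rw [h3, Finset.sum_const, smul_eq_mul]
  refine Nat.mul_le_mul_right _ ?_
  rw [← card_generation_const B j]
  exact Finset.card_le_card (generation_mono j fun _ _ w _ => hB _)

lemma IsBRW.measure_lt_abs (h : IsBRW P off μ N X) (u : List ℕ) (z : ℝ) :
    P {ω | z < |X u ω|} = μ {x | z < |x|} := by
  rw [← h.law_X u, Measure.map_apply (h.measurable_X u)]
  · rfl
  · exact measurableSet_lt measurable_const (continuous_abs.measurable)

open Classical in
-- A union bound over the subsets of size `J`; the exponent `J` prices many simultaneous large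
-- displacements.
lemma IsBRW.measure_le_card_filter (h : IsBRW P off μ N X) (W : Finset (List ℕ)) (J : ℕ) (z : ℝ) :
    P {ω | J ≤ (W.filter fun u => z < |X u ω|).card} ≤ (W.card * μ {x | z < |x|}) ^ J := by
  have hset : MeasurableSet {x : ℝ | z < |x|} :=
    measurableSet_lt measurable_const (continuous_abs.measurable)
  have hsub : {ω | J ≤ (W.filter fun u => z < |X u ω|).card} ⊆
      ⋃ s ∈ W.powersetCard J, ⋂ u ∈ s, X u ⁻¹' {x | z < |x|} := by
    intro ω hω
    obtain ⟨s, hs, hc⟩ := Finset.exists_subset_card_eq (hω : J ≤ _)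
    simp only [Set.mem_iUnion, Set.mem_iInter]
    exact ⟨s, Finset.mem_powersetCard.2 ⟨hs.trans (Finset.filter_subset _ _), hc⟩,
      fun u hu => (Finset.mem_filter.1 (hs hu)).2⟩
  have hindep : iIndepFun X P := h.indep.comp (fun _ => Prod.snd) fun _ => measurable_snd
  have hprob : ∀ s ∈ W.powersetCard J, P (⋂ u ∈ s, X u ⁻¹' {x | z < |x|}) =
      μ {x | z < |x|} ^ J := by
    intro s hs
    rw [hindep.measure_inter_preimage_eq_mul s (fun u _ => hset),
      ← (Finset.mem_powersetCard.1 hs).2, ← Finset.prod_const]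
    exact Finset.prod_congr rfl fun u _ => h.measure_lt_abs u z
  calc _ ≤ ∑ s ∈ W.powersetCard J, P (⋂ u ∈ s, X u ⁻¹' {x | z < |x|}) :=
        (measure_mono hsub).trans (measure_biUnion_finset_le _ _)
    _ = (W.card.choose J) * μ {x | z < |x|} ^ J := by
        rw [Finset.sum_congr rfl hprob, Finset.sum_const, Finset.card_powersetCard, nsmul_eq_mul]
    _ ≤ (W.card ^ J : ℕ) * μ {x | z < |x|} ^ J := by
        gcongr
        exact Nat.choose_le_pow _ _
    _ = _ := by rw [Nat.cast_pow, mul_pow]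

lemma IsBRW.measure_exists_lt_abs_le (h : IsBRW P off μ N X) {m : ℝ} (hm : 0 ≤ m)
    (hmean : ∑' j : ℕ, off j * (j : ℝ≥0∞) = ENNReal.ofReal m) (k : ℕ) (z : ℝ) :
    P {ω | ∃ u ∈ generation (fun u => N u ω) k, z < |X u ω|} ≤
      ENNReal.ofReal (m ^ k) * μ {x | z < |x|} := by
  classical
  have hset : MeasurableSet {x : ℝ | z < |x|} :=
    measurableSet_lt measurable_const (continuous_abs.measurable)
  have hmeas (w : List ℕ) : Measurable[sigma N X {i | i.2 = false}]
      fun ω => if z < |X w ω| then (1 : ℝ≥0∞) else 0 :=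
    (Measurable.ite hset measurable_const measurable_const).comp
      (measurable_sigma_X (N := N) (S := {i | i.2 = false}) (u := w) rfl)
  have hint := h.lintegral_sum_generation_of_forall k (κ := μ {x | z < |x|}) hmeas
    (fun w _ => by
      have : (fun ω => if z < |X w ω| then (1 : ℝ≥0∞) else 0) =
          {ω | z < |X w ω|}.indicator 1 := by
        ext ω; simp [Set.indicator_apply]
      rw [this, ← h.measure_lt_abs w z]
      exact lintegral_indicator_one (hset.preimage (h.measurable_X w)))
  rw [h.lintegral_card_generation, hmean, ← ENNReal.ofReal_pow hm] at hint
  rw [← hint]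
  have hm' : AEMeasurable (fun ω => ∑ w ∈ generation (fun u => N u ω) k,
      if z < |X w ω| then (1 : ℝ≥0∞) else 0) P :=
    (measurable_sum_generation (fun u _ => h.measurable_N u)
      fun w _ => (hmeas w).mono (h.sigma_le _) le_rfl).aemeasurable
  have := mul_meas_ge_le_lintegral₀ hm' 1
  rw [one_mul] at this
  refine (measure_mono ?_).trans this
  rintro ω ⟨u, hu, huz⟩
  have h1 := Finset.single_le_sum (f := fun w => if z < |X w ω| then (1 : ℝ≥0∞) else 0)
    (fun w _ => zero_le) hu
  simpa [huz] using h1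

end Far

/-! ### Tail of the displacements -/

section Tail

variable {μ : Measure ℝ} [IsProbabilityMeasure μ] {α : ℝ}

lemma measure_lt_abs_eq (h_symm : μ.map (fun x : ℝ => -x) = μ) {z : ℝ} (hz : 0 ≤ z) :
    μ.real {x | z < |x|} = 2 * μ.real (Set.Ioi z) := by
  have h1 : {x : ℝ | z < |x|} = Set.Ioi z ∪ Set.Iio (-z) := by
    ext x
    simp only [Set.mem_ofPred_eq, Set.mem_union, Set.mem_Ioi, Set.mem_Iio, lt_abs]
    exact or_congr Iff.rfl lt_neg
  have h2 : μ.real (Set.Iio (-z)) = μ.real (Set.Ioi z) := by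
    conv_lhs => rw [← h_symm]
    rw [map_measureReal_apply (by fun_prop) measurableSet_Iio]
    congr 1
    ext x
    simp
  rw [h1, measureReal_union _ measurableSet_Iio, h2, two_mul]
  rw [Set.disjoint_left]
  intro x hx hx'
  simp only [Set.mem_Ioi, Set.mem_Iio] at hx hx'
  linarith

/-- Upper bound of the tail, in terms of the logarithmic cost `z ^ α`. -/
lemma exists_tail_upper (h_symm : μ.map (fun x : ℝ => -x) = μ) (h_alpha : 0 < α)
    (h_tail : (fun z : ℝ => μ.real (Set.Ioi z)) =Θ[atTop]
      fun z : ℝ => Real.exp (-Real.exp (z ^ α))) :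
    ∃ C y₀ : ℝ, 1 ≤ C ∧ 0 ≤ y₀ ∧ ∀ y, y₀ ≤ y →
      μ {x | y ^ (1 / α) < |x|} ≤ ENNReal.ofReal (C * Real.exp (-Real.exp y)) := by
  obtain ⟨C, hC⟩ := h_tail.1.bound
  obtain ⟨z₀, hz₀⟩ := eventually_atTop.1 hC
  refine ⟨max 1 (2 * C), (max z₀ 0) ^ α, le_max_left _ _, by positivity, fun y hy => ?_⟩
  have hy0 : 0 ≤ y := le_trans (by positivity) hy
  have hz : max z₀ 0 ≤ y ^ (1 / α) := by
    have := Real.rpow_le_rpow (by positivity) hy (by positivity : 0 ≤ 1 / α)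
    rwa [← Real.rpow_mul (by positivity), mul_one_div_cancel h_alpha.ne', Real.rpow_one] at this
  have h1 := hz₀ _ ((le_max_left _ _).trans hz)
  rw [Real.norm_eq_abs, Real.norm_eq_abs, abs_of_nonneg measureReal_nonneg, Real.abs_exp,
    ← Real.rpow_mul hy0, one_div_mul_cancel h_alpha.ne', Real.rpow_one] at h1
  rw [← ofReal_measureReal, measure_lt_abs_eq h_symm (by positivity)]
  refine ENNReal.ofReal_le_ofReal ?_
  calc 2 * μ.real (Set.Ioi (y ^ (1 / α))) ≤ 2 * (C * Real.exp (-Real.exp y)) := by gcongr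
    _ = (2 * C) * Real.exp (-Real.exp y) := by ring
    _ ≤ _ := by gcongr; exact le_max_right _ _

end Tail

/-! ### Sums of powers -/

/-- Comparison with an integral. The ramp on `[0, Λ / c]` contributes the fraction `1 / (β + 1)` of
what the plateau value would give there, so the loss is `β / (β + 1) * (Λ / c)`. For `β = 1 / α`
this fraction is `1 / (1 + α)`, which is the source of `y_α`. -/
lemma sum_min_rpow_le {β Λ c η : ℝ} {T : ℕ} (hβ : 0 < β) (hΛ : 0 < Λ) (hc : 0 < c) (hη : 0 < η)
    (hT : Λ / c ≤ T) :
    ∑ j ∈ Finset.range T, (min Λ (j * c) + η * Λ) ^ β ≤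
      (1 + η) ^ (β + 1) * (Λ ^ β * (T - β / (β + 1) * (Λ / c))) := by
  set f : ℝ → ℝ := fun x => (min Λ (x * c) + η * Λ) ^ β with hf
  have hmin {x : ℝ} (hx : 0 ≤ x) : 0 ≤ min Λ (x * c) := le_min hΛ.le (by positivity)
  have hmono : MonotoneOn f (Set.Icc (0 : ℝ) (0 + T)) := by
    intro x hx y hy hxy
    have := hmin hx.1
    exact Real.rpow_le_rpow (by positivity) (by gcongr) hβ.le
  have h1 := hmono.sum_le_integral
  simp only [zero_add, hf] at h1
  have hs : 0 ≤ Λ / c := by positivity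
  have hcont : Continuous f :=
    ((continuous_const.min (continuous_id.mul continuous_const)).add continuous_const).rpow_const
      fun x => Or.inr hβ.le
  have hA : ∫ x in (0 : ℝ)..(Λ / c), f x ≤
      (1 + η) ^ (β + 1) * (Λ ^ β * (Λ / c / (β + 1))) := by
    have e1 : ∫ x in (0 : ℝ)..(Λ / c), f x = ∫ x in (0 : ℝ)..(Λ / c), (c * x + η * Λ) ^ β := by
      refine intervalIntegral.integral_congr fun x hx => ?_
      rw [Set.uIcc_of_le hs] at hx
      have : x * c ≤ Λ := (le_div_iff₀ hc).1 hx.2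
      simp only [hf, min_eq_right this]
      rw [mul_comm x c]
    rw [e1, intervalIntegral.integral_comp_mul_add (fun y => y ^ β) hc.ne' (η * Λ),
      integral_rpow (Or.inl (by linarith)), smul_eq_mul]
    have e2 : c * (Λ / c) + η * Λ = (1 + η) * Λ := by field_simp
    rw [e2, Real.mul_rpow (by positivity) hΛ.le, Real.rpow_add_one hΛ.ne']
    have e3 : 0 ≤ (c * 0 + η * Λ) ^ (β + 1) := by
      rw [mul_zero, zero_add]; positivity
    calc c⁻¹ * (((1 + η) ^ (β + 1) * (Λ ^ β * Λ) - (c * 0 + η * Λ) ^ (β + 1)) / (β + 1)) ≤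
        c⁻¹ * (((1 + η) ^ (β + 1) * (Λ ^ β * Λ)) / (β + 1)) := by
          gcongr
          linarith
      _ = _ := by field_simp
  have hB : ∫ x in (Λ / c)..(T : ℝ), f x ≤ (1 + η) ^ (β + 1) * (Λ ^ β * (T - Λ / c)) := by
    have e1 : ∫ x in (Λ / c)..(T : ℝ), f x = ∫ x in (Λ / c)..(T : ℝ), ((1 + η) * Λ) ^ β := by
      refine intervalIntegral.integral_congr fun x hx => ?_
      rw [Set.uIcc_of_le hT] at hx
      have : Λ ≤ x * c := (div_le_iff₀ hc).1 hx.1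
      simp only [hf, min_eq_left this]
      ring_nf
    rw [e1, intervalIntegral.integral_const, smul_eq_mul, Real.mul_rpow (by positivity) hΛ.le]
    have e2 : (1 + η) ^ β ≤ (1 + η) ^ (β + 1) :=
      Real.rpow_le_rpow_of_exponent_le (by linarith) (by linarith)
    calc (T - Λ / c) * ((1 + η) ^ β * Λ ^ β) = (1 + η) ^ β * (Λ ^ β * (T - Λ / c)) := by ring
      _ ≤ _ := by gcongr
  refine h1.trans ?_
  have h2 := intervalIntegral.integral_add_adjacent_intervals (μ := volume)
    (hcont.intervalIntegrable 0 (Λ / c)) (hcont.intervalIntegrable (Λ / c) T)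
  calc ∫ x in (0 : ℝ)..(T : ℝ), (min Λ (x * c) + η * Λ) ^ β = ∫ x in (0 : ℝ)..(T : ℝ), f x := rfl
    _ ≤ (1 + η) ^ (β + 1) * (Λ ^ β * (Λ / c / (β + 1))) +
        (1 + η) ^ (β + 1) * (Λ ^ β * (T - Λ / c)) := by rw [← h2]; gcongr
    _ = _ := by field_simp; ring

lemma le_sum_rpow {β c : ℝ} (hβ : 0 < β) (hc : 0 < c) (s : ℕ) :
    c ^ β * ((s : ℝ) ^ (β + 1) / (β + 1)) ≤ ∑ j ∈ Finset.range (s + 1), (j * c) ^ β := by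
  have hmono : MonotoneOn (fun x : ℝ => (x * c) ^ β) (Set.Icc (0 : ℝ) (0 + s)) := by
    intro x hx y _ hxy
    have := hx.1
    exact Real.rpow_le_rpow (by positivity) (by gcongr) hβ.le
  have h1 := hmono.integral_le_sum
  simp only [zero_add] at h1
  rw [Finset.sum_range_succ', Nat.cast_zero, zero_mul, Real.zero_rpow hβ.ne', add_zero]
  refine le_trans (le_of_eq ?_) h1
  have : ∫ x in (0 : ℝ)..(s : ℝ), (x * c) ^ β = ∫ x in (0 : ℝ)..(s : ℝ), c ^ β * x ^ β := by
    refine intervalIntegral.integral_congr fun x hx => ?_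
    rw [Set.uIcc_of_le (Nat.cast_nonneg s)] at hx
    rw [Real.mul_rpow hx.1 hc.le, mul_comm]
  rw [this, intervalIntegral.integral_const_mul, integral_rpow (Or.inl (by linarith)),
    Real.zero_rpow (by linarith), sub_zero]

/-! ### Extremal offspring numbers -/

section Offspring

variable {off : PMF ℕ}

lemma minOffspring_mem (h_off0 : off 0 = 0) :
    1 ≤ minOffspring off ∧ 0 < off (minOffspring off) := by
  have hne : {k : ℕ | 1 ≤ k ∧ 0 < off k}.Nonempty := by
    obtain ⟨k, hk⟩ := off.support_nonempty
    refine ⟨k, ?_, pos_iff_ne_zero.2 hk⟩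
    rcases Nat.eq_zero_or_pos k with rfl | h
    · exact absurd h_off0 hk
    · exact h
  exact Nat.sInf_mem hne

lemma two_le_minOffspring (h_off0 : off 0 = 0) (h_off1 : off 1 = 0) : 2 ≤ minOffspring off := by
  obtain ⟨h1, h2⟩ := minOffspring_mem h_off0
  rcases h1.lt_or_eq with h | h
  · exact h
  · rw [← h, h_off1] at h2
    exact absurd h2 (lt_irrefl _)

lemma minOffspring_le (h_off0 : off 0 = 0) {k : ℕ} (hk : off k ≠ 0) : minOffspring off ≤ k := by
  refine Nat.sInf_le ⟨?_, pos_iff_ne_zero.2 hk⟩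
  rcases Nat.eq_zero_or_pos k with rfl | h
  · exact absurd h_off0 hk
  · exact h

lemma le_maxOffspring (h_off0 : off 0 = 0) {k : ℕ} (hk : off k ≠ 0) :
    (k : ℕ∞) ≤ maxOffspring off := by
  refine le_sSup ⟨k, ?_, pos_iff_ne_zero.2 hk, rfl⟩
  rcases Nat.eq_zero_or_pos k with rfl | h
  · exact absurd h_off0 hk
  · exact h

lemma le_maxOffspring_toNat (h_off0 : off 0 = 0) (hB : maxOffspring off ≠ ⊤) {k : ℕ}
    (hk : off k ≠ 0) : k ≤ (maxOffspring off).toNat := by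
  have := le_maxOffspring h_off0 hk
  rw [← ENat.natCast_toNat hB] at this
  exact_mod_cast this

lemma maxOffspring_toNat_ne_zero (h_off0 : off 0 = 0) (hB : maxOffspring off ≠ ⊤) :
    off (maxOffspring off).toNat ≠ 0 := by
  obtain ⟨h1, h2⟩ := minOffspring_mem h_off0
  have hne : {K : ℕ∞ | ∃ k : ℕ, 1 ≤ k ∧ 0 < off k ∧ K = (k : ℕ∞)}.Nonempty := ⟨_, _, h1, h2, rfl⟩
  have := hne.to_subtype
  obtain ⟨k, -, hk, hkB⟩ := ENat.sSup_mem_of_nonempty_of_lt_top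
    (show maxOffspring off < ⊤ from lt_top_iff_ne_top.2 hB)
  have : maxOffspring off = k := hkB
  rw [this, ENat.toNat_natCast]
  exact hk.ne'

lemma exists_le_of_maxOffspring_eq_top (hB : maxOffspring off = ⊤) (M : ℕ) :
    ∃ k ≥ M, off k ≠ 0 := by
  by_contra! hcon
  have : maxOffspring off ≤ M := by
    refine sSup_le ?_
    rintro _ ⟨k, -, hk, rfl⟩
    by_contra! hlt
    exact hk.ne' (hcon k (by exact_mod_cast hlt.le))
  rw [hB] at this
  exact absurd this (by simp)

end Offspring

/-! ### Few particles of generation `T` are far away. -/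

section FarBound

variable {Ω : Type*} [mΩ : MeasurableSpace Ω] {P : Measure Ω} [IsProbabilityMeasure P] {off : PMF ℕ}
  {μ : Measure ℝ} [IsProbabilityMeasure μ] {N : List ℕ → Ω → ℕ} {X : List ℕ → Ω → ℝ}

lemma IsBRW.ae_off_ne_zero (h : IsBRW P off μ N X) : ∀ᵐ ω ∂P, ∀ u, off (N u ω) ≠ 0 := by
  rw [ae_all_iff]
  intro u
  have h1 : ∀ᵐ ω ∂P, ∀ k : ℕ, off k = 0 → N u ω ≠ k := by
    rw [ae_all_iff]
    intro k
    by_cases hk : off k = 0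
    · have : P {ω | N u ω = k} = 0 := by rw [h.measure_N_eq, hk]
      rw [measure_eq_zero_iff_ae_notMem] at this
      filter_upwards [this] with ω hω _ using hω
    · exact ae_of_all _ fun ω h0 => absurd h0 hk
  filter_upwards [h1] with ω hω h0 using hω _ h0 rfl

lemma eventually_mul_le_exp {a : ℝ} (ha : 0 < a) (D : ℝ) :
    ∀ᶠ T : ℕ in atTop, D * ((T : ℝ) + 1) ≤ Real.exp (a * T) := by
  filter_upwards [tendsto_natCast_atTop_atTop.eventually_ge_atTop (4 * |D| / a ^ 2),
    eventually_ge_atTop 1] with T hT hT1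
  have hT1' : (1 : ℝ) ≤ T := by exact_mod_cast hT1
  have h1 := Real.quadratic_le_exp_of_nonneg (show 0 ≤ a * T by positivity)
  rw [div_le_iff₀ (by positivity)] at hT
  have h2 : D * ((T : ℝ) + 1) ≤ |D| * (2 * T) :=
    mul_le_mul (le_abs_self D) (by linarith) (by positivity) (abs_nonneg D)
  have h3 : 4 * |D| * T ≤ T * a ^ 2 * T := by gcongr
  nlinarith [mul_nonneg ha.le (Nat.cast_nonneg (α := ℝ) T)]

open Classical in
-- A vertex `j` generations before `T` has at most `B ^ j` descendants in generation `T`. Moving a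
-- share `ε / (T + 1)` of `b ^ T` particles thus takes at least `max 1 (ε b ^ T / (B ^ j (T + 1)))`
-- large displacements. The threshold `z j = min Λ (j log B) + η Λ`, with `Λ = T log b`, is chosen
-- so that this number times `exp (z j)` is at least `2 b ^ T`, whichever term of the maximum is
-- larger.
lemma eventually_measure_far_le_of_bounded {b B : ℕ} (hb : 2 ≤ b) (hbB : b ≤ B)
    {α C y₀ ε η : ℝ} (hε : 0 < ε) (hη : 0 < η) (hC : 1 ≤ C)
    (htail : ∀ y, y₀ ≤ y → μ {x | y ^ (1 / α) < |x|} ≤ ENNReal.ofReal (C * Real.exp (-Real.exp y))) :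
    ∀ᶠ T : ℕ in atTop, ∀ {N : List ℕ → Ω → ℕ} {X : List ℕ → Ω → ℝ} (_ : IsBRW P off μ N X)
      (_ : ∀ᵐ ω ∂P, ∀ u, N u ω ≤ B),
      P {ω | (b ^ T : ℝ) ≤ (generation (fun u => N u ω) T).card ∧
        ε * (generation (fun u => N u ω) T).card <
          (((generation (fun u => N u ω) T).filter fun v =>
            ∑ j ∈ Finset.range T, (min (T * Real.log b) (j * Real.log B) +
              η * (T * Real.log b)) ^ (1 / α) < |position (fun u => X u ω) v|).card : ℝ)} ≤
        ENNReal.ofReal (T * Real.exp (-b ^ T)) := by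
  have hb0 : (0 : ℝ) < b := by positivity
  have hb1 : (1 : ℝ) < b := by exact_mod_cast hb
  have hB1 : (1 : ℝ) < B := by exact_mod_cast hb.trans hbB
  have hB0 : (0 : ℝ) < B := by linarith
  have hlb : 0 < Real.log b := Real.log_pos hb1
  have hlB : 0 < Real.log B := Real.log_pos hB1
  have hlC : 0 ≤ Real.log C := Real.log_nonneg hC
  have hηb : 0 < η * Real.log b := by positivity
  -- The slack `η Λ` pays for everything of lower order: the number `B ^ T` of candidate vertices
  -- and the tail constant, the factor `(T + 1) / ε`, and a factor `2`.
  filter_upwards [eventually_mul_le_exp hηb (2 * (Real.log B + Real.log C)),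
    eventually_mul_le_exp hηb (2 / ε), eventually_mul_le_exp hηb 2,
    (tendsto_natCast_atTop_atTop (R := ℝ)).eventually_ge_atTop (y₀ / (η * Real.log b))]
    with T hT1 hT2 hT3 hT4 N X h hNB
  set Λ : ℝ := T * Real.log b with hΛ
  have hΛ0 : 0 ≤ Λ := by positivity
  have hηΛ : η * Real.log b * T = η * Λ := by rw [hΛ]; ring
  rw [hηΛ] at hT1 hT2 hT3
  have hexpΛ : Real.exp Λ = b ^ T := by
    rw [hΛ, Real.exp_nat_mul, Real.exp_log hb0]
  set z : ℕ → ℝ := fun j => min Λ (j * Real.log B) + η * Λ with hz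
  set ℓ : ℕ → ℝ := fun k => z (T - k) ^ (1 / α) with hℓ
  have hzη (j : ℕ) : η * Λ ≤ z j := by
    have : 0 ≤ min Λ (j * Real.log B) := le_min hΛ0 (by positivity)
    simp only [hz]; linarith
  have hsum : ∑ j ∈ Finset.range T, z j ^ (1 / α) = ∑ k ∈ Finset.range T, ℓ (k + 1) := by
    rw [← Finset.sum_range_reflect]
    refine Finset.sum_congr rfl fun k hk => ?_
    have := Finset.mem_range.1 hk
    simp only [hℓ]
    congr 2
    omega
  set J : ℕ → ℕ := fun j => ⌈max 1 (ε * b ^ T / (B ^ j * (T + 1)))⌉₊ with hJ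
  have hJle (j : ℕ) : max 1 (ε * b ^ T / (B ^ j * (T + 1))) ≤ (J j : ℝ) := Nat.le_ceil _
  have hJcost (j : ℕ) : (b : ℝ) ^ T ≤ J j * (Real.exp (z j) / 2) := by
    rcases le_total Λ (j * Real.log B) with hj | hj
    · have h1 : (1 : ℝ) ≤ J j := (le_max_left _ _).trans (hJle j)
      have h2 : Real.exp (z j) = b ^ T * Real.exp (η * Λ) := by
        simp only [hz, min_eq_left hj, Real.exp_add, hexpΛ]
      have h3 : 2 ≤ Real.exp (η * Λ) := by
        have : (0 : ℝ) ≤ T := Nat.cast_nonneg T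
        linarith
      calc (b : ℝ) ^ T = 1 * (b ^ T * 2 / 2) := by ring
        _ ≤ J j * (Real.exp (z j) / 2) := by rw [h2]; gcongr
    · have h1 : ε * b ^ T / (B ^ j * (T + 1)) ≤ J j := (le_max_right _ _).trans (hJle j)
      have h2 : Real.exp (z j) = B ^ j * Real.exp (η * Λ) := by
        simp only [hz, min_eq_right hj, Real.exp_add, Real.exp_nat_mul, Real.exp_log hB0]
      rw [h2]
      calc (b : ℝ) ^ T = ε * b ^ T / (B ^ j * (T + 1)) * (B ^ j * (2 / ε * (T + 1)) / 2) := by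
            field_simp
        _ ≤ J j * (B ^ j * Real.exp (η * Λ) / 2) := by gcongr
  -- Large displacements are counted in the full `B`-ary tree, which almost surely contains the
  -- random one and makes the index set deterministic.
  set bad : ℕ → Set Ω := fun j => {ω | J j ≤
    ((generation (fun _ => B) (T - j)).filter fun u => ℓ (T - j) < |X u ω|).card} with hbad
  have hbadP : ∀ j ∈ Finset.range T, P (bad j) ≤ ENNReal.ofReal (Real.exp (-b ^ T)) := by
    intro j hj
    have hjT : T - (T - j) = j := by have := Finset.mem_range.1 hj; omega
    have hy : y₀ ≤ z j := by
      refine le_trans ?_ (hzη j)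
      rw [div_le_iff₀ hηb] at hT4
      rw [← hηΛ]; linarith
    have h1 := htail (z j) hy
    refine (h.measure_le_card_filter _ (J j) _).trans ?_
    rw [card_generation_const]
    simp only [hℓ, hjT]
    -- Half of `exp (z j)` is spent on the number of vertices and on the constant `C`.
    have h2 : ((B ^ (T - j) : ℕ) : ℝ≥0∞) * μ {x | z j ^ (1 / α) < |x|} ≤
        ENNReal.ofReal (Real.exp (-(Real.exp (z j) / 2))) := by
      calc ((B ^ (T - j) : ℕ) : ℝ≥0∞) * μ {x | z j ^ (1 / α) < |x|} ≤
          ENNReal.ofReal ((B ^ (T - j) : ℕ) : ℝ) *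
            ENNReal.ofReal (C * Real.exp (-Real.exp (z j))) := by
            rw [ENNReal.ofReal_natCast]; gcongr
        _ = ENNReal.ofReal (((B ^ (T - j) : ℕ) : ℝ) * (C * Real.exp (-Real.exp (z j)))) :=
            (ENNReal.ofReal_mul (by positivity)).symm
        _ ≤ _ := by
            refine ENNReal.ofReal_le_ofReal ?_
            have e1 : ((B ^ (T - j) : ℕ) : ℝ) ≤ Real.exp (T * Real.log B) := by
              rw [Real.exp_nat_mul, Real.exp_log hB0]
              push_cast
              exact pow_le_pow_right₀ hB1.le (Nat.sub_le _ _)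
            have e2 : C = Real.exp (Real.log C) := (Real.exp_log (by linarith)).symm
            calc ((B ^ (T - j) : ℕ) : ℝ) * (C * Real.exp (-Real.exp (z j))) ≤
                Real.exp (T * Real.log B) * (Real.exp (Real.log C) * Real.exp (-Real.exp (z j))) := by
                  rw [← e2]; gcongr
              _ = Real.exp (T * Real.log B + (Real.log C + -Real.exp (z j))) := by
                  rw [Real.exp_add (T * Real.log B), Real.exp_add (Real.log C)]
              _ ≤ _ := by
                  rw [Real.exp_le_exp]
                  have e3 : Real.exp (η * Λ) ≤ Real.exp (z j) := Real.exp_le_exp.2 (hzη j)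
                  have e4 : (0 : ℝ) ≤ T := Nat.cast_nonneg T
                  nlinarith [mul_nonneg e4 hlC]
    calc _ ≤ ENNReal.ofReal (Real.exp (-(Real.exp (z j) / 2))) ^ J j := by gcongr
      _ = ENNReal.ofReal (Real.exp (J j * -(Real.exp (z j) / 2))) := by
          rw [← ENNReal.ofReal_pow (Real.exp_nonneg _), ← Real.exp_nat_mul]
      _ ≤ _ := by
          refine ENNReal.ofReal_le_ofReal (Real.exp_le_exp.2 ?_)
          have := hJcost j
          linarith
  calc _ ≤ P (⋃ j ∈ Finset.range T, bad j) := by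
        refine measure_mono_ae ?_
        filter_upwards [hNB] with ω hω
        rintro ⟨hb', hfar⟩
        by_contra hcon
        have hlt : ∀ j ∈ Finset.range T, (B : ℝ) ^ j * (((generation (fun u => N u ω) (T - j)).filter
            fun u => ℓ (T - j) < |X u ω|).card : ℝ) ≤ ε * b ^ T / (T + 1) := by
          intro j hj
          have h1 : ω ∉ bad j := fun hmem => hcon (Set.mem_biUnion hj hmem)
          have h2 : ((generation (fun u => N u ω) (T - j)).filter
              fun u => ℓ (T - j) < |X u ω|).card < J j := by
            refine lt_of_le_of_lt (Finset.card_le_card (Finset.filter_subset_filter _ ?_))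
              (not_le.1 h1)
            exact generation_mono _ fun _ _ u _ => hω u
          rw [hJ, Nat.lt_ceil, lt_max_iff] at h2
          rcases h2 with h2 | h2
          · rw [Nat.cast_lt_one] at h2
            rw [h2, Nat.cast_zero, mul_zero]
            positivity
          · rw [lt_div_iff₀ (by positivity)] at h2
            rw [le_div_iff₀ (by positivity)]
            linarith
        have h3 := card_far_le (c := fun u => N u ω) (B := B) hω (fun u => X u ω) ℓ T
        have h4 : (((generation (fun u => N u ω) T).filter fun v =>
            ∑ j ∈ Finset.range T, z j ^ (1 / α) < |position (fun u => X u ω) v|).card : ℝ) ≤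
            ∑ j ∈ Finset.range T, (B : ℝ) ^ j * (((generation (fun u => N u ω) (T - j)).filter
            fun u => ℓ (T - j) < |X u ω|).card : ℝ) := by
          rw [hsum]
          exact_mod_cast h3
        have h5 := h4.trans (Finset.sum_le_sum hlt)
        rw [Finset.sum_const, Finset.card_range, nsmul_eq_mul] at h5
        have h6 : (T : ℝ) * (ε * b ^ T / (T + 1)) ≤ ε * b ^ T := by
          rw [mul_div_assoc', div_le_iff₀ (by positivity)]
          have : (0 : ℝ) ≤ ε * b ^ T := by positivity
          nlinarith
        have h7 : ε * (b : ℝ) ^ T ≤ ε * (generation (fun u => N u ω) T).card := by gcongr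
        have h8 := hfar.trans_le (h5.trans (h6.trans h7))
        exact lt_irrefl _ h8
    _ ≤ ∑ j ∈ Finset.range T, P (bad j) := measure_biUnion_finset_le _ _
    _ ≤ ∑ j ∈ Finset.range T, ENNReal.ofReal (Real.exp (-b ^ T)) := Finset.sum_le_sum hbadP
    _ = _ := by
        rw [Finset.sum_const, Finset.card_range, nsmul_eq_mul, ENNReal.ofReal_mul (Nat.cast_nonneg T),
          ENNReal.ofReal_natCast]

open Classical in
-- Without a bound on the offspring one large displacement could move a dominant subtree, so the
-- threshold is the same in every generation. A first moment suffices: a displacement beyond `((1 +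
-- η) T log b) ^ (1 / α)` costs `b ^ T exp (η Λ)` in the exponent, against a mean population of at
-- most `m ^ T`.
lemma eventually_measure_far_le {b : ℕ} (hb : 2 ≤ b) {m : ℝ} (hm : 2 ≤ m)
    (hmean : ∑' j : ℕ, off j * (j : ℝ≥0∞) = ENNReal.ofReal m)
    {α C y₀ ε η : ℝ} (hε : 0 < ε) (hη : 0 < η) (hC : 1 ≤ C)
    (htail : ∀ y, y₀ ≤ y → μ {x | y ^ (1 / α) < |x|} ≤ ENNReal.ofReal (C * Real.exp (-Real.exp y))) :
    ∀ᶠ T : ℕ in atTop, ∀ {N : List ℕ → Ω → ℕ} {X : List ℕ → Ω → ℝ} (_ : IsBRW P off μ N X),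
      P {ω | (b ^ T : ℝ) ≤ (generation (fun u => N u ω) T).card ∧
        ε * (generation (fun u => N u ω) T).card <
          (((generation (fun u => N u ω) T).filter fun v =>
            T * ((1 + η) * (T * Real.log b)) ^ (1 / α) <
              |position (fun u => X u ω) v|).card : ℝ)} ≤
        ENNReal.ofReal (T * Real.exp (-b ^ T)) := by
  have hb0 : (0 : ℝ) < b := by positivity
  have hb1 : (1 : ℝ) < b := by exact_mod_cast hb
  have hlb : 0 < Real.log b := Real.log_pos hb1
  have hlm : 0 < Real.log m := Real.log_pos (by linarith)
  have hm0 : 0 < m := by linarith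
  have hlC : 0 ≤ Real.log C := Real.log_nonneg hC
  have hηb : 0 < η * Real.log b := by positivity
  filter_upwards [eventually_mul_le_exp hηb (2 * (Real.log m + Real.log C)),
    eventually_mul_le_exp hηb 2,
    (tendsto_natCast_atTop_atTop (R := ℝ)).eventually_ge_atTop (y₀ / ((1 + η) * Real.log b))]
    with T hT1 hT3 hT4 N X h
  set Λ : ℝ := T * Real.log b with hΛ
  have hηΛ : η * Real.log b * T = η * Λ := by rw [hΛ]; ring
  rw [hηΛ] at hT1 hT3
  have hexpΛ : Real.exp Λ = b ^ T := by
    rw [hΛ, Real.exp_nat_mul, Real.exp_log hb0]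
  have hTn : (0 : ℝ) ≤ T := Nat.cast_nonneg T
  set z : ℝ := (1 + η) * Λ with hz
  have hy : y₀ ≤ z := by
    rw [div_le_iff₀ (by positivity)] at hT4
    rw [hz, hΛ]; linarith
  have hexpz : Real.exp z = b ^ T * Real.exp (η * Λ) := by
    rw [hz, add_mul, one_mul, Real.exp_add, hexpΛ]
  have hbT : (1 : ℝ) ≤ b ^ T := one_le_pow₀ hb1.le
  have hlarge : ∀ j ∈ Finset.range T, P {ω | ∃ u ∈ generation (fun u => N u ω) (T - j),
      z ^ (1 / α) < |X u ω|} ≤ ENNReal.ofReal (Real.exp (-b ^ T)) := by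
    intro j _
    refine (h.measure_exists_lt_abs_le hm0.le hmean _ _).trans ?_
    calc _ ≤ ENNReal.ofReal (m ^ (T - j)) * ENNReal.ofReal (C * Real.exp (-Real.exp z)) := by
          gcongr; exact htail z hy
      _ = ENNReal.ofReal (m ^ (T - j) * (C * Real.exp (-Real.exp z))) :=
          (ENNReal.ofReal_mul (by positivity)).symm
      _ ≤ _ := by
        refine ENNReal.ofReal_le_ofReal ?_
        have e1 : m ^ (T - j) ≤ Real.exp (T * Real.log m) := by
          rw [Real.exp_nat_mul, Real.exp_log hm0]
          exact pow_le_pow_right₀ (by linarith) (Nat.sub_le _ _)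
        have e2 : C = Real.exp (Real.log C) := (Real.exp_log (by linarith)).symm
        calc m ^ (T - j) * (C * Real.exp (-Real.exp z)) ≤
            Real.exp (T * Real.log m) * (Real.exp (Real.log C) * Real.exp (-Real.exp z)) := by
              rw [← e2]; gcongr
          _ = Real.exp (T * Real.log m + (Real.log C + -Real.exp z)) := by
              rw [Real.exp_add (T * Real.log m), Real.exp_add (Real.log C)]
          _ ≤ _ := by
              rw [Real.exp_le_exp, hexpz]
              nlinarith [mul_nonneg hTn hlC]
  calc _ ≤ P (⋃ j ∈ Finset.range T, {ω | ∃ u ∈ generation (fun u => N u ω) (T - j),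
      z ^ (1 / α) < |X u ω|}) := by
        refine measure_mono ?_
        rintro ω ⟨-, hfar⟩
        have hpos : (0 : ℝ) < (((generation (fun u => N u ω) T).filter fun v =>
            T * z ^ (1 / α) < |position (fun u => X u ω) v|).card : ℝ) :=
          lt_of_le_of_lt (by positivity) hfar
        rw [Nat.cast_pos, Finset.card_pos] at hpos
        obtain ⟨v, hv⟩ := hpos
        obtain ⟨hv, hv'⟩ := Finset.mem_filter.1 hv
        have hl := length_of_mem_generation hv
        obtain ⟨j, hj, hj'⟩ := exists_lt_abs_of_sum_lt (fun u => X u ω) (fun _ => z ^ (1 / α)) v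
          (by simpa [hl] using hv')
        rw [hl] at hj
        refine Set.mem_biUnion (Finset.mem_coe.2 (Finset.mem_range.2 hj)) ⟨v.drop j, ?_, hj'⟩
        refine drop_mem_generation (j := j) ?_
        rwa [show j + (T - j) = T by omega]
    _ ≤ ∑ j ∈ Finset.range T, P {ω | ∃ u ∈ generation (fun u => N u ω) (T - j),
      z ^ (1 / α) < |X u ω|} := measure_biUnion_finset_le _ _
    _ ≤ ∑ j ∈ Finset.range T, ENNReal.ofReal (Real.exp (-b ^ T)) := Finset.sum_le_sum hlarge
    _ = _ := by
        rw [Finset.sum_const, Finset.card_range, nsmul_eq_mul, ENNReal.ofReal_mul (Nat.cast_nonneg T),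
          ENNReal.ofReal_natCast]

end FarBound

/-! ### Upper bound of the probability -/

section UpperBound

variable {Ω : Type*} [mΩ : MeasurableSpace Ω] {P : Measure Ω} [IsProbabilityMeasure P] {off : PMF ℕ}
  {μ : Measure ℝ} [IsProbabilityMeasure μ] {N : List ℕ → Ω → ℕ} {X : List ℕ → Ω → ℝ}

open Classical in
-- The cases `B < ∞` and `B = ∞` in one form: `S T` is the distance that a positive share of
-- generation `T` does not reach at a price below `b ^ T`.
lemma exists_eventually_measure_far_le (h_off0 : off 0 = 0) (h_off1 : off 1 = 0)
    {m : ℝ} (hm : 2 ≤ m) (hmean : ∑' j : ℕ, off j * (j : ℝ≥0∞) = ENNReal.ofReal m)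
    (h_symm : μ.map (fun x : ℝ => -x) = μ) {α : ℝ} (h_alpha : 0 < α)
    (h_tail : (fun z : ℝ => μ.real (Set.Ioi z)) =Θ[atTop]
      fun z : ℝ => Real.exp (-Real.exp (z ^ α)))
    {ε η : ℝ} (hε : 0 < ε) (hη : 0 < η) (h : IsBRW P off μ N X) :
    ∃ S : ℕ → ℝ, (∀ᶠ T : ℕ in atTop, S T ≤ (1 + η) ^ (1 / α + 1) *
        ((T * Real.log (minOffspring off)) ^ (1 / α) * (T * (yConst off α)⁻¹))) ∧
      ∀ᶠ T : ℕ in atTop,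
      P {ω | ((minOffspring off : ℝ) ^ T : ℝ) ≤ (generation (fun u => N u ω) T).card ∧
        ε * (generation (fun u => N u ω) T).card <
          (((generation (fun u => N u ω) T).filter fun v =>
            S T < |position (fun u => X u ω) v|).card : ℝ)} ≤
        ENNReal.ofReal (T * Real.exp (-(minOffspring off : ℝ) ^ T)) := by
  obtain ⟨C, y₀, hC, -, htail⟩ := exists_tail_upper h_symm h_alpha h_tail
  have hb := two_le_minOffspring h_off0 h_off1
  set b := minOffspring off with hbdef
  have hb1 : (1 : ℝ) < b := by exact_mod_cast hb
  have hlb : 0 < Real.log b := Real.log_pos hb1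
  have hβ : 0 < 1 / α := by positivity
  by_cases hB : maxOffspring off = ⊤
  · refine ⟨fun T => T * ((1 + η) * (T * Real.log b)) ^ (1 / α), ?_, ?_⟩
    · refine Eventually.of_forall fun T => ?_
      have h2 := Real.mul_rpow (x := 1 + η) (y := T * Real.log b) (z := 1 / α) (by positivity)
        (by positivity)
      simp only [yConst, if_pos hB, inv_one, mul_one, h2]
      have h1 : (1 + η) ^ (1 / α) ≤ (1 + η) ^ (1 / α + 1) :=
        Real.rpow_le_rpow_of_exponent_le (by linarith) (by linarith)
      calc (T : ℝ) * ((1 + η) ^ (1 / α) * (T * Real.log b) ^ (1 / α)) =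
          (1 + η) ^ (1 / α) * ((T * Real.log b) ^ (1 / α) * T) := by ring
        _ ≤ _ := by gcongr
    · filter_upwards [eventually_measure_far_le (P := P) (off := off) hb hm hmean hε hη hC htail]
        with T hT using hT h
  · set B := (maxOffspring off).toNat with hBdef
    have hbB : b ≤ B := le_maxOffspring_toNat h_off0 hB (minOffspring_mem h_off0).2.ne'
    have hB1 : (1 : ℝ) < B := by exact_mod_cast hb.trans hbB
    have hlB : 0 < Real.log B := Real.log_pos hB1
    have hlbB : Real.log b ≤ Real.log B :=
      Real.log_le_log (by linarith) (by exact_mod_cast hbB)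
    refine ⟨fun T => ∑ j ∈ Finset.range T, (min (T * Real.log b) (j * Real.log B) +
              η * (T * Real.log b)) ^ (1 / α), ?_, ?_⟩
    · filter_upwards [eventually_gt_atTop 0] with T hT
      have h1 := sum_min_rpow_le (β := 1 / α) (Λ := T * Real.log b) (c := Real.log B) (η := η)
        (T := T) hβ (by positivity) hlB hη (by
          rw [div_le_iff₀ hlB]; gcongr)
      refine h1.trans (le_of_eq ?_)
      have h2 : (T : ℝ) - 1 / α / (1 / α + 1) * (T * Real.log b / Real.log B) =
          T * (yConst off α)⁻¹ := by
        rw [yConst, if_neg hB, ← hBdef, ← hbdef, inv_div]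
        field_simp
      rw [h2]
    · filter_upwards [eventually_measure_far_le_of_bounded (P := P) (off := off) hb hbB hε hη hC
        htail] with T hT
      refine hT h ?_
      filter_upwards [h.ae_off_ne_zero] with ω hω u using le_maxOffspring_toNat h_off0 hB (hω u)

lemma finite_setOf_abs_mul_le {δ : ℝ} (hδ : 0 < δ) (R : ℝ) : {i : ℤ | |i * δ| ≤ R}.Finite := by
  refine (Set.finite_Icc (-⌈R / δ⌉) ⌈R / δ⌉).subset fun i hi => ?_
  have h1 : |(i : ℝ)| ≤ R / δ := by
    rw [le_div_iff₀ hδ]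
    simpa [abs_mul, abs_of_pos hδ] using hi
  have h2 : |(i : ℝ)| ≤ ⌈R / δ⌉ := h1.trans (Int.le_ceil _)
  rw [abs_le] at h2
  exact ⟨by exact_mod_cast h2.1, by exact_mod_cast h2.2⟩

lemma IsBRW.exists_eventually_measure_le (h_off0 : off 0 = 0) (h_off1 : off 1 = 0)
    (h_offexp : ∃ θ : ℝ, 0 < θ ∧
      Summable fun k : ℕ => (off k).toReal * Real.exp (θ * (k : ℝ)))
    (h_symm : μ.map (fun x : ℝ => -x) = μ) (h_var : ∫ x : ℝ, x ^ 2 ∂μ = 1)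
    {α : ℝ} (h_alpha : 0 < α)
    (h_tail : (fun z : ℝ => μ.real (Set.Ioi z)) =Θ[atTop]
      fun z : ℝ => Real.exp (-Real.exp (z ^ α)))
    (h : IsBRW P off μ N X) {A : Set ℝ} (h_A : A ∈ halfLineAlgebra) {p : ℝ} (h_p : nu A < p)
    (h_p1 : p < 1) (h_fin : rateI A p < ⊤)
    (h_cont : ContinuousAt (fun q : ℝ => rateI A q) p) {R' η : ℝ} (hR0 : 0 < R')
    (hR' : R' < (rateI A p).toReal) (hη : 0 < η) {T : ℕ → ℕ} (hT : Tendsto T atTop atTop)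
    (hTn : Tendsto (fun n => (T n : ℝ) / n) atTop (𝓝 0))
    (hTR : ∀ᶠ n : ℕ in atTop, (1 + η) ^ (1 / α + 1) *
        ((T n * Real.log (minOffspring off)) ^ (1 / α) * (T n * (yConst off α)⁻¹)) <
        R' * √(n : ℝ)) :
    ∃ c > 0, ∀ᶠ n : ℕ in atTop, P.real {ω | p ≤ empirical (fun u => N u ω) (fun u => X u ω) n
        (√(n : ℝ) • A)} ≤ T n * Real.exp (-(minOffspring off : ℝ) ^ T n) +
          Real.exp (-c * (minOffspring off : ℝ) ^ T n) := by
  classical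
  have hp0 : 0 < p := measureReal_nonneg.trans_lt h_p
  obtain ⟨m, C, s₀, hm, hC, hs₀, hmean, hgen⟩ := exists_offspring_bound h_off0 h_off1 h_offexp
  obtain ⟨θ₀, K, hθ₀, hK, hexp⟩ := exists_lintegral_exp_treeSum_le (P := P) (μ := μ) hm hC hs₀
    hmean hgen
  obtain ⟨R, hR'R, hR⟩ := exists_between hR'
  obtain ⟨q, hqp, hq⟩ := exists_lt_forall_nu_lt h_cont h_fin (hR0.trans hR'R).le hR
  obtain ⟨δ₁, hδ₁, hδq⟩ := exists_forall_nu_cthickening_lt (finite_frontier_of_mem_halfLineAlgebra h_A)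
    hq
  have hq0 : 0 ≤ q := measureReal_nonneg.trans (hq 0 (by simp; linarith)).le
  obtain ⟨δ, hδ0, hδ₁', hδR⟩ : ∃ δ > 0, δ ≤ δ₁ ∧ δ ≤ R - R' :=
    ⟨min δ₁ (R - R'), lt_min hδ₁ (by linarith), min_le_left _ _, min_le_right _ _⟩
  have hpq : 0 < p - q := by linarith
  obtain ⟨θ, hθ0, hθθ₀, hθK⟩ : ∃ θ > 0, θ ≤ θ₀ ∧ K * θ ≤ (p - q) / 4 := by
    -- The quadratic error `K θ ^ 2` then takes at most half of the gain `θ (p - q) / 2`.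
    refine ⟨min θ₀ ((p - q) / (4 * (K + 1))), lt_min hθ₀ (by positivity), min_le_left _ _, ?_⟩
    calc K * min θ₀ ((p - q) / (4 * (K + 1))) ≤ (K + 1) * ((p - q) / (4 * (K + 1))) := by
          gcongr
          · linarith
          · exact min_le_right _ _
      _ = (p - q) / 4 := by field_simp
  set c := θ * ((p - q) / 4) with hc
  have hc0 : 0 < c := by positivity
  have hcθ : θ * (-((p - q) / 2)) + K * θ ^ 2 ≤ -c := by
    have : K * θ ^ 2 ≤ θ * ((p - q) / 4) := by nlinarith
    rw [hc]; linarith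
  obtain ⟨S, hS, hfar⟩ := exists_eventually_measure_far_le h_off0 h_off1 hm hmean h_symm h_alpha
    h_tail (ε := (p - q) / 4) (by positivity) hη h
  -- Only finitely many cells lie within distance `R`, so the central limit bound holds for all of
  -- them simultaneously.
  have hnear : ∀ᶠ n : ℕ in atTop, ∀ i ∈ {i : ℤ | |i * δ| ≤ R}, (walkLaw μ (n - T n)).real
      {s | (√(n : ℝ))⁻¹ * s + i * δ ∈ Metric.cthickening δ A} < q := by
    rw [eventually_all_finite (finite_setOf_abs_mul_le hδ0 R)]
    intro i hi
    refine h.eventually_walkLaw_le h_symm h_var hTn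
      (F := {s | s + i * δ ∈ Metric.cthickening δ A})
      (Metric.isClosed_cthickening.preimage (by fun_prop)) ?_
    have hsub : {s : ℝ | s + i * δ ∈ Metric.cthickening δ A} ⊆
        {s | s + i * δ ∈ Metric.cthickening δ₁ A} :=
      fun s hs => Metric.cthickening_mono hδ₁' A hs
    exact lt_of_le_of_lt (measureReal_mono hsub) (hδq _ hi)
  refine ⟨c, hc0, ?_⟩
  filter_upwards [hnear, hT.eventually hS, hT.eventually hfar, hTR, eventually_gt_atTop 0,
    hTn.eventually (gt_mem_nhds one_pos)] with n hn1 hn2 hn3 hn4 hn5 hn6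
  have hTle : T n ≤ n := by
    have hn' : (0 : ℝ) < n := by exact_mod_cast hn5
    rw [div_lt_one hn', Nat.cast_lt] at hn6
    exact hn6.le
  have hmain := h.measure_empirical_inter_le (m := m) (θ := θ) (K := K) (by linarith)
    (fun hh k f hf hf1 => hexp hh k hf hf1 θ hθ0.le hθθ₀) hθ0.le (A := A) (p := p)
    (q := q) (δ := δ) (R := R) (R' := R') (c := c) (b := minOffspring off) (n := n) (T := T n)
    hp0 h_p1 hq0 hδ0 (by linarith) hn5 hTle (fun i hi => (hn1 i hi).le) hc0.le hcθ
  have hb : ∀ᵐ ω ∂P, ((minOffspring off : ℝ) ^ T n : ℝ) ≤ (generation (fun u => N u ω) (T n)).card := by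
    filter_upwards [h.ae_off_ne_zero] with ω hω
    exact_mod_cast pow_le_card_generation (fun u => minOffspring_le h_off0 (hω u)) (T n)
  refine ENNReal.toReal_le_of_le_ofReal (by positivity) ?_
  rw [ENNReal.ofReal_add (by positivity) (by positivity)]
  refine le_trans (measure_mono_ae ?_) ((measure_union_le _ _).trans (add_le_add hn3 hmain))
  filter_upwards [hb] with ω hω hp
  by_cases hcase : (p - q) / 4 * (generation (fun u => N u ω) (T n)).card <
          (((generation (fun u => N u ω) (T n)).filter fun v =>
            S (T n) < |position (fun u => X u ω) v|).card : ℝ)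
  · exact Or.inl ⟨hω, hcase⟩
  · refine Or.inr ⟨hp, hω, ?_⟩
    refine le_trans ?_ (not_lt.1 hcase)
    refine Nat.cast_le.2 (Finset.card_le_card fun v hv => ?_)
    obtain ⟨hv1, hv2⟩ := Finset.mem_filter.1 hv
    exact Finset.mem_filter.2 ⟨hv1, (hn2.trans_lt hn4).trans_le hv2⟩

end UpperBound

/-! ### A tree with a dominant branch -/

section DominantBranch

/-- The offspring numbers of the tree in which the descendants of the leftmost vertex of
generation `t` have `K` children and all other vertices have `b` children. -/
def branchTree (b K t : ℕ) (u : List ℕ) : ℕ :=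
  open Classical in if List.replicate t 0 <:+ u then K else b

variable {b K t : ℕ}

lemma shift_branchTree : shift (List.replicate t 0) (branchTree b K t) = fun _ => K := by
  ext w
  simp [shift, branchTree]

lemma replicate_mem_generation {c : List ℕ → ℕ} (hc : ∀ u, 0 < c u) (k : ℕ) :
    List.replicate k 0 ∈ generation c k := by
  induction k with
  | zero => simp [generation_zero]
  | succ k ih => exact cons_mem_generation.2 ⟨ih, hc _⟩

open Classical in
lemma card_filter_suffix_generation (hb : 0 < b) (hK : 0 < K) (s : ℕ) :
    ((generation (branchTree b K t) (s + t)).filter fun v => List.replicate t 0 <:+ v).card =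
      K ^ s := by
  have hpos (u : List ℕ) : 0 < branchTree b K t u := by
    rw [branchTree]; split_ifs <;> assumption
  have heq : (generation (branchTree b K t) (s + t)).filter (fun v => List.replicate t 0 <:+ v) =
      (generation (fun _ => K) s).image fun w => w ++ List.replicate t 0 := by
    ext v
    simp only [Finset.mem_filter, Finset.mem_image]
    constructor
    · rintro ⟨hv, w, rfl⟩
      have hl := length_of_mem_generation hv
      have hw : w.length = s := by simp at hl; omega
      refine ⟨w, ?_, rfl⟩
      rw [← shift_branchTree (b := b) (t := t)]
      exact ((append_mem_generation hw).1 hv).2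
    · rintro ⟨w, hw, rfl⟩
      refine ⟨(append_mem_generation (length_of_mem_generation hw)).2
        ⟨replicate_mem_generation hpos t, ?_⟩, List.suffix_append _ _⟩
      rwa [shift_branchTree]
  rw [heq, Finset.card_image_of_injective _ fun a a' h => List.append_cancel_right h,
    card_generation_const]

open Classical in
lemma filter_not_suffix_generation_subset (k : ℕ) :
    (generation (branchTree b K t) k).filter (fun v => ¬ List.replicate t 0 <:+ v) ⊆
      generation (fun _ => b) k := by
  induction k with
  | zero => exact Finset.filter_subset _ _
  | succ k ih =>
    intro v hv
    obtain ⟨hv, hs⟩ := Finset.mem_filter.1 hv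
    match v with
    | [] => simp [nil_mem_generation] at hv
    | i :: u =>
      rw [cons_mem_generation] at hv ⊢
      have hu : ¬ List.replicate t 0 <:+ u := fun h => hs (h.trans (List.suffix_cons i u))
      refine ⟨ih (Finset.mem_filter.2 ⟨hv.1, hu⟩), ?_⟩
      have := hv.2
      rwa [branchTree, if_neg hu] at this

open Classical in
lemma card_filter_not_suffix_le (k : ℕ) :
    ((generation (branchTree b K t) k).filter fun v => ¬ List.replicate t 0 <:+ v).card ≤ b ^ k := by
  rw [← card_generation_const b k]
  exact Finset.card_le_card (filter_not_suffix_generation_subset k)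

open Classical in
/-- The vertices of generation `k` on the leftmost path up to generation `t` or below it. -/
def branch (b K t k : ℕ) : Finset (List ℕ) :=
  (generation (branchTree b K t) k).filter
    fun u => u <:+ List.replicate t 0 ∨ List.replicate t 0 <:+ u

/-- Truncated subtraction covers both regimes: up to generation `t` the branch is a single path and
the bound is `1`. -/
lemma card_branch_le (hb : 0 < b) (hK : 0 < K) (k : ℕ) : (branch b K t k).card ≤ K ^ (k - t) := by
  classical
  rcases le_total t k with htk | hkt
  · rw [← card_filter_suffix_generation (t := t) hb hK (k - t), Nat.sub_add_cancel htk]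
    refine Finset.card_le_card fun u hu => ?_
    obtain ⟨hu, h⟩ := Finset.mem_filter.1 hu
    refine Finset.mem_filter.2 ⟨hu, ?_⟩
    rcases h with h | h
    · have hl := h.length_le
      rw [length_of_mem_generation hu, List.length_replicate] at hl
      rw [h.eq_of_length_le (by rw [length_of_mem_generation hu, List.length_replicate]; omega)]
    · exact h
  · rw [Nat.sub_eq_zero_of_le hkt, pow_zero, Finset.card_le_one]
    have key : ∀ u ∈ branch b K t k, u = List.replicate k 0 := by
      intro u hu
      obtain ⟨hu, h⟩ := Finset.mem_filter.1 hu
      have hl := length_of_mem_generation hu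
      have h' : u <:+ List.replicate t 0 := by
        rcases h with h | h
        · exact h
        · rw [h.eq_of_length_le (by rw [hl, List.length_replicate]; omega)]
      rw [List.eq_replicate_iff]
      exact ⟨hl, fun a ha => List.eq_of_mem_replicate (h'.subset ha)⟩
    intro u hu u' hu'
    rw [key u hu, key u' hu']

lemma card_generation_branchTree_le (hb : 0 < b) (hK : 0 < K) {k T : ℕ} (hk : k ≤ T) :
    (generation (branchTree b K t) k).card ≤ b ^ T + K ^ (T - t) := by
  classical
  rw [← Finset.card_filter_add_card_filter_not (fun v => List.replicate t 0 <:+ v), add_comm]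
  refine add_le_add ((card_filter_not_suffix_le k).trans (Nat.pow_le_pow_right hb hk)) ?_
  refine le_trans (Finset.card_le_card ?_) ((card_branch_le (b := b) (t := t) hb hK k).trans
    (Nat.pow_le_pow_right hK (by omega)))
  intro u hu
  obtain ⟨hu, h⟩ := Finset.mem_filter.1 hu
  exact Finset.mem_filter.2 ⟨hu, Or.inr h⟩

lemma position_mem_Icc {x : List ℕ → ℝ} {σ : ℝ} {lo hi : ℕ → ℝ} (v : List ℕ)
    (h : ∀ u, u <:+ v → u ≠ [] → lo u.length ≤ σ * x u ∧ σ * x u ≤ hi u.length) :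
    ∑ k ∈ Finset.range v.length, lo (k + 1) ≤ σ * position x v ∧
      σ * position x v ≤ ∑ k ∈ Finset.range v.length, hi (k + 1) := by
  induction v with
  | nil => simp [position]
  | cons i u ih =>
    have h1 := ih fun w hw => h w (hw.trans (List.suffix_cons i u))
    have h2 := h (i :: u) (List.suffix_refl _) (by simp)
    rw [List.length_cons, Finset.sum_range_succ, Finset.sum_range_succ, position, mul_add]
    rw [List.length_cons] at h2
    exact ⟨add_le_add h1.1 h2.1, add_le_add h1.2 h2.2⟩

lemma mem_branch_of_suffix {T : ℕ} {u v : List ℕ} (hv : v ∈ generation (branchTree b K t) T)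
    (hs : List.replicate t 0 <:+ v) (hu : u <:+ v) : u ∈ branch b K t u.length := by
  classical
  refine Finset.mem_filter.2 ⟨?_, ?_⟩
  · obtain ⟨w, rfl⟩ := hu
    have hl := length_of_mem_generation hv
    rw [List.length_append] at hl
    rw [← hl] at hv
    exact ((append_mem_generation rfl).1 hv).1
  · exact List.suffix_or_suffix_of_suffix hu hs

end DominantBranch

/-! ### Lower bound of the tail -/

section TailLower

variable {μ : Measure ℝ} [IsProbabilityMeasure μ] {α : ℝ}

/-- The displacements must be controlled from both sides. The doubly exponential tail makes a window
as likely as the half-line up to constants, since `exp (((1 + δ) z) ^ α) - exp (z ^ α)` tends to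
infinity. -/
lemma exists_tail_lower_Ioc (h_alpha : 0 < α)
    (h_tail : (fun z : ℝ => μ.real (Set.Ioi z)) =Θ[atTop]
      fun z : ℝ => Real.exp (-Real.exp (z ^ α))) {δ : ℝ} (hδ : 0 < δ) :
    ∃ C z₁ : ℝ, 0 < C ∧ 0 ≤ z₁ ∧ ∀ z, z₁ ≤ z →
      Real.exp (-(C * Real.exp (z ^ α))) ≤ μ.real (Set.Ioc z ((1 + δ) * z)) := by
  obtain ⟨C₀, hC₀, hub⟩ := h_tail.1.exists_pos
  obtain ⟨c₁, hc₁, hlb⟩ := h_tail.2.exists_pos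
  have hub' := hub.bound
  have hlb' := hlb.bound
  obtain ⟨z₂, hz₂⟩ := eventually_atTop.1 hub'
  obtain ⟨z₃, hz₃⟩ := eventually_atTop.1 hlb'
  have hgap : 0 < (1 + δ) ^ α - 1 := sub_pos.2 (Real.one_lt_rpow (by linarith) h_alpha)
  have hlim : Tendsto (fun z : ℝ => ((1 + δ) ^ α - 1) * z ^ α) atTop atTop :=
    (tendsto_rpow_atTop h_alpha).const_mul_atTop hgap
  obtain ⟨z₄, hz₄⟩ := eventually_atTop.1 (hlim.eventually_ge_atTop (Real.log (2 * C₀ * c₁)))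
  -- The prefactor `(2 c₁)⁻¹` moves into the exponent because `exp (z ^ α) ≥ 1`.
  refine ⟨1 + |Real.log (2 * c₁)|, max (max z₂ z₃) (max z₄ 0), by positivity,
    (le_max_right _ _).trans (le_max_right _ _), fun z hz => ?_⟩
  have h2 : z₂ ≤ z := ((le_max_left _ _).trans (le_max_left _ _)).trans hz
  have h3 : z₃ ≤ z := ((le_max_right _ _).trans (le_max_left _ _)).trans hz
  have h4 : z₄ ≤ z := ((le_max_left _ _).trans (le_max_right _ _)).trans hz
  have h0 : 0 ≤ z := ((le_max_right _ _).trans (le_max_right _ _)).trans hz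
  set w := z ^ α with hw
  have hw0 : 0 ≤ w := by positivity
  set w' := ((1 + δ) * z) ^ α with hw'
  have hww : w' = (1 + δ) ^ α * w := by rw [hw', Real.mul_rpow (by positivity) h0]
  have hzz : z ≤ (1 + δ) * z := by nlinarith
  have e1 := hz₃ z h3
  have e2 := hz₂ ((1 + δ) * z) (h2.trans hzz)
  rw [Real.norm_eq_abs, Real.norm_eq_abs, abs_of_nonneg measureReal_nonneg, Real.abs_exp] at e1 e2
  have hsplit : μ.real (Set.Ioc z ((1 + δ) * z)) =
      μ.real (Set.Ioi z) - μ.real (Set.Ioi ((1 + δ) * z)) := by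
    rw [eq_sub_iff_add_eq, ← measureReal_union _ measurableSet_Ioi, Set.Ioc_union_Ioi_eq_Ioi hzz]
    rw [Set.disjoint_left]
    intro x hx hx'
    exact absurd hx.2 (not_le.2 hx')
  have hdiff : Real.log (2 * C₀ * c₁) ≤ Real.exp w' - Real.exp w := by
    refine (hz₄ z h4).trans ?_
    have hle : w' = w + ((1 + δ) ^ α - 1) * w := by rw [hww]; ring
    have hnn : 0 ≤ ((1 + δ) ^ α - 1) * w := by positivity
    have hee : Real.exp w' = Real.exp w * Real.exp (((1 + δ) ^ α - 1) * w) := by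
      rw [hle, Real.exp_add]
    have := Real.add_one_le_exp (((1 + δ) ^ α - 1) * w)
    have h1w : 1 ≤ Real.exp w := Real.one_le_exp hw0
    rw [hee]
    nlinarith
  have hsmall : C₀ * Real.exp (-Real.exp w') ≤ (2 * c₁)⁻¹ * Real.exp (-Real.exp w) := by
    have h5 : Real.exp (-Real.exp w') ≤ Real.exp (-Real.exp w) * (2 * C₀ * c₁)⁻¹ := by
      rw [← Real.exp_log (show 0 < (2 * C₀ * c₁)⁻¹ by positivity), ← Real.exp_add,
        Real.exp_le_exp, Real.log_inv]
      linarith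
    calc C₀ * Real.exp (-Real.exp w') ≤ C₀ * (Real.exp (-Real.exp w) * (2 * C₀ * c₁)⁻¹) := by gcongr
      _ = _ := by field_simp
  have hlow : 2 * (2 * c₁)⁻¹ * Real.exp (-Real.exp w) ≤ μ.real (Set.Ioi z) := by
    rw [mul_inv, ← mul_assoc, mul_inv_cancel₀ two_ne_zero, one_mul, inv_mul_le_iff₀ hc₁]
    exact e1
  have hfin : (2 * c₁)⁻¹ * Real.exp (-Real.exp w) ≤ μ.real (Set.Ioc z ((1 + δ) * z)) := by
    rw [hsplit]; linarith
  refine le_trans ?_ hfin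
  rw [← Real.exp_log (show 0 < (2 * c₁)⁻¹ by positivity), ← Real.exp_add, Real.exp_le_exp,
    Real.log_inv]
  have h1w : 1 ≤ Real.exp w := Real.one_le_exp hw0
  nlinarith [le_abs_self (Real.log (2 * c₁)), abs_nonneg (Real.log (2 * c₁))]

/-- To allow small `z` as well, the window at `z₁` is used below `z₁`; this costs an additive width
`D` and a larger `C`. Symmetry of the law allows either direction `σ`. -/
lemma exists_tail_lower (h_symm : μ.map (fun x : ℝ => -x) = μ) (h_alpha : 0 < α)
    (h_tail : (fun z : ℝ => μ.real (Set.Ioi z)) =Θ[atTop]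
      fun z : ℝ => Real.exp (-Real.exp (z ^ α))) {δ : ℝ} (hδ : 0 < δ) {σ : ℝ}
    (hσ : σ = 1 ∨ σ = -1) :
    ∃ C D : ℝ, 0 < C ∧ 0 ≤ D ∧ ∀ z, 0 ≤ z →
      Real.exp (-(C * Real.exp (z ^ α))) ≤
        μ.real {x | z ≤ σ * x ∧ σ * x ≤ (1 + δ) * z + D} := by
  obtain ⟨C, z₁, hC, hz₁, h⟩ := exists_tail_lower_Ioc h_alpha h_tail hδ
  have h1 : ∀ z, 0 ≤ z → Real.exp (-(C * Real.exp (z₁ ^ α) * Real.exp (z ^ α))) ≤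
      μ.real (Set.Icc z ((1 + δ) * z + (1 + δ) * z₁)) := by
    intro z hz
    rcases le_total z₁ z with hzz | hzz
    · refine le_trans ?_ ((h z hzz).trans (measureReal_mono fun x hx => ⟨hx.1.le, ?_⟩))
      · rw [Real.exp_le_exp, neg_le_neg_iff]
        have : 1 ≤ Real.exp (z₁ ^ α) := Real.one_le_exp (by positivity)
        gcongr
        exact le_mul_of_one_le_right hC.le this
      · have : 0 ≤ (1 + δ) * z₁ := by positivity
        linarith [hx.2]
    · refine le_trans ?_ ((h z₁ le_rfl).trans (measureReal_mono fun x hx => ⟨hzz.trans hx.1.le, ?_⟩))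
      · rw [Real.exp_le_exp, neg_le_neg_iff]
        have : 1 ≤ Real.exp (z ^ α) := Real.one_le_exp (by positivity)
        exact le_mul_of_one_le_right (by positivity) this
      · have : 0 ≤ (1 + δ) * z := by positivity
        linarith [hx.2]
  refine ⟨C * Real.exp (z₁ ^ α), (1 + δ) * z₁, by positivity, by positivity, fun z hz => ?_⟩
  refine (h1 z hz).trans (le_of_eq ?_)
  rcases hσ with rfl | rfl
  · congr 1
    ext x
    simp
  · conv_lhs => rw [← h_symm]
    rw [map_measureReal_apply (by fun_prop) measurableSet_Icc]
    congr 1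
    ext x
    simp only [Set.mem_preimage, Set.mem_Icc, Set.mem_ofPred_eq, neg_mul, one_mul]

end TailLower

/-! ### Lower bound of the probability -/

section LowerBound

variable {Ω : Type*} [mΩ : MeasurableSpace Ω] {P : Measure Ω} [IsProbabilityMeasure P] {off : PMF ℕ}
  {μ : Measure ℝ} [IsProbabilityMeasure μ] {N : List ℕ → Ω → ℕ} {X : List ℕ → Ω → ℝ}

/-- The event that the first `T` generations form the tree `branchTree b K t` and that the
displacements along the branch are about `z k` in generation `k`. -/
def branchEvent (N : List ℕ → Ω → ℕ) (X : List ℕ → Ω → ℝ) (b K t T : ℕ) (σ : ℝ) (z hi : ℕ → ℝ) :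
    Set Ω :=
  (⋂ u ∈ (Finset.range T).biUnion fun k => generation (branchTree b K t) k,
    N u ⁻¹' {branchTree b K t u}) ∩
  ⋂ u ∈ (Finset.range T).biUnion fun k => branch b K t (k + 1),
    X u ⁻¹' {x | z u.length ≤ σ * x ∧ σ * x ≤ hi u.length}

lemma measurableSet_window (σ a b : ℝ) : MeasurableSet {x : ℝ | a ≤ σ * x ∧ σ * x ≤ b} :=
  (measurableSet_le measurable_const (measurable_const_mul σ)).inter
    (measurableSet_le (measurable_const_mul σ) measurable_const)

lemma length_of_mem_branch {b K t k : ℕ} {u : List ℕ} (hu : u ∈ branch b K t k) : u.length = k := by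
  classical
  exact length_of_mem_generation (Finset.mem_filter.1 hu).1

lemma measurableSet_branchEvent (b K t T : ℕ) (σ : ℝ) (z hi : ℕ → ℝ) :
    MeasurableSet[sigma N X (pastIndex T)] (branchEvent N X b K t T σ z hi) := by
  refine @MeasurableSet.inter _ (sigma N X (pastIndex T)) _ _ ?_ ?_
  · refine Finset.measurableSet_biInter (m := sigma N X (pastIndex T)) _ fun u hu => ?_
    obtain ⟨k, hk, hu⟩ := Finset.mem_biUnion.1 hu
    have hl : u.length < T := (length_of_mem_generation hu).trans_lt (Finset.mem_range.1 hk)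
    exact measurable_sigma_N (S := pastIndex T) ⟨hl.le, fun _ => hl⟩ (measurableSet_singleton _)
  · refine Finset.measurableSet_biInter (m := sigma N X (pastIndex T)) _ fun u hu => ?_
    obtain ⟨k, hk, hu⟩ := Finset.mem_biUnion.1 hu
    have hl : u.length ≤ T := (length_of_mem_branch hu).trans_le (Finset.mem_range.1 hk)
    exact measurable_sigma_X (S := pastIndex T) ⟨hl, by simp⟩ (measurableSet_window _ _ _)

/-- By independence each prescribed vertex costs a factor `π`, and in generation `k` at most `K ^ (k
- t)` displacements cost `exp (-a k)` each. -/
lemma IsBRW.le_measureReal_branchEvent (h : IsBRW P off μ N X) {b K t T : ℕ} (hb : 0 < b)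
    (hK : 0 < K) {π : ℝ} (hπ0 : 0 < π) (hπ1 : π ≤ 1) (hπb : π ≤ (off b).toReal)
    (hπK : π ≤ (off K).toReal) {σ : ℝ} {z hi a : ℕ → ℝ} (ha : ∀ k, 0 ≤ a k)
    (hX : ∀ k, Real.exp (-a k) ≤ μ.real {x | z k ≤ σ * x ∧ σ * x ≤ hi k}) :
    π ^ (T * (b ^ T + K ^ (T - t))) *
      Real.exp (-∑ k ∈ Finset.range T, (K : ℝ) ^ (k + 1 - t) * a (k + 1)) ≤
      P.real (branchEvent N X b K t T σ z hi) := by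
  have hN' : iIndepFun N P := h.indep.comp (fun _ => Prod.fst) fun _ => measurable_fst
  have hX' : iIndepFun X P := h.indep.comp (fun _ => Prod.snd) fun _ => measurable_snd
  have hind : Indep (sigma N X {i | i.2 = true}) (sigma N X {i | i.2 = false}) P :=
    h.indep_sigma (by
      rw [Set.disjoint_left]
      intro i hi hi'
      simp_all)
  set U := (Finset.range T).biUnion fun k => generation (branchTree b K t) k with hU
  set V := (Finset.range T).biUnion fun k => branch b K t (k + 1) with hV
  have hmul : P.real (branchEvent N X b K t T σ z hi) =
      P.real (⋂ u ∈ U, N u ⁻¹' {branchTree b K t u}) *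
      P.real (⋂ u ∈ V, X u ⁻¹' {x | z u.length ≤ σ * x ∧ σ * x ≤ hi u.length}) := by
    rw [measureReal_def, measureReal_def, measureReal_def, ← ENNReal.toReal_mul]
    congr 1
    refine (Indep_iff _ _ _).1 hind _ _ ?_ ?_
    · exact Finset.measurableSet_biInter (m := sigma N X {i | i.2 = true}) _ fun u _ =>
        measurable_sigma_N (S := {i | i.2 = true}) rfl (measurableSet_singleton _)
    · exact Finset.measurableSet_biInter (m := sigma N X {i | i.2 = false}) _ fun u _ =>
        measurable_sigma_X (S := {i | i.2 = false}) rfl (measurableSet_window _ _ _)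
  have h1 : π ^ (T * (b ^ T + K ^ (T - t))) ≤ P.real (⋂ u ∈ U, N u ⁻¹' {branchTree b K t u}) := by
    rw [measureReal_def, hN'.measure_inter_preimage_eq_mul U
      (fun u _ => measurableSet_singleton _), ENNReal.toReal_prod]
    have hcard : U.card ≤ T * (b ^ T + K ^ (T - t)) := by
      refine Finset.card_biUnion_le.trans ?_
      calc _ ≤ ∑ k ∈ Finset.range T, (b ^ T + K ^ (T - t)) :=
            Finset.sum_le_sum fun k hk =>
              card_generation_branchTree_le hb hK (Finset.mem_range.1 hk).le
        _ = _ := by simp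
    refine (pow_le_pow_of_le_one hπ0.le hπ1 hcard).trans ?_
    rw [← Finset.prod_const]
    refine Finset.prod_le_prod (fun _ _ => hπ0.le) fun u _ => ?_
    have : P (N u ⁻¹' {branchTree b K t u}) = off (branchTree b K t u) := h.measure_N_eq u _
    rw [this, branchTree]
    split_ifs <;> assumption
  have h2 : Real.exp (-∑ k ∈ Finset.range T, (K : ℝ) ^ (k + 1 - t) * a (k + 1)) ≤
      P.real (⋂ u ∈ V, X u ⁻¹' {x | z u.length ≤ σ * x ∧ σ * x ≤ hi u.length}) := by
    rw [measureReal_def, hX'.measure_inter_preimage_eq_mul V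
      (fun u _ => measurableSet_window _ _ _), ENNReal.toReal_prod]
    have hsum : ∑ u ∈ V, a u.length ≤ ∑ k ∈ Finset.range T, (K : ℝ) ^ (k + 1 - t) * a (k + 1) := by
      rw [hV, Finset.sum_biUnion]
      · refine Finset.sum_le_sum fun k _ => ?_
        rw [Finset.sum_congr rfl fun u hu => by rw [length_of_mem_branch hu], Finset.sum_const,
          nsmul_eq_mul]
        refine mul_le_mul_of_nonneg_right ?_ (ha _)
        exact_mod_cast card_branch_le hb hK (k + 1)
      · intro k _ k' _ hne
        rw [Function.onFun, Finset.disjoint_left]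
        intro u hu hu'
        have := (length_of_mem_branch hu).symm.trans (length_of_mem_branch hu')
        omega
    calc _ ≤ Real.exp (-∑ u ∈ V, a u.length) := Real.exp_le_exp.2 (neg_le_neg hsum)
      _ = ∏ u ∈ V, Real.exp (-a u.length) := by rw [← Finset.sum_neg_distrib, Real.exp_sum]
      _ ≤ _ := by
        refine Finset.prod_le_prod (fun _ _ => Real.exp_nonneg _) fun u _ => ?_
        refine (hX u.length).trans (le_of_eq ?_)
        rw [measureReal_def, ← h.law_X u, Measure.map_apply (h.measurable_X u)
          (measurableSet_window _ _ _)]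
  rw [hmul]
  exact mul_le_mul h1 h2 (Real.exp_nonneg _) measureReal_nonneg

lemma generation_eq_of_mem_branchEvent {b K t T : ℕ} {σ : ℝ} {z hi : ℕ → ℝ} {ω : Ω}
    (hω : ω ∈ branchEvent N X b K t T σ z hi) :
    generation (fun u => N u ω) T = generation (branchTree b K t) T := by
  refine generation_congr fun j hj u hu => ?_
  exact Set.mem_iInter₂.1 hω.1 u (Finset.mem_biUnion.2 ⟨j, Finset.mem_range.2 hj, hu⟩)

lemma position_of_mem_branchEvent {b K t T : ℕ} {σ : ℝ} {z hi : ℕ → ℝ} {ω : Ω}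
    (hω : ω ∈ branchEvent N X b K t T σ z hi) {v : List ℕ}
    (hv : v ∈ generation (branchTree b K t) T) (hs : List.replicate t 0 <:+ v) :
    ∑ k ∈ Finset.range T, z (k + 1) ≤ σ * position (fun u => X u ω) v ∧
      σ * position (fun u => X u ω) v ≤ ∑ k ∈ Finset.range T, hi (k + 1) := by
  have hl := length_of_mem_generation hv
  have := position_mem_Icc (x := fun u => X u ω) (σ := σ) (lo := z) (hi := hi) v
    fun u hu hne => by
      refine Set.mem_iInter₂.1 hω.2 u (Finset.mem_biUnion.2 ⟨u.length - 1, ?_, ?_⟩)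
      · have h1 := hu.length_le
        have h2 := List.length_pos_iff.2 hne
        rw [Finset.mem_range]; omega
      · have h2 := List.length_pos_iff.2 hne
        rw [Nat.sub_add_cancel h2]
        exact mem_branch_of_suffix hv hs hu
  rwa [hl] at this

set_option maxHeartbeats 1000000 in
/-- If the branch dominates generation `T`, then the branch event makes the proportion of particles
in `√n A` at least `p` with probability at least `1 / 2`. -/
lemma IsBRW.le_measureReal_empirical {m θ C : ℝ} (hm : 0 < m)
    (hexp : ∀ {N : List ℕ → Ω → ℕ} {X : List ℕ → Ω → ℝ}
      (_ : IsBRW P off μ N X) (k : ℕ) {f : ℝ → ℝ} (_ : Measurable f) (_ : ∀ s, |f s| ≤ 1),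
      ∫⁻ ω, ENNReal.ofReal (Real.exp (θ *
        (treeSum (fun u => N u ω) (fun u => X u ω) k f / m ^ k))) ∂P ≤
      ENNReal.ofReal (Real.exp (θ * ∫ s, f s ∂walkLaw μ k + C * θ ^ 2)))
    (hθ : 0 ≤ θ) (hC : 0 ≤ C) (h : IsBRW P off μ N X) {A : Set ℝ} {p ε δ x σ : ℝ} {b K n t T : ℕ}
    (hp0 : 0 ≤ p) (hp1 : p ≤ 1) (hε : 0 < ε) (hε1 : ε ≤ 1) (hδ : 0 < δ) (hn : 0 < n)
    (ht : t ≤ T) (hT : T ≤ n) (hb : 0 < b) (hK : 0 < K) (hσ : σ ^ 2 = 1) (hx : σ * x = |x|)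
    (hnear : (walkLaw μ (n - T)).real
      {s | (√(n : ℝ))⁻¹ * s + x ∈ Metric.cthickening δ Aᶜ} ≤ 1 - p - 2 * ε)
    {z hi : ℕ → ℝ} (hlo : ∑ k ∈ Finset.range T, z (k + 1) = |x| * √(n : ℝ))
    (hhi : ∑ k ∈ Finset.range T, hi (k + 1) ≤ (|x| + δ) * √(n : ℝ))
    (hdom : t = 0 ∨ (b : ℝ) ^ T ≤ ε * K ^ (T - t))
    (hθε : 4 * C * θ ≤ ε) (hbig : 2 ≤ θ * ε * K ^ (T - t)) :
    P.real (branchEvent N X b K t T σ z hi) / 2 ≤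
      P.real {ω | p ≤ empirical (fun u => N u ω) (fun u => X u ω) n (√(n : ℝ) • A)} := by
  classical
  have hn' : (0 : ℝ) < √(n : ℝ) := Real.sqrt_pos.2 (by exact_mod_cast hn)
  set g := generation (branchTree b K t) T with hg
  have hgl : ∀ v ∈ g, v.length = T := fun v hv => length_of_mem_generation hv
  set E : Set ℝ := {s | (√(n : ℝ))⁻¹ * s + x ∈ Metric.cthickening δ Aᶜ} with hE
  have hEm : MeasurableSet E :=
    Metric.isClosed_cthickening.measurableSet.preimage ((measurable_id.const_mul _).add_const _)
  -- This dominates `p` minus the indicator of `√n A`: on the branch through the thickened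
  -- complement of `A`, elsewhere trivially. A negative sum is then what is wanted.
  set f : List ℕ → ℝ → ℝ := fun v s =>
    if List.replicate t 0 <:+ v then E.indicator 1 s - (1 - p) else p with hf
  have hfm (v : List ℕ) : Measurable (f v) := by
    simp only [hf]
    split_ifs
    · exact (measurable_one.indicator hEm).sub_const _
    · exact measurable_const
  have hf1 (v : List ℕ) (s : ℝ) : |f v s| ≤ 1 := by
    simp only [hf]
    split_ifs
    · by_cases hs : s ∈ E
      · simp only [hs, Set.indicator_of_mem, Pi.one_apply]
        rw [abs_le]; constructor <;> linarith
      · simp only [hs, not_false_eq_true, Set.indicator_of_notMem, zero_sub, abs_neg]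
        rw [abs_le]; constructor <;> linarith
    · rw [abs_le]; constructor <;> linarith
  set H : Set Ω := {ω | 0 ≤ ∑ v ∈ g, treeSum (fun u => N (u ++ v) ω) (fun u => X (u ++ v) ω)
    (n - T) (f v)} with hH
  set M : ℝ := (K : ℝ) ^ (T - t) with hM
  have hMpos : 0 < M := by positivity
  have hchosen : ((g.filter fun v => List.replicate t 0 <:+ v).card : ℝ) = M := by
    have := card_filter_suffix_generation (t := t) hb hK (T - t)
    rw [Nat.sub_add_cancel ht] at this
    rw [hg, this, hM]
    push_cast
    rfl
  have hother : ((g.filter fun v => ¬ List.replicate t 0 <:+ v).card : ℝ) ≤ ε * M := by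
    rcases hdom with rfl | hdom
    · simp only [List.replicate_zero, List.nil_suffix, not_true_eq_false, Finset.filter_false,
        Finset.card_empty, Nat.cast_zero]
      positivity
    · refine le_trans ?_ hdom
      exact_mod_cast card_filter_not_suffix_le (K := K) (t := t) T
  have hgcard : (g.card : ℝ) ≤ 2 * M := by
    have := Finset.card_filter_add_card_filter_not (s := g) (fun v => List.replicate t 0 <:+ v)
    have h1 : (g.card : ℝ) = (g.filter fun v => List.replicate t 0 <:+ v).card +
        (g.filter fun v => ¬ List.replicate t 0 <:+ v).card := by exact_mod_cast this.symm
    rw [h1, hchosen]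
    nlinarith
  -- The `M` branch vertices contribute at most `-2 ε` each, and the at most `ε M` others at most
  -- `1` each.
  have hint : ∑ v ∈ g, ∫ s, f v s ∂walkLaw μ (n - T) ≤ -(ε * M) := by
    have hle : ∀ v ∈ g, ∫ s, f v s ∂walkLaw μ (n - T) ≤
        if List.replicate t 0 <:+ v then -(2 * ε) else 1 := by
      intro v _
      simp only [hf]
      split_ifs
      · have hI : Integrable (E.indicator (1 : ℝ → ℝ)) (walkLaw μ (n - T)) :=
          (integrable_const (1 : ℝ)).indicator hEm
        rw [integral_sub hI (integrable_const _), integral_indicator_one hEm]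
        simp only [integral_const, probReal_univ, smul_eq_mul, one_mul]
        linarith
      · simpa using hp1
    refine (Finset.sum_le_sum hle).trans ?_
    rw [Finset.sum_ite, Finset.sum_const, Finset.sum_const, nsmul_eq_mul, nsmul_eq_mul, hchosen]
    linarith
  have hPH : P.real H ≤ 1 / 2 := by
    have h1 := h.measure_sum_treeSum_nonneg_le hm hexp hθ g hgl (n - T) hfm hf1
    have h2 := ENNReal.toReal_le_of_le_ofReal (Real.exp_nonneg _) h1
    refine h2.trans ?_
    -- The error is at most `2 C θ ^ 2 M ≤ θ ε M / 2`, so the exponent is at most `-θ ε M / 2 ≤ -1`.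
    have h3 : θ * ∑ v ∈ g, ∫ s, f v s ∂walkLaw μ (n - T) + C * θ ^ 2 * g.card ≤ -1 := by
      have e1 : θ * ∑ v ∈ g, ∫ s, f v s ∂walkLaw μ (n - T) ≤ θ * -(ε * M) := by gcongr
      have e2 : C * θ ^ 2 * g.card ≤ C * θ ^ 2 * (2 * M) := by gcongr
      have e4 : (4 * C * θ) * (θ * M / 2) ≤ ε * (θ * M / 2) := by gcongr
      nlinarith
    refine (Real.exp_le_exp.2 h3).trans ?_
    rw [Real.exp_neg, one_div]
    have : 2 ≤ Real.exp 1 := by linarith [Real.add_one_le_exp (1 : ℝ)]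
    gcongr
  have hHm : MeasurableSet[sigma N X (⋃ v ∈ g, subtreeIndex v)] H := by
    have hsm : Measurable[sigma N X (⋃ v ∈ g, subtreeIndex v)] fun ω => ∑ v ∈ g,
        treeSum (fun u => N (u ++ v) ω) (fun u => X (u ++ v) ω) (n - T) (f v) :=
      Finset.measurable_fun_sum (m := sigma N X (⋃ v ∈ g, subtreeIndex v)) g fun v hv =>
        (measurable_treeSum_subtree v (n - T) (hfm v)).mono
          (sigma_mono (Set.subset_biUnion_of_mem (u := fun v => subtreeIndex v) hv)) le_rfl
    exact hsm (measurableSet_Ici (a := (0 : ℝ)))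
  have hdisj : Disjoint (pastIndex T) (⋃ v ∈ g, subtreeIndex v) := by
    rw [Set.disjoint_iUnion₂_right]
    intro v hv
    rw [← hgl v hv]
    exact disjoint_pastIndex_subtreeIndex v
  have hindep : P.real (branchEvent N X b K t T σ z hi ∩ Hᶜ) =
      P.real (branchEvent N X b K t T σ z hi) * P.real Hᶜ := by
    rw [measureReal_def, measureReal_def, measureReal_def, ← ENNReal.toReal_mul]
    congr 1
    exact (Indep_iff _ _ _).1 (h.indep_sigma hdisj) _ _ (measurableSet_branchEvent b K t T σ z hi)
      (@MeasurableSet.compl _ _ (sigma N X (⋃ v ∈ g, subtreeIndex v)) hHm)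
  have hHc : 1 / 2 ≤ P.real Hᶜ := by
    rw [probReal_compl_eq_one_sub (h.sigma_le _ _ hHm)]
    linarith
  have hsub : branchEvent N X b K t T σ z hi ∩ Hᶜ ⊆
      {ω | p ≤ empirical (fun u => N u ω) (fun u => X u ω) n (√(n : ℝ) • A)} := by
    rintro ω ⟨hG, hHω⟩
    have hgω : generation (fun u => N u ω) T = g := generation_eq_of_mem_branchEvent hG
    have hlt : ∑ v ∈ g, treeSum (fun u => N (u ++ v) ω) (fun u => X (u ++ v) ω) (n - T) (f v) < 0 :=
      not_le.1 hHω
    have hpt : ∀ v ∈ g, ∀ s, p - (√(n : ℝ) • A).indicator (1 : ℝ → ℝ)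
        (position (fun u => X u ω) v + s) ≤ f v s := by
      intro v hv s
      simp only [hf]
      split_ifs with hvt
      · by_cases hA : position (fun u => X u ω) v + s ∈ √(n : ℝ) • A
        · rw [Set.indicator_of_mem hA]
          have : 0 ≤ E.indicator (1 : ℝ → ℝ) s := Set.indicator_nonneg (fun _ _ => zero_le_one) s
          simp only [Pi.one_apply]
          linarith
        · have hsE : s ∈ E := by
            rw [Set.mem_smul_set_iff_inv_smul_mem₀ hn'.ne', smul_eq_mul] at hA
            obtain ⟨hp1', hp2'⟩ := position_of_mem_branchEvent hG hv hvt
            have h2 := mem_cthickening_of_dist_le (δ := 0) le_rfl hδ.le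
              (Metric.self_subset_cthickening Aᶜ hA) (b := (√(n : ℝ))⁻¹ * s + x) (by
                have h3 : (√(n : ℝ))⁻¹ * s + x -
                    (√(n : ℝ))⁻¹ * (position (fun u => X u ω) v + s) =
                    -(σ * (σ * position (fun u => X u ω) v - |x| * √(n : ℝ)) / √(n : ℝ)) := by
                  rw [← hx]
                  field_simp
                  linear_combination (position (fun u => X u ω) v - √(n : ℝ) * x) * hσ
                have hσ1 : |σ| = 1 := by
                  rw [← sq_abs] at hσ
                  have := abs_nonneg σ
                  nlinarith
                rw [h3, abs_neg, abs_div, abs_mul, hσ1, one_mul, abs_of_pos hn',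
                  abs_of_nonneg (by linarith), div_le_iff₀ hn']
                linarith)
            simpa [hE] using h2
          rw [Set.indicator_of_notMem hA, Set.indicator_of_mem hsE]
          simp
      · have : 0 ≤ (√(n : ℝ) • A).indicator (1 : ℝ → ℝ) (position (fun u => X u ω) v + s) :=
          Set.indicator_nonneg (fun _ _ => zero_le_one) _
        linarith
    have h0 : treeSum (fun u => N u ω) (fun u => X u ω) n
        (fun s => p - (√(n : ℝ) • A).indicator (1 : ℝ → ℝ) s) < 0 := by
      have hnT : n = (n - T) + T := by omega
      rw [hnT, treeSum_add, hgω, ← hnT]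
      refine lt_of_le_of_lt (Finset.sum_le_sum fun v hv => ?_) hlt
      exact Finset.sum_le_sum fun w _ => hpt v hv _
    have h1 : treeSum (fun u => N u ω) (fun u => X u ω) n
        (fun s => p - (√(n : ℝ) • A).indicator (1 : ℝ → ℝ) s) =
        p * count (fun u => N u ω) (fun u => X u ω) n Set.univ -
        count (fun u => N u ω) (fun u => X u ω) n (√(n : ℝ) • A) := by
      rw [count_eq_treeSum, count_eq_treeSum]
      simp [treeSum, Finset.sum_sub_distrib, mul_comm]
    rw [h1] at h0
    have h2 : (count (fun u => N u ω) (fun u => X u ω) n (√(n : ℝ) • A) : ℝ) ≤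
        count (fun u => N u ω) (fun u => X u ω) n Set.univ := by
      refine Nat.cast_le.2 (Finset.card_le_card fun v hv => ?_)
      simpa using (Finset.mem_filter.1 hv).1
    have h3 : (0 : ℝ) < count (fun u => N u ω) (fun u => X u ω) n Set.univ := by
      have : (0 : ℝ) ≤ count (fun u => N u ω) (fun u => X u ω) n Set.univ := Nat.cast_nonneg _
      nlinarith
    rw [Set.mem_ofPred_eq, empirical, le_div_iff₀ h3]
    linarith
  calc P.real (branchEvent N X b K t T σ z hi) / 2 ≤
      P.real (branchEvent N X b K t T σ z hi) * P.real Hᶜ := by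
        have : 0 ≤ P.real (branchEvent N X b K t T σ z hi) := measureReal_nonneg
        nlinarith
    _ = P.real (branchEvent N X b K t T σ z hi ∩ Hᶜ) := hindep.symm
    _ ≤ _ := measureReal_mono hsub

end LowerBound

/-! ### The displacements along a cheap branch -/

section Profile

/-- The counterpart of `sum_min_rpow_le`: rounding and the extra `κ` in the length of the ramp lose
only a bounded number of terms of size `Λ ^ β`. -/
lemma le_sum_ite_rpow {β Λ c κ : ℝ} (hβ : 0 < β) (hΛ : 0 < Λ) (hc : 0 < c)
    {T s : ℕ} (hsT : s ≤ T) (hs : Λ / c ≤ s) (hs' : s ≤ (Λ + κ) / c + 1) (hcΛ : c ≤ Λ) :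
    Λ ^ β * (T - β / (β + 1) * (Λ / c) - (κ / c + 2)) ≤
      ∑ j ∈ Finset.range T, (if s ≤ j then Λ ^ β else (j * c) ^ β) := by
  have hs0 : s ≠ 0 := by
    rintro rfl
    have : 0 < Λ / c := by positivity
    simp only [Nat.cast_zero] at hs
    linarith
  obtain ⟨s', rfl⟩ := Nat.exists_eq_succ_of_ne_zero hs0
  have hsplit : ∑ j ∈ Finset.range T, (if s' + 1 ≤ j then Λ ^ β else (j * c : ℝ) ^ β) =
      ∑ j ∈ Finset.range (s' + 1), (j * c : ℝ) ^ β + (T - (s' + 1 : ℕ)) * Λ ^ β := by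
    rw [← Finset.sum_range_add_sum_Ico _ hsT]
    congr 1
    · refine Finset.sum_congr rfl fun j hj => if_neg ?_
      have := Finset.mem_range.1 hj
      omega
    · rw [Finset.sum_congr rfl fun j hj => if_pos (Finset.mem_Ico.1 hj).1, Finset.sum_const,
        Nat.card_Ico, nsmul_eq_mul, Nat.cast_sub hsT]
  rw [Nat.succ_eq_add_one] at *
  rw [hsplit]
  have h1 := le_sum_rpow hβ hc s'
  push_cast at hs hs' ⊢
  have hx : 1 ≤ Λ / c := by rwa [one_le_div hc]
  -- Bernoulli's inequality for `(Λ / c - 1) ^ (β + 1)`, as `s' ≥ Λ / c - 1`.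
  have h2 : (Λ / c) ^ (β + 1) * (1 - (β + 1) * (c / Λ)) ≤ (s' : ℝ) ^ (β + 1) := by
    have h3 : 1 + (β + 1) * (-(c / Λ)) ≤ (1 + -(c / Λ)) ^ (β + 1) :=
      one_add_mul_self_le_rpow_one_add (by
        have : c / Λ ≤ 1 := by rwa [div_le_one hΛ]
        linarith) (by linarith)
    have h4 : (Λ / c) * (1 + -(c / Λ)) = Λ / c - 1 := by field_simp; ring
    calc (Λ / c) ^ (β + 1) * (1 - (β + 1) * (c / Λ)) ≤
        (Λ / c) ^ (β + 1) * (1 + -(c / Λ)) ^ (β + 1) := by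
          gcongr
          linarith
      _ = (Λ / c - 1) ^ (β + 1) := by
          rw [← h4, Real.mul_rpow (by positivity)]
          have : c / Λ ≤ 1 := by rwa [div_le_one hΛ]
          linarith
      _ ≤ _ := Real.rpow_le_rpow (by linarith) (by linarith) (by linarith)
  have h5 : c ^ β * ((Λ / c) ^ (β + 1) * (1 - (β + 1) * (c / Λ)) / (β + 1)) =
      Λ ^ β * (Λ / c / (β + 1) - 1) := by
    rw [Real.rpow_add_one (by positivity), Real.div_rpow hΛ.le hc.le]
    have : c ^ β ≠ 0 := (Real.rpow_pos_of_pos hc _).ne'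
    field_simp
  have h6 : Λ ^ β * (Λ / c / (β + 1) - 1) ≤ ∑ j ∈ Finset.range (s' + 1), (j * c : ℝ) ^ β := by
    rw [← h5]
    refine le_trans ?_ h1
    gcongr
  have h7 : (T - β / (β + 1) * (Λ / c) - (κ / c + 2)) ≤
      (Λ / c / (β + 1) - 1) + (T - (s' + 1)) := by
    have e1 : β / (β + 1) * (Λ / c) = Λ / c - Λ / c / (β + 1) := by field_simp; ring
    have e2 : (Λ + κ) / c = Λ / c + κ / c := add_div _ _ _
    rw [e1]
    linarith
  have h8 : 0 ≤ Λ ^ β := by positivity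
  nlinarith [mul_le_mul_of_nonneg_left h7 h8]

/-- On the single path `z k ^ α = T log b`, at price `b ^ T`. Below generation `t`, `z k ^ α = (T -
k) log K`: the `K ^ (k - t)` vertices together cost `K ^ (T - t)`, which is comparable to `b ^ T`.
-/
lemma eventually_exists_profile {α ε J : ℝ} (hα : 0 < α) (hε : 0 < ε) (hε1 : ε ≤ 1) {b K : ℕ}
    (hb : 2 ≤ b) (hbK : b ≤ K)
    (hJ : J < 1 - Real.log b / ((1 + α) * Real.log K)) :
    ∀ᶠ T : ℕ in atTop, ∃ t ≤ T, ∃ z : ℕ → ℝ, (∀ k, 0 ≤ z k) ∧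
      (t = 0 ∨ (b : ℝ) ^ T ≤ ε * K ^ (T - t)) ∧ (b : ℝ) ^ T ≤ K ^ (T - t) ∧
      (K : ℝ) ^ (T - t) ≤ K / ε * b ^ T ∧
      J * (T * (T * Real.log b) ^ (1 / α)) ≤ ∑ k ∈ Finset.range T, z (k + 1) ∧
      ∀ k < T, (K : ℝ) ^ (k + 1 - t) * Real.exp (z (k + 1) ^ α) ≤ b ^ T + K ^ (T - t) := by
  have hb1 : (1 : ℝ) < b := by exact_mod_cast hb
  have hbK' : (b : ℝ) ≤ K := by exact_mod_cast hbK
  have hK1 : (1 : ℝ) < K := hb1.trans_le hbK'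
  set l := Real.log b with hl
  set c := Real.log K with hc
  have hl0 : 0 < l := Real.log_pos hb1
  have hc0 : 0 < c := Real.log_pos hK1
  have hlc : l ≤ c := Real.log_le_log (by linarith) hbK'
  set κ := Real.log ε⁻¹ with hκ
  have hκ0 : 0 ≤ κ := Real.log_nonneg ((one_le_inv₀ hε).2 hε1)
  have hβ : 0 < 1 / α := by positivity
  have hexpc : Real.exp c = K := Real.exp_log (by linarith)
  have hexpl : Real.exp l = b := Real.exp_log (by linarith)
  have hexpκ : Real.exp κ = ε⁻¹ := Real.exp_log (by positivity)
  have hbT (T : ℕ) : (b : ℝ) ^ T = Real.exp (T * l) := by rw [Real.exp_nat_mul, hexpl]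
  have hKs (s : ℕ) : (K : ℝ) ^ s = Real.exp (s * c) := by rw [Real.exp_nat_mul, hexpc]
  filter_upwards [tendsto_natCast_atTop_atTop.eventually_ge_atTop (c / l),
    tendsto_natCast_atTop_atTop.eventually_ge_atTop ((κ / c + 2) /
      (1 - l / ((1 + α) * c) - J)), eventually_gt_atTop 0] with T hT1 hT2 hT3
  rw [div_le_iff₀ hl0] at hT1
  rw [div_le_iff₀ (by linarith)] at hT2
  set Λ := T * l with hΛ
  have hΛ0 : 0 < Λ := by positivity
  -- With `κ = log (1 / ε)` the ceiling is the least length for which `K ^ s ≥ b ^ T / ε`. If it is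
  -- at least `T`, as can happen when `K = b`, the branch is the whole tree (`t = 0`) and dominates
  -- trivially.
  set s := min T ⌈(Λ + κ) / c⌉₊ with hs
  have hsT : s ≤ T := min_le_left _ _
  have hs1 : Λ / c ≤ s := by
    rw [hs, Nat.cast_min, le_min_iff]
    refine ⟨?_, le_trans ?_ (Nat.le_ceil _)⟩
    · rw [div_le_iff₀ hc0, hΛ]; gcongr
    · gcongr; linarith
  have hs2 : (s : ℝ) ≤ (Λ + κ) / c + 1 :=
    le_trans (Nat.cast_le.2 (min_le_right _ _)) (Nat.ceil_lt_add_one (by positivity)).le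
  have hts : T - (T - s) = s := by omega
  refine ⟨T - s, Nat.sub_le _ _, fun k => if s ≤ T - k then Λ ^ (1 / α) else
    ((T - k : ℕ) * c) ^ (1 / α), fun k => ?_, ?_, ?_, ?_, ?_, ?_⟩
  · dsimp only
    split_ifs <;> positivity
  · rw [hts]
    by_cases hcase : T ≤ ⌈(Λ + κ) / c⌉₊
    · left; rw [hs, min_eq_left hcase]; simp
    · right
      have : s = ⌈(Λ + κ) / c⌉₊ := min_eq_right (by omega)
      have h1 : (Λ + κ) / c ≤ s := by rw [this]; exact Nat.le_ceil _
      rw [div_le_iff₀ hc0] at h1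
      rw [hbT, hKs, ← hΛ]
      calc Real.exp Λ = ε * Real.exp (Λ + κ) := by
            rw [Real.exp_add, hexpκ]; field_simp
        _ ≤ _ := by gcongr
  · rw [hts, hbT, hKs, Real.exp_le_exp, ← div_le_iff₀ hc0]
    exact hs1
  · rw [hts, hbT, hKs, ← hΛ]
    calc Real.exp (s * c) ≤ Real.exp (Λ + κ + c) := by
          rw [Real.exp_le_exp]
          have := mul_le_mul_of_nonneg_right hs2 hc0.le
          have h3 : ((Λ + κ) / c + 1) * c = Λ + κ + c := by field_simp
          linarith
      _ = _ := by rw [Real.exp_add, Real.exp_add, hexpκ, hexpc]; field_simp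
  · have h1 := le_sum_ite_rpow hβ hΛ0 hc0 hsT hs1 hs2 hT1
    rw [← Finset.sum_range_reflect] at h1
    have h2 : ∑ j ∈ Finset.range T, (if s ≤ T - 1 - j then Λ ^ (1 / α) else
        ((T - 1 - j : ℕ) * c : ℝ) ^ (1 / α)) = ∑ k ∈ Finset.range T,
        (if s ≤ T - (k + 1) then Λ ^ (1 / α) else ((T - (k + 1) : ℕ) * c : ℝ) ^ (1 / α)) := by
      refine Finset.sum_congr rfl fun k _ => ?_
      rw [show T - 1 - k = T - (k + 1) by omega]
    rw [h2] at h1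
    refine le_trans ?_ h1
    have h3 : 1 / α / (1 / α + 1) * (Λ / c) = T * (l / ((1 + α) * c)) := by
      rw [hΛ]; field_simp
    rw [h3]
    have h4 : 0 ≤ Λ ^ (1 / α) := by positivity
    have h5 : J * T ≤ T - T * (l / ((1 + α) * c)) - (κ / c + 2) := by linarith
    nlinarith [mul_le_mul_of_nonneg_left h5 h4]
  · intro k hk
    have hpow {x : ℝ} (hx : 0 ≤ x) : (x ^ (1 / α)) ^ α = x := by
      rw [← Real.rpow_mul hx, one_div, inv_mul_cancel₀ hα.ne', Real.rpow_one]
    have hb0 : 0 ≤ (b : ℝ) ^ T := by positivity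
    have hK0 : 0 ≤ (K : ℝ) ^ s := by positivity
    rw [hts]
    dsimp only
    split_ifs with hsk
    · rw [hpow hΛ0.le, show k + 1 - (T - s) = 0 by omega, pow_zero, one_mul, ← hbT]
      linarith
    · rw [hpow (by positivity), ← hKs, ← pow_add, show k + 1 - (T - s) + (T - (k + 1)) = s by omega]
      linarith

lemma inv_yConst {off : PMF ℕ} {α : ℝ} (h_alpha : 0 < α) (h_off0 : off 0 = 0) (h_off1 : off 1 = 0)
    (hB : maxOffspring off ≠ ⊤) :
    (yConst off α)⁻¹ = 1 - Real.log (minOffspring off) /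
      ((1 + α) * Real.log ((maxOffspring off).toNat : ℝ)) := by
  have hb := two_le_minOffspring h_off0 h_off1
  have hbB := le_maxOffspring_toNat h_off0 hB (minOffspring_mem h_off0).2.ne'
  have hlB : 0 < Real.log ((maxOffspring off).toNat : ℝ) :=
    Real.log_pos (by exact_mod_cast hb.trans hbB)
  rw [yConst, if_neg hB, inv_div]
  field_simp

lemma yConst_pos {off : PMF ℕ} {α : ℝ} (h_alpha : 0 < α) (h_off0 : off 0 = 0)
    (h_off1 : off 1 = 0) : 0 < yConst off α := by
  by_cases hB : maxOffspring off = ⊤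
  · simp [yConst, hB]
  have hb := two_le_minOffspring h_off0 h_off1
  have hb1 : (1 : ℝ) < minOffspring off := by exact_mod_cast hb
  have hbB := le_maxOffspring_toNat h_off0 hB (minOffspring_mem h_off0).2.ne'
  have hlb : 0 < Real.log (minOffspring off : ℝ) := Real.log_pos hb1
  have hlB : Real.log (minOffspring off : ℝ) ≤ Real.log ((maxOffspring off).toNat : ℝ) :=
    Real.log_le_log (by linarith) (by exact_mod_cast hbB)
  rw [← inv_pos, inv_yConst h_alpha h_off0 h_off1 hB, sub_pos,
    div_lt_one (mul_pos (by linarith) (by linarith))]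
  nlinarith

/-- For `B < ∞` the choice is `K = B`; for `B = ∞` a large `K` in the support brings the factor
close to `1`. -/
lemma exists_offspring_lt {off : PMF ℕ} {α J : ℝ} (h_alpha : 0 < α) (h_off0 : off 0 = 0)
    (h_off1 : off 1 = 0) (hJ : J < (yConst off α)⁻¹) :
    ∃ K : ℕ, off K ≠ 0 ∧ minOffspring off ≤ K ∧
      J < 1 - Real.log (minOffspring off) / ((1 + α) * Real.log K) := by
  by_cases hB : maxOffspring off = ⊤
  · have hJ1 : J < 1 := by simpa [yConst, hB] using hJ
    have hlim : Tendsto (fun K : ℕ => 1 - Real.log (minOffspring off) / ((1 + α) * Real.log K))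
        atTop (𝓝 (1 - 0)) := by
      refine tendsto_const_nhds.sub (tendsto_const_nhds.div_atTop ?_)
      exact (Real.tendsto_log_atTop.comp tendsto_natCast_atTop_atTop).const_mul_atTop
        (by linarith)
    rw [sub_zero] at hlim
    obtain ⟨M, hM⟩ := eventually_atTop.1 (hlim.eventually (lt_mem_nhds hJ1))
    obtain ⟨K, hK, hK0⟩ := exists_le_of_maxOffspring_eq_top hB M
    exact ⟨K, hK0, minOffspring_le h_off0 hK0, hM K hK⟩
  · have hB0 := maxOffspring_toNat_ne_zero h_off0 hB
    exact ⟨_, hB0, minOffspring_le h_off0 hB0, by rwa [← inv_yConst h_alpha h_off0 h_off1 hB]⟩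

end Profile

/-! ### Asymptotic lower bound of the probability -/

section LowerBound

variable {Ω : Type*} [mΩ : MeasurableSpace Ω] {P : Measure Ω} [IsProbabilityMeasure P] {off : PMF ℕ}
  {μ : Measure ℝ} [IsProbabilityMeasure μ] {N : List ℕ → Ω → ℕ} {X : List ℕ → Ω → ℝ}

lemma measurableSet_of_mem_halfLineAlgebra {A : Set ℝ} (h_A : A ∈ halfLineAlgebra) :
    MeasurableSet A := by
  have h1 := MeasurableSpace.measurableSet_generateFrom h_A
  rwa [halfLineAlgebra, generateFrom_generateSetAlgebra_eq, ← borel_eq_generateFrom_Iic,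
    ← BorelSpace.measurable_eq] at h1

lemma nu_compl {E : Set ℝ} (hE : MeasurableSet E) : nu Eᶜ = 1 - nu E := by
  rw [nu, nu, probReal_compl_eq_one_sub hE]

set_option maxHeartbeats 1000000 in
lemma IsBRW.exists_eventually_le_measure (h_off0 : off 0 = 0) (h_off1 : off 1 = 0)
    (h_offexp : ∃ θ : ℝ, 0 < θ ∧
      Summable fun k : ℕ => (off k).toReal * Real.exp (θ * (k : ℝ)))
    (h_symm : μ.map (fun x : ℝ => -x) = μ) (h_var : ∫ x : ℝ, x ^ 2 ∂μ = 1)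
    {α : ℝ} (h_alpha : 0 < α)
    (h_tail : (fun z : ℝ => μ.real (Set.Ioi z)) =Θ[atTop]
      fun z : ℝ => Real.exp (-Real.exp (z ^ α)))
    (h : IsBRW P off μ N X) {A : Set ℝ} (h_A : A ∈ halfLineAlgebra) {p : ℝ} (h_p : nu A < p)
    (h_p1 : p < 1) (h_fin : rateI A p < ⊤)
    (h_cont : ContinuousAt (fun q : ℝ => rateI A q) p) {R J : ℝ}
    (hR : (rateI A p).toReal < R) (hJ : J < (yConst off α)⁻¹) {T : ℕ → ℕ}
    (hT : Tendsto T atTop atTop) (hTn : Tendsto (fun n => (T n : ℝ) / n) atTop (𝓝 0))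
    (hTs : Tendsto (fun n : ℕ => (T n : ℝ) / √(n : ℝ)) atTop (𝓝 0))
    (hTR : ∀ᶠ n : ℕ in atTop, R * √(n : ℝ) ≤
      J * (T n * (T n * Real.log (minOffspring off)) ^ (1 / α))) :
    ∃ C > 0, ∀ᶠ n : ℕ in atTop, Real.exp (-(C * (T n * (minOffspring off : ℝ) ^ T n))) ≤
      P.real {ω | p ≤ empirical (fun u => N u ω) (fun u => X u ω) n (√(n : ℝ) • A)} := by
  have hp0 : 0 < p := measureReal_nonneg.trans_lt h_p
  obtain ⟨m, C₁, s₀, hm, hC₁, hs₀, hmean, hgen⟩ := exists_offspring_bound h_off0 h_off1 h_offexp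
  obtain ⟨θ₀, K₁, hθ₀, hK₁, hexp⟩ := exists_lintegral_exp_treeSum_le (P := P) (μ := μ) hm hC₁ hs₀
    hmean hgen
  obtain ⟨q, hq, x, hx, hqx⟩ := exists_gt_exists_le_nu h_cont h_fin hR
  have hR0 : 0 < R := (abs_nonneg x).trans_lt hx
  obtain ⟨σ, hσ, hσx⟩ : ∃ σ : ℝ, (σ = 1 ∨ σ = -1) ∧ σ * x = |x| := by
    rcases abs_choice x with hx | hx
    · exact ⟨1, Or.inl rfl, by rw [hx, one_mul]⟩
    · exact ⟨-1, Or.inr rfl, by rw [hx, neg_one_mul]⟩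
  have hσ2 : σ ^ 2 = 1 := by rcases hσ with rfl | rfl <;> norm_num
  obtain ⟨ε, hε, hε1, hεq⟩ : ∃ ε > 0, ε ≤ 1 ∧ 1 - q < 1 - p - 2 * ε :=
    ⟨min 1 ((q - p) / 4), lt_min one_pos (by linarith), min_le_left _ _, by
      have : min 1 ((q - p) / 4) ≤ (q - p) / 4 := min_le_right _ _
      linarith⟩
  have hfr : (frontier Aᶜ).Finite := by
    rw [frontier_compl]; exact finite_frontier_of_mem_halfLineAlgebra h_A
  have hAm : MeasurableSet A := measurableSet_of_mem_halfLineAlgebra h_A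
  have hqx' : nu {s | s + x ∈ Aᶜ} < 1 - p - 2 * ε := by
    have h1 : {s | s + x ∈ Aᶜ} = {s | s + x ∈ A}ᶜ := rfl
    have h2 := nu_compl (hAm.preimage (measurable_id.add_const x))
    rw [h1]
    refine h2.trans_lt ?_
    simp only [Set.preimage, id] at *
    linarith
  obtain ⟨δ, hδ, hδq⟩ := exists_nu_cthickening_lt hfr hqx'
  obtain ⟨θ, hθ0, hθθ₀, hθK⟩ : ∃ θ > 0, θ ≤ θ₀ ∧ 4 * K₁ * θ ≤ ε := by
    refine ⟨min θ₀ (ε / (4 * K₁ + 1)), lt_min hθ₀ (by positivity), min_le_left _ _, ?_⟩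
    calc 4 * K₁ * min θ₀ (ε / (4 * K₁ + 1)) ≤ (4 * K₁ + 1) * (ε / (4 * K₁ + 1)) := by
          gcongr
          · linarith
          · exact min_le_right _ _
      _ = ε := by field_simp
  obtain ⟨K, hK, hbK, hJK⟩ := exists_offspring_lt h_alpha h_off0 h_off1 hJ
  have hb := two_le_minOffspring h_off0 h_off1
  set b := minOffspring off with hbdef
  have hb1 : (1 : ℝ) < b := by exact_mod_cast hb
  have hK1 : (1 : ℝ) < K := by exact_mod_cast hb.trans hbK
  obtain ⟨π, hπ0, hπ1, hπb, hπK⟩ : ∃ π : ℝ, 0 < π ∧ π ≤ 1 ∧ π ≤ (off b).toReal ∧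
      π ≤ (off K).toReal :=
    ⟨min 1 (min (off b).toReal (off K).toReal), lt_min one_pos (lt_min
      (ENNReal.toReal_pos (minOffspring_mem h_off0).2.ne' (off.apply_ne_top _))
      (ENNReal.toReal_pos hK (off.apply_ne_top _))), min_le_left _ _,
      (min_le_right _ _).trans (min_le_left _ _), (min_le_right _ _).trans (min_le_right _ _)⟩
  -- The tolerance `δ` is shared between the relative width `δ₂` of the windows and their additive
  -- width `D`, which sums to `D * T n = o(√n)`.
  obtain ⟨δ₂, hδ₂, hδ₂x⟩ : ∃ δ₂ > 0, δ₂ * |x| ≤ δ / 2 := by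
    refine ⟨δ / 2 / (|x| + 1), by positivity, ?_⟩
    rw [div_mul_eq_mul_div, div_le_iff₀ (by positivity)]
    nlinarith [abs_nonneg x]
  obtain ⟨C, D, hC, hD, htail⟩ := exists_tail_lower h_symm h_alpha h_tail hδ₂ hσ
  have hnear := h.eventually_walkLaw_le h_symm h_var hTn
    (F := {s | s + x ∈ Metric.cthickening δ Aᶜ})
    (Metric.isClosed_cthickening.preimage (by fun_prop)) hδq
  set L := Real.log π⁻¹ with hL
  have hL0 : 0 ≤ L := Real.log_nonneg ((one_le_inv₀ hπ0).2 hπ1)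
  have hexpL : π = Real.exp (-L) := by rw [hL, Real.log_inv, neg_neg, Real.exp_log hπ0]
  -- `L` prices the tree and `C` the displacements, `1 + K / ε` compares the vertex count with `b ^
  -- T`, and the final `1` pays for the factor `1 / 2`.
  refine ⟨(L + C) * (1 + K / ε) + 1, by positivity, ?_⟩
  have hDs : ∀ᶠ n : ℕ in atTop, (T n : ℝ) / √(n : ℝ) < δ / 2 / (D + 1) :=
    hTs.eventually (gt_mem_nhds (by positivity))
  filter_upwards [hnear, hT.eventually (eventually_exists_profile h_alpha hε hε1 hb hbK hJK), hTR,
    eventually_gt_atTop 0, hTn.eventually (gt_mem_nhds one_pos), hDs, hT.eventually_gt_atTop 0,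
    hT.eventually ((tendsto_pow_atTop_atTop_of_one_lt hb1).eventually_ge_atTop (2 / (θ * ε)))] with n
    hn1 hn2 hn3 hn4 hn5 hn6 hn7 hn8
  have hn' : (0 : ℝ) < n := by exact_mod_cast hn4
  have hsq : 0 < √(n : ℝ) := Real.sqrt_pos.2 hn'
  have hTle : T n ≤ n := by
    rw [div_lt_one hn', Nat.cast_lt] at hn5
    exact hn5.le
  obtain ⟨t, ht, z, hz0, hdom, hbK', hKb, hsum, hcost⟩ := hn2
  set W := ∑ k ∈ Finset.range (T n), z (k + 1) with hW
  have hWR : R * √(n : ℝ) ≤ W := hn3.trans hsum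
  have hW0 : 0 < W := lt_of_lt_of_le (by positivity) hWR
  -- The profile reaches at least `R √n > |x| √n`; shrinking it by `r ≤ 1` hits the target exactly
  -- and only lowers the price.
  set r := |x| * √(n : ℝ) / W with hr
  have hr0 : 0 ≤ r := by positivity
  have hr1 : r ≤ 1 := by
    rw [hr, div_le_one hW0]
    refine le_trans ?_ hWR
    gcongr
  have hlo : ∑ k ∈ Finset.range (T n), r * z (k + 1) = |x| * √(n : ℝ) := by
    rw [← Finset.mul_sum, ← hW, hr]
    field_simp
  have hhi : ∑ k ∈ Finset.range (T n), ((1 + δ₂) * (r * z (k + 1)) + D) ≤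
      (|x| + δ) * √(n : ℝ) := by
    rw [Finset.sum_add_distrib, ← Finset.mul_sum, hlo, Finset.sum_const, Finset.card_range,
      nsmul_eq_mul]
    rw [div_lt_div_iff₀ hsq (by positivity)] at hn6
    have h1 := mul_le_mul_of_nonneg_right hδ₂x hsq.le
    linarith
  have hmain := h.le_measureReal_empirical (m := m) (θ := θ) (C := K₁) (by linarith)
    (fun hh k f hf hf1 => hexp hh k hf hf1 θ hθ0.le hθθ₀) hθ0.le hK₁ (A := A) (p := p) (ε := ε)
    (δ := δ) (x := x) (σ := σ) (b := b) (K := K) (n := n) (t := t) (T := T n) hp0.le h_p1.le hε hε1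
    hδ hn4 ht hTle (by omega) (by omega) hσ2 hσx hn1.le (z := fun k => r * z k)
    (hi := fun k => (1 + δ₂) * (r * z k) + D) hlo hhi hdom hθK (by
      rw [div_le_iff₀ (by positivity)] at hn8
      refine hn8.trans ?_
      rw [mul_comm]
      gcongr)
  have hev := h.le_measureReal_branchEvent (b := b) (K := K) (t := t) (T := T n) (by omega) (by omega)
    hπ0 hπ1 hπb hπK (σ := σ) (z := fun k => r * z k) (hi := fun k => (1 + δ₂) * (r * z k) + D)
    (a := fun k => C * Real.exp (z k ^ α)) (fun k => by positivity) (fun k => by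
      refine le_trans ?_ (htail (r * z k) (mul_nonneg hr0 (hz0 k)))
      have h1 : r * z k ≤ z k := mul_le_of_le_one_left (hz0 k) hr1
      have h2 := mul_nonneg hr0 (hz0 k)
      gcongr)
  refine le_trans ?_ hmain
  rw [le_div_iff₀ two_pos]
  refine le_trans ?_ hev
  set M : ℝ := T n * ((b : ℝ) ^ T n + (K : ℝ) ^ (T n - t)) with hM
  have hcosts : ∑ k ∈ Finset.range (T n), (K : ℝ) ^ (k + 1 - t) * (C * Real.exp (z (k + 1) ^ α)) ≤
      C * M := by
    have h1 : ∀ k ∈ Finset.range (T n), (K : ℝ) ^ (k + 1 - t) * (C * Real.exp (z (k + 1) ^ α)) ≤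
        C * ((b : ℝ) ^ T n + (K : ℝ) ^ (T n - t)) := fun k hk => by
      have := mul_le_mul_of_nonneg_left (hcost k (Finset.mem_range.1 hk)) hC.le
      linarith
    refine (Finset.sum_le_sum h1).trans (le_of_eq ?_)
    rw [Finset.sum_const, Finset.card_range, nsmul_eq_mul, hM]
    ring
  have hπM : π ^ (T n * (b ^ T n + K ^ (T n - t))) = Real.exp (-(L * M)) := by
    rw [hexpL, ← Real.exp_nat_mul, hM]
    push_cast
    congr 1
    ring
  have hT1 : (1 : ℝ) ≤ T n := by exact_mod_cast hn7
  have hMle : M ≤ (1 + K / ε) * (T n * (b : ℝ) ^ T n) := by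
    have := mul_le_mul_of_nonneg_left hKb (by linarith : (0 : ℝ) ≤ T n)
    rw [hM]
    linarith
  have hbT : (1 : ℝ) ≤ T n * (b : ℝ) ^ T n := by
    have : (1 : ℝ) ≤ (b : ℝ) ^ T n := one_le_pow₀ hb1.le
    nlinarith
  have htwo : (2 : ℝ) ≤ Real.exp 1 := by linarith [Real.add_one_le_exp (1 : ℝ)]
  calc Real.exp (-(((L + C) * (1 + K / ε) + 1) * (T n * (b : ℝ) ^ T n))) * 2 ≤
      Real.exp (-(((L + C) * (1 + K / ε) + 1) * (T n * (b : ℝ) ^ T n))) * Real.exp 1 := by gcongr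
    _ ≤ Real.exp (-(L * M)) * Real.exp (-(C * M)) := by
        rw [← Real.exp_add, ← Real.exp_add, Real.exp_le_exp]
        have := mul_le_mul_of_nonneg_left hMle (add_nonneg hL0 hC.le)
        linarith
    _ ≤ _ := by
        rw [hπM]
        gcongr

end LowerBound

/-! ### The limit -/

section Limit

lemma tendsto_ceil_div_rpow {κ γ : ℝ} (hκ : 0 < κ) (hγ : 0 < γ) :
    Tendsto (fun n : ℕ => (⌈κ * (n : ℝ) ^ γ⌉₊ : ℝ) / (n : ℝ) ^ γ) atTop (𝓝 κ) :=
  (tendsto_nat_ceil_mul_div_atTop hκ.le).comp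
    ((tendsto_rpow_atTop hγ).comp tendsto_natCast_atTop_atTop)

lemma tendsto_ceil_rpow {κ γ : ℝ} (hκ : 0 < κ) (hγ : 0 < γ) :
    Tendsto (fun n : ℕ => ⌈κ * (n : ℝ) ^ γ⌉₊) atTop atTop :=
  tendsto_nat_ceil_atTop.comp
    (((tendsto_rpow_atTop hγ).comp tendsto_natCast_atTop_atTop).const_mul_atTop hκ)

lemma tendsto_ceil_div_rpow_zero {κ γ s : ℝ} (hκ : 0 < κ) (hγ : 0 < γ) (hs : γ < s) :
    Tendsto (fun n : ℕ => (⌈κ * (n : ℝ) ^ γ⌉₊ : ℝ) / (n : ℝ) ^ s) atTop (𝓝 0) := by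
  have h1 : Tendsto (fun n : ℕ => (n : ℝ) ^ (-(s - γ))) atTop (𝓝 0) :=
    (tendsto_rpow_neg_atTop (by linarith)).comp tendsto_natCast_atTop_atTop
  have h2 := (tendsto_ceil_div_rpow hκ hγ).mul h1
  rw [mul_zero] at h2
  refine h2.congr' ?_
  filter_upwards [eventually_gt_atTop 0] with n hn
  have hn' : (0 : ℝ) < n := by exact_mod_cast hn
  rw [show -(s - γ) = γ - s by ring, Real.rpow_sub hn']
  have := (Real.rpow_pos_of_pos hn' γ).ne'
  field_simp

/-- The exponent `γ = α / (2 (α + 1))` is determined by `γ (1 / α + 1) = 1 / 2`. -/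
lemma tendsto_ceil_mul_rpow_div_sqrt {α κ l : ℝ} (hα : 0 < α) (hκ : 0 < κ) (hl : 0 < l) :
    Tendsto (fun n : ℕ => (⌈κ * (n : ℝ) ^ (α / (2 * (α + 1)))⌉₊ *
      (⌈κ * (n : ℝ) ^ (α / (2 * (α + 1)))⌉₊ * l) ^ (1 / α)) / √(n : ℝ)) atTop
      (𝓝 (κ ^ (1 / α + 1) * l ^ (1 / α))) := by
  have h1 := ((tendsto_ceil_div_rpow hκ (γ := α / (2 * (α + 1))) (by positivity)).rpow_const
    (p := 1 / α + 1) (Or.inl hκ.ne')).mul_const (l ^ (1 / α))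
  refine h1.congr' ?_
  filter_upwards [eventually_gt_atTop 0] with n hn
  have hn' : (0 : ℝ) < n := by exact_mod_cast hn
  have h2 : ((n : ℝ) ^ (α / (2 * (α + 1)))) ^ (1 / α + 1) = √(n : ℝ) := by
    rw [← Real.rpow_mul hn'.le, Real.sqrt_eq_rpow]
    congr 1
    field_simp
    ring
  have hpos : (0 : ℝ) < ⌈κ * (n : ℝ) ^ (α / (2 * (α + 1)))⌉₊ :=
    Nat.cast_pos.2 (Nat.ceil_pos.2 (by positivity))
  rw [Real.div_rpow (Nat.cast_nonneg _) (by positivity), h2, Real.rpow_add_one hpos.ne',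
    Real.mul_rpow hpos.le hl.le]
  ring

lemma eventually_add_exp_le {b c : ℝ} (hb : 1 < b) (hc : 0 < c) :
    ∃ c' > 0, ∀ᶠ T : ℕ in atTop,
      T * Real.exp (-b ^ T) + Real.exp (-c * b ^ T) ≤ Real.exp (-(c' * b ^ T)) := by
  obtain ⟨c', hc', hc1, hc2⟩ : ∃ c' > 0, c' ≤ 1 / 2 ∧ c' ≤ c / 2 :=
    ⟨min (1 / 2) (c / 2), by positivity, min_le_left _ _, min_le_right _ _⟩
  refine ⟨c', hc', ?_⟩
  have hl : 0 < Real.log b := Real.log_pos hb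
  filter_upwards [eventually_mul_le_exp hl (1 / c')] with T hT
  have hbT : Real.exp (Real.log b * T) = b ^ T := by
    rw [mul_comm, Real.exp_nat_mul, Real.exp_log (by linarith)]
  rw [hbT, div_mul_eq_mul_div, one_mul, div_le_iff₀ hc'] at hT
  set x := b ^ T with hx
  have h1 : Real.exp (-x) ≤ Real.exp (-(2 * c' * x)) := by
    rw [Real.exp_le_exp]; nlinarith
  have h2 : Real.exp (-c * x) ≤ Real.exp (-(2 * c' * x)) := by
    rw [Real.exp_le_exp]; nlinarith
  have h3 : (T : ℝ) + 1 ≤ Real.exp (c' * x) := by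
    linarith [Real.add_one_le_exp (c' * x)]
  calc T * Real.exp (-x) + Real.exp (-c * x) ≤
      T * Real.exp (-(2 * c' * x)) + Real.exp (-(2 * c' * x)) := by gcongr
    _ = (T + 1) * Real.exp (-(2 * c' * x)) := by ring
    _ ≤ Real.exp (c' * x) * Real.exp (-(2 * c' * x)) := by gcongr
    _ = _ := by rw [← Real.exp_add]; congr 1; ring

/-- With `T = ⌈κ n ^ γ⌉`, `-log f` is at least `c b ^ T` for each `κ < ℓ` and at most `C T b ^ T`
for each `κ > ℓ`. After another logarithm and division by `n ^ γ`, the constants and the factor `T`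
disappear. -/
lemma tendsto_loglog {b γ ℓ : ℝ} (hb : 1 < b) (hγ : 0 < γ) (hℓ : 0 < ℓ) {f : ℕ → ℝ}
    (hup : ∀ κ, 0 < κ → κ < ℓ → ∃ c > 0, ∀ᶠ n : ℕ in atTop,
      f n ≤ ⌈κ * (n : ℝ) ^ γ⌉₊ * Real.exp (-b ^ ⌈κ * (n : ℝ) ^ γ⌉₊) +
        Real.exp (-c * b ^ ⌈κ * (n : ℝ) ^ γ⌉₊))
    (hlow : ∀ κ, ℓ < κ → ∃ C > 0, ∀ᶠ n : ℕ in atTop,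
      Real.exp (-(C * (⌈κ * (n : ℝ) ^ γ⌉₊ * b ^ ⌈κ * (n : ℝ) ^ γ⌉₊))) ≤ f n) :
    Tendsto (fun n : ℕ => (n : ℝ) ^ (-γ) * Real.log (-Real.log (f n))) atTop
      (𝓝 (ℓ * Real.log b)) := by
  have hl : 0 < Real.log b := Real.log_pos hb
  have hn0 : Tendsto (fun n : ℕ => (n : ℝ) ^ (-γ)) atTop (𝓝 0) :=
    (tendsto_rpow_neg_atTop hγ).comp tendsto_natCast_atTop_atTop
  have hfpos : ∀ᶠ n in atTop, 0 < f n := by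
    obtain ⟨C, -, hC⟩ := hlow (ℓ + 1) (by linarith)
    filter_upwards [hC] with n hn using (Real.exp_pos _).trans_le hn
  have hup' : ∀ κ, 0 < κ → κ < ℓ → ∃ c > 0, ∀ᶠ n : ℕ in atTop,
      c * b ^ ⌈κ * (n : ℝ) ^ γ⌉₊ ≤ -Real.log (f n) := by
    intro κ hκ hκℓ
    obtain ⟨c, hc, h⟩ := hup κ hκ hκℓ
    obtain ⟨c', hc', h'⟩ := eventually_add_exp_le hb hc
    refine ⟨c', hc', ?_⟩
    filter_upwards [h, (tendsto_ceil_rpow hκ hγ).eventually h', hfpos] with n h1 h2 h3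
    have h4 := Real.log_le_log h3 (h1.trans h2)
    rw [Real.log_exp] at h4
    linarith
  have hlogpos : ∀ᶠ n in atTop, 0 < -Real.log (f n) := by
    obtain ⟨c, hc, h⟩ := hup' (ℓ / 2) (by linarith) (by linarith)
    filter_upwards [h] with n hn using lt_of_lt_of_le (by positivity) hn
  rw [tendsto_order]
  refine ⟨fun a ha => ?_, fun a ha => ?_⟩
  · obtain ⟨κ, hκ1, hκ2⟩ := exists_between (max_lt hℓ ((div_lt_iff₀ hl).2 ha))
    have hκ : 0 < κ := (le_max_left _ _).trans_lt hκ1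
    have haκ : a < κ * Real.log b := (div_lt_iff₀ hl).1 ((le_max_right _ _).trans_lt hκ1)
    obtain ⟨c, hc, h⟩ := hup' κ hκ hκ2
    have hlim := (hn0.mul_const (Real.log c)).add
      ((tendsto_ceil_div_rpow hκ hγ).mul_const (Real.log b))
    rw [zero_mul, zero_add] at hlim
    filter_upwards [h, hlim.eventually (lt_mem_nhds haκ), eventually_gt_atTop 0] with n h1 h2 h3
    have hn' : (0 : ℝ) < n := by exact_mod_cast h3
    refine h2.trans_le ?_
    have h4 := Real.log_le_log (by positivity) h1
    rw [Real.log_mul hc.ne' (by positivity), Real.log_pow] at h4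
    calc (n : ℝ) ^ (-γ) * Real.log c + (⌈κ * (n : ℝ) ^ γ⌉₊ : ℝ) / (n : ℝ) ^ γ * Real.log b =
        (n : ℝ) ^ (-γ) * (Real.log c + ⌈κ * (n : ℝ) ^ γ⌉₊ * Real.log b) := by
          rw [Real.rpow_neg hn'.le]; ring
      _ ≤ _ := by gcongr
  · obtain ⟨κ, hκ1, hκ2⟩ := exists_between ((lt_div_iff₀ hl).2 ha)
    have hκ : 0 < κ := hℓ.trans hκ1
    rw [lt_div_iff₀ hl] at hκ2
    obtain ⟨C, hC, h⟩ := hlow κ hκ1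
    have hlogT : Tendsto (fun n : ℕ => Real.log (⌈κ * (n : ℝ) ^ γ⌉₊ : ℝ) /
        (⌈κ * (n : ℝ) ^ γ⌉₊ : ℝ)) atTop (𝓝 0) :=
      (Real.isLittleO_log_id_atTop.tendsto_div_nhds_zero.comp tendsto_natCast_atTop_atTop).comp
        (tendsto_ceil_rpow hκ hγ)
    have hlim := ((hn0.mul_const (Real.log C)).add
      (hlogT.mul (tendsto_ceil_div_rpow hκ hγ))).add
      ((tendsto_ceil_div_rpow hκ hγ).mul_const (Real.log b))
    rw [zero_mul, zero_mul, zero_add, zero_add] at hlim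
    filter_upwards [h, hlim.eventually (gt_mem_nhds hκ2), eventually_gt_atTop 0, hlogpos,
      (tendsto_ceil_rpow hκ hγ).eventually_gt_atTop 0] with n h1 h2 h3 h5 h6
    have hn' : (0 : ℝ) < n := by exact_mod_cast h3
    have hT : (0 : ℝ) < ⌈κ * (n : ℝ) ^ γ⌉₊ := by exact_mod_cast h6
    refine lt_of_le_of_lt ?_ h2
    have h4 := Real.log_le_log (Real.exp_pos _) h1
    rw [Real.log_exp] at h4
    have h7 := Real.log_le_log h5 (neg_le.1 h4)
    rw [Real.log_mul hC.ne' (by positivity), Real.log_mul hT.ne' (by positivity), Real.log_pow] at h7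
    calc (n : ℝ) ^ (-γ) * Real.log (-Real.log (f n)) ≤ (n : ℝ) ^ (-γ) * (Real.log C +
        (Real.log ⌈κ * (n : ℝ) ^ γ⌉₊ + ⌈κ * (n : ℝ) ^ γ⌉₊ * Real.log b)) := by gcongr
      _ = _ := by
          rw [Real.rpow_neg hn'.le]
          field_simp
          ring

end Limit

end BranchingRandomWalk

end

theorem theorem4 {Ω : Type*} [MeasurableSpace Ω] (P : Measure Ω) [IsProbabilityMeasure P]
    -- offspring law with p₀ = p₁ = 0 and an exponential moment
    (off : PMF ℕ) (h_off0 : off 0 = 0) (h_off1 : off 1 = 0)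
    (h_offexp : ∃ θ : ℝ, 0 < θ ∧
      Summable fun k : ℕ => (off k).toReal * Real.exp (θ * (k : ℝ)))
    -- step law: symmetric, second moment 1, Gumbel tail
    (μ : Measure ℝ) [IsProbabilityMeasure μ]
    (h_symm : μ.map (fun x : ℝ => -x) = μ) (h_var : ∫ x : ℝ, x ^ 2 ∂μ = 1)
    (α : ℝ) (h_alpha : 0 < α)
    (h_tail : (fun z : ℝ => μ.real (Set.Ioi z)) =Θ[atTop]
      fun z : ℝ => Real.exp (-Real.exp (z ^ α)))
    -- the branching random walk
    (N : List ℕ → Ω → ℕ) (X : List ℕ → Ω → ℝ)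
    (h_brw : BranchingRandomWalk.IsBRW P off μ N X)
    -- the set A and the level p
    (A : Set ℝ) (h_A : A ∈ BranchingRandomWalk.halfLineAlgebra)
    (h_nuA : 0 < BranchingRandomWalk.nu A)
    (p : ℝ) (h_p : BranchingRandomWalk.nu A < p) (h_p1 : p < 1)
    (h_fin : BranchingRandomWalk.rateI A p < ⊤)
    (h_cont : ContinuousAt (fun q : ℝ => BranchingRandomWalk.rateI A q) p) :
    Tendsto
      (fun n : ℕ => (n : ℝ) ^ (-(α / (2 * (α + 1)))) *
        Real.log (-Real.log (P.real {ω | p ≤ BranchingRandomWalk.empirical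
          (fun u => N u ω) (fun u => X u ω) n (Real.sqrt (n : ℝ) • A)})))
      atTop
      (𝓝 ((BranchingRandomWalk.yConst off α * (BranchingRandomWalk.rateI A p).toReal *
        Real.log (BranchingRandomWalk.minOffspring off : ℝ)) ^ (α / (α + 1)))) := by
  have hb := BranchingRandomWalk.two_le_minOffspring h_off0 h_off1
  have hb1 : (1 : ℝ) < BranchingRandomWalk.minOffspring off := by exact_mod_cast hb
  have hy : 0 < BranchingRandomWalk.yConst off α :=
    BranchingRandomWalk.yConst_pos h_alpha h_off0 h_off1
  have hI : 0 < (BranchingRandomWalk.rateI A p).toReal :=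
    BranchingRandomWalk.rateI_toReal_pos
      (BranchingRandomWalk.finite_frontier_of_mem_halfLineAlgebra h_A) h_p h_fin
  set l := Real.log (BranchingRandomWalk.minOffspring off : ℝ) with hl
  set y := BranchingRandomWalk.yConst off α
  set I := (BranchingRandomWalk.rateI A p).toReal
  have hl0 : 0 < l := Real.log_pos hb1
  set γ := α / (2 * (α + 1)) with hγ
  have hγ0 : 0 < γ := by positivity
  have hγ1 : γ < 1 / 2 := by
    rw [hγ, div_lt_div_iff₀ (by positivity) two_pos]
    linarith
  set L := (y * I * l) ^ (α / (α + 1)) with hL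
  have hL0 : 0 < L := by positivity
  have hβ : 0 < 1 / α + 1 := by positivity
  -- `L / l` is the critical `κ`, for which the displacement attainable in `κ n ^ γ` generations is
  -- asymptotically `I √n`.
  have hcrit : y⁻¹ * ((L / l) ^ (1 / α + 1) * l ^ (1 / α)) = I := by
    have h1 : L ^ (1 / α + 1) = y * I * l := by
      rw [hL, ← Real.rpow_mul (by positivity), show α / (α + 1) * (1 / α + 1) = 1 by field_simp; ring,
        Real.rpow_one]
    have h2 := (Real.rpow_pos_of_pos hl0 (1 / α)).ne'
    rw [Real.div_rpow hL0.le hl0.le, h1, Real.rpow_add_one hl0.ne']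
    field_simp
  have hmono {κ κ' : ℝ} (h0 : 0 < κ) (h1 : κ < κ') :
      y⁻¹ * (κ ^ (1 / α + 1) * l ^ (1 / α)) < y⁻¹ * (κ' ^ (1 / α + 1) * l ^ (1 / α)) := by
    have := Real.rpow_lt_rpow h0.le h1 hβ
    gcongr
  have hTn {κ : ℝ} (hκ : 0 < κ) :
      Tendsto (fun n : ℕ => (⌈κ * (n : ℝ) ^ γ⌉₊ : ℝ) / n) atTop (𝓝 0) := by
    simpa using BranchingRandomWalk.tendsto_ceil_div_rpow_zero hκ hγ0 (s := 1) (by linarith)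
  have hkey := BranchingRandomWalk.tendsto_loglog hb1 hγ0 (div_pos hL0 hl0)
    (f := fun n => P.real {ω | p ≤ BranchingRandomWalk.empirical
      (fun u => N u ω) (fun u => X u ω) n (Real.sqrt (n : ℝ) • A)}) ?_ ?_
  · rwa [← hl, div_mul_cancel₀ _ hl0.ne'] at hkey
  · intro κ hκ hκL
    obtain ⟨κ', h1, h2⟩ := exists_between hκL
    have hκ' : 0 < κ' := hκ.trans h1
    have h3 := hmono hκ' h2
    rw [hcrit] at h3
    obtain ⟨R', h4, h5⟩ := exists_between h3
    -- With this `η` the slack factor `(1 + η) ^ (1 / α + 1)` turns `κ` into the still subcritical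
    -- `κ'`.
    have hη : 0 < κ' / κ - 1 := by
      rw [sub_pos, one_lt_div hκ]
      exact h1
    refine h_brw.exists_eventually_measure_le h_off0 h_off1 h_offexp h_symm h_var h_alpha h_tail h_A
      h_p h_p1 h_fin h_cont (R' := R') (η := κ' / κ - 1) (lt_trans (by positivity) h4) h5 hη
      (BranchingRandomWalk.tendsto_ceil_rpow hκ hγ0) (hTn hκ) ?_
    have hlim := (BranchingRandomWalk.tendsto_ceil_mul_rpow_div_sqrt h_alpha hκ hl0).const_mul
      ((κ' / κ) ^ (1 / α + 1) * y⁻¹)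
    have hval : (κ' / κ) ^ (1 / α + 1) * y⁻¹ * (κ ^ (1 / α + 1) * l ^ (1 / α)) =
        y⁻¹ * (κ' ^ (1 / α + 1) * l ^ (1 / α)) := by
      have := (Real.rpow_pos_of_pos hκ (1 / α + 1)).ne'
      rw [Real.div_rpow hκ'.le hκ.le]
      field_simp
    rw [hval] at hlim
    filter_upwards [hlim.eventually (gt_mem_nhds h4), eventually_gt_atTop 0] with n hn hn0
    have hsq : 0 < Real.sqrt (n : ℝ) := Real.sqrt_pos.2 (by exact_mod_cast hn0)
    rw [← mul_div_assoc, div_lt_iff₀ hsq] at hn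
    refine lt_of_eq_of_lt ?_ hn
    rw [add_sub_cancel]
    ring
  · intro κ hκL
    obtain ⟨κ', h1, h2⟩ := exists_between hκL
    have hκ' : 0 < κ' := (div_pos hL0 hl0).trans h1
    have hκ : 0 < κ := hκ'.trans h2
    have h3 := hmono (div_pos hL0 hl0) h1
    rw [hcrit] at h3
    obtain ⟨R, h4, h5⟩ := exists_between h3
    -- With this value of `J` the supercritical `κ` is reduced to `κ'`, which still reaches beyond
    -- `R`.
    have hJ : (κ' / κ) ^ (1 / α + 1) * y⁻¹ < y⁻¹ := by
      refine mul_lt_of_lt_one_left (inv_pos.2 hy) (Real.rpow_lt_one (by positivity) ?_ hβ)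
      rwa [div_lt_one hκ]
    refine h_brw.exists_eventually_le_measure h_off0 h_off1 h_offexp h_symm h_var h_alpha h_tail h_A
      h_p h_p1 h_fin h_cont (R := R) h4 hJ
      (BranchingRandomWalk.tendsto_ceil_rpow hκ hγ0) (hTn hκ) ?_ ?_
    · simpa only [Real.sqrt_eq_rpow] using
        BranchingRandomWalk.tendsto_ceil_div_rpow_zero hκ hγ0 hγ1
    have hlim := (BranchingRandomWalk.tendsto_ceil_mul_rpow_div_sqrt h_alpha hκ hl0).const_mul
      ((κ' / κ) ^ (1 / α + 1) * y⁻¹)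
    have hval : (κ' / κ) ^ (1 / α + 1) * y⁻¹ * (κ ^ (1 / α + 1) * l ^ (1 / α)) =
        y⁻¹ * (κ' ^ (1 / α + 1) * l ^ (1 / α)) := by
      have := (Real.rpow_pos_of_pos hκ (1 / α + 1)).ne'
      rw [Real.div_rpow hκ'.le hκ.le]
      field_simp
    rw [hval] at hlim
    filter_upwards [hlim.eventually (lt_mem_nhds h5), eventually_gt_atTop 0] with n hn hn0
    have hsq : 0 < Real.sqrt (n : ℝ) := Real.sqrt_pos.2 (by exact_mod_cast hn0)
    rw [← mul_div_assoc, lt_div_iff₀ hsq] at hn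
    exact hn.le
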